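/- **Setting.** Two-sorted vocabulary $\mathcal L_A^2$: number variables (over $\mathbb N$), string variables (over finite subsets of $\mathbb N$), symbols $0,1,+,\cdot,\le$, length $|X|$ ($0$ if $X=\emptyset$, else $1+\max X$), $X(t)$ (meaning $t\in X$), and equality for both sorts. $\Sigma_0^B$-formulas have no string quantifiers and only bounded number quantifiers. $\mathsf V^0$ is axiomatized by the 2-BASIC axioms of Cook–Nguyen (B1–B12, L1, L2, SE) and comprehension $\exists X\le y\,\forall z<y\,(X(z)\leftrightarrow\varphi(z))$ for $\Sigma_0^B$-formulas $\varphi$ in which $X$ is not free. With $\langle x,y\rangle=(x+y)(x+y+1)+2y$, write $Z(x,y)$ for $Z(\langle x,y\rangle)$, and let $(X)^i$ be the least $y$ with $X(i,y)$, or $|X|$ if there is none. $\mathsf{VCC}^*$ is $\mathsf V^0$ together with the axiom $\exists Z\le\langle m,n+1\rangle+1\ \delta_{\mathsf{CCV}}(m,n,X,Y,Z)$, where $\delta_{\mathsf{CCV}}$ says: $Z(0,i)\leftrightarrow Y(i)$ for $i<m$; and whenever $i<n$, $x,y<m$ and $(X)^i=\langle x,y\rangle$, then $Z(i+1,x)\leftrightarrow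 Z(i,x)\wedge Z(i,y)$, $Z(i+1,y)\leftrightarrow Z(i,x)\vee Z(i,y)$, and $Z(i+1,j)\leftrightarrow Z(i,j)$ for all $j<m$ with $j\ne x,y$. $T\vdash\varphi$ means that $\varphi$ is a logical consequence of (the universal closures of) the axioms of $T$. A two-sorted relation $R(\vec x,\vec X)$ is in $\mathsf{AC}^0$ if it is represented by a $\Sigma_0^B$-formula (in the standard structure). A number (string) function is in $\mathsf{FAC}^0$ if its value (length) is bounded by a polynomial in $\vec x,|\vec X|$ and its graph (bit graph) is in $\mathsf{AC}^0$. $R$ is many-one $\mathsf{AC}^0$-reducible to $S$ if $R(\vec x,\vec X)\leftrightarrow S(\vec f(\vec x,\vec X),\vec F(\vec x,\vec X))$ for some $\vec f,\vec F$ in $\mathsf{FAC}^0$. **Problems.** A comparator gate $\langle x,y\rangle$ replaces the bits $p,q$ on wires $x,y$ by $p\wedge q$ on $x$ and $p\vee q$ on $y$ ($x=y$ is allowed and does nothing). *Ccv*: given a comparator circuit with $m$ wires (a sequence of $n$ gates), an input and a wire $w<m$, does $w$ output $1$? *Ccv¬*: the same for circuits which may also contain negation gates, flipping the bit on a wire.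 The lfm-matching of a bipartite graph with bottom nodes $v_0,\dots,v_{m-1}$, top nodes $w_0,\dots,w_{n-1}$ and edge matrix $E$ is the matching produced by successively matching $v_0,\dots,v_{m-1}$ to the least available adjacent top node. *Lfmm*: does a designated edge belong to the lfm-matching? *vLfmm*: is a designated top node matched in the lfm-matching? *3Lfmm*, *3vLfmm*: the restrictions of these to graphs of degree at most three. Inputs that do not encode an instance are "no" inputs. Each problem is expressed in $\mathcal L_A^2$ by a formula asserting that the input encodes an instance and that there is a bounded string coding the layers $Z$ of the circuit computation (satisfying $\delta_{\mathsf{CCV}}$, or its analogue with negation gates), respectively the lfm-matching $L$ (satisfying, for all $i<m$, $j<n$: $L(i,j)$ iff $E(i,j)$, no $k<j$ has $L(i,k)$, no $\ell<i$ has $L(\ell,j)$, and each $k<j$ has $\neg E(i,k)$ or $L(i',k)$ for some $i'<i$), that gives the answer "yes". **Statement.** 1. Each of the six formulas represents the corresponding problem in the standard structure. 2. The six problems *Ccv*, *3vLfmm*, *vLfmm*, *Ccv¬*, *3Lfmm*, *Lfmm* are, provably in $\mathsf{VCC}^*$, equivalent under many-one $\mathsf{AC}^0$-reductions: for any two of them,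 with formulas $P(\vec x,\vec X)$ and $Q(\vec y,\vec Y)$, there are number functions $\vec f$ and string functions $\vec F$, with $\Sigma_0^B$-defined graphs, respectively bit graphs, and bounded by number terms, such that $\mathsf V^0$ proves their totality and $$\mathsf{VCC}^*\vdash P(\vec x,\vec X)\leftrightarrow Q(\vec f(\vec x,\vec X),\vec F(\vec x,\vec X)).$$ 3. Each of the six problems $R$, in particular *Lfmm*, *vLfmm*, *3Lfmm* and *3vLfmm*, is $\mathsf{CC}$-complete: the class $\mathsf{CC}$ of all relations many-one $\mathsf{AC}^0$-reducible to *Ccv* equals the class of all relations many-one $\mathsf{AC}^0$-reducible to $R$. -/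

import Mathlib

universe u

namespace TwoSorted

/-! ## The two-sorted vocabulary: terms and formulas

`NTerm k l` and `Formula k l` are number terms and formulas whose free number variables are
numbered `0, …, k-1` and whose free string variables are numbered `0, …, l-1`.  A quantifier over
numbers (strings) binds the number variable `k` (string variable `l`) of its body, so that a
variable keeps its number under further quantifiers. -/

/-- Number terms: built from `0`, `1`, number variables and lengths `|X|` by `+` and `·`. -/
inductive NTerm (k l : ℕ) : Type
  | var : Fin k → NTerm k l
  | zero : NTerm k l
  | one : NTerm k l
  | add : NTerm k l → NTerm k l → NTerm k l
  | mul : NTerm k l → NTerm k l → NTerm k l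
  | len : Fin l → NTerm k l

instance (k l : ℕ) : Zero (NTerm k l) := ⟨NTerm.zero⟩
instance (k l : ℕ) : One (NTerm k l) := ⟨NTerm.one⟩
instance (k l : ℕ) : Add (NTerm k l) := ⟨NTerm.add⟩
instance (k l : ℕ) : Mul (NTerm k l) := ⟨NTerm.mul⟩

/-- Formulas.  The only string terms are the string variables. -/
inductive Formula : ℕ → ℕ → Type
  | eq {k l : ℕ} : NTerm k l → NTerm k l → Formula k l
  | le {k l : ℕ} : NTerm k l → NTerm k l → Formula k l
  | strEq {k l : ℕ} : Fin l → Fin l → Formula k l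
  | mem {k l : ℕ} : NTerm k l → Fin l → Formula k l
  | neg {k l : ℕ} : Formula k l → Formula k l
  | and {k l : ℕ} : Formula k l → Formula k l → Formula k l
  | or {k l : ℕ} : Formula k l → Formula k l → Formula k l
  | exN {k l : ℕ} : Formula (k + 1) l → Formula k l
  | allN {k l : ℕ} : Formula (k + 1) l → Formula k l
  | exS {k l : ℕ} : Formula k (l + 1) → Formula k l
  | allS {k l : ℕ} : Formula k (l + 1) → Formula k l

/-- Extension of a renaming of variables to one more variable, the last one. -/
def extendRen {a b : ℕ} (f : Fin a → Fin b) : Fin (a + 1) → Fin (b + 1) :=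
  Fin.snoc (α := fun _ => Fin (b + 1)) (fun i => (f i).castSucc) (Fin.last b)

/-- Renaming of the variables of a term. -/
def NTerm.rename {k l k' l' : ℕ} (f : Fin k → Fin k') (g : Fin l → Fin l') :
    NTerm k l → NTerm k' l'
  | .var i => .var (f i)
  | .zero => .zero
  | .one => .one
  | .add t u => .add (t.rename f g) (u.rename f g)
  | .mul t u => .mul (t.rename f g) (u.rename f g)
  | .len X => .len (g X)

/-- Renaming of the free variables of a formula (capture is impossible). -/
def Formula.rename : {k l k' l' : ℕ} → (Fin k → Fin k') → (Fin l → Fin l') →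
    Formula k l → Formula k' l'
  | _, _, _, _, f, g, .eq t u => .eq (t.rename f g) (u.rename f g)
  | _, _, _, _, f, g, .le t u => .le (t.rename f g) (u.rename f g)
  | _, _, _, _, _, g, .strEq X Y => .strEq (g X) (g Y)
  | _, _, _, _, f, g, .mem t X => .mem (t.rename f g) (g X)
  | _, _, _, _, f, g, .neg φ => .neg (φ.rename f g)
  | _, _, _, _, f, g, .and φ ψ => .and (φ.rename f g) (ψ.rename f g)
  | _, _, _, _, f, g, .or φ ψ => .or (φ.rename f g) (ψ.rename f g)
  | _, _, _, _, f, g, .exN φ => .exN (φ.rename (extendRen f) g)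
  | _, _, _, _, f, g, .allN φ => .allN (φ.rename (extendRen f) g)
  | _, _, _, _, f, g, .exS φ => .exS (φ.rename f (extendRen g))
  | _, _, _, _, f, g, .allS φ => .allS (φ.rename f (extendRen g))

/-- Weakening of a term by one number variable. -/
def NTerm.liftN {k l : ℕ} (t : NTerm k l) : NTerm (k + 1) l := t.rename Fin.castSucc id

/-- Weakening of a term by one string variable. -/
def NTerm.liftS {k l : ℕ} (t : NTerm k l) : NTerm k (l + 1) := t.rename id Fin.castSucc

/-- Weakening of a formula by one number variable. -/
def Formula.liftN {k l : ℕ} (φ : Formula k l) : Formula (k + 1) l := φ.rename Fin.castSucc id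

/-- Weakening of a formula by one string variable. -/
def Formula.liftS {k l : ℕ} (φ : Formula k l) : Formula k (l + 1) := φ.rename id Fin.castSucc

/-- Implication. -/
def Formula.imp {k l : ℕ} (φ ψ : Formula k l) : Formula k l := .or (.neg φ) ψ

/-- Equivalence. -/
def Formula.iff {k l : ℕ} (φ ψ : Formula k l) : Formula k l := .and (φ.imp ψ) (ψ.imp φ)

infixr:35 " ⋏ " => Formula.and
infixr:30 " ⋎ " => Formula.or
infixr:25 " ➝ " => Formula.imp
infix:20 " ⭤ " => Formula.iff
prefix:max "∼" => Formula.neg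

/-- `t < u` abbreviates `t ≤ u ∧ t ≠ u`. -/
def Formula.lt {k l : ℕ} (t u : NTerm k l) : Formula k l := .le t u ⋏ ∼(.eq t u)

/-- `∃ x ≤ t, φ`, where `x` is the last number variable of `φ` and does not occur in `t`. -/
def Formula.exLe {k l : ℕ} (t : NTerm k l) (φ : Formula (k + 1) l) : Formula k l :=
  .exN (.le (.var (Fin.last k)) t.liftN ⋏ φ)

/-- `∀ x ≤ t, φ`. -/
def Formula.allLe {k l : ℕ} (t : NTerm k l) (φ : Formula (k + 1) l) : Formula k l :=
  .allN (.le (.var (Fin.last k)) t.liftN ➝ φ)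

/-- `∃ x < t, φ`. -/
def Formula.exLt {k l : ℕ} (t : NTerm k l) (φ : Formula (k + 1) l) : Formula k l :=
  .exLe t (∼(.eq (.var (Fin.last k)) t.liftN) ⋏ φ)

/-- `∀ x < t, φ`. -/
def Formula.allLt {k l : ℕ} (t : NTerm k l) (φ : Formula (k + 1) l) : Formula k l :=
  .allLe t (∼(.eq (.var (Fin.last k)) t.liftN) ➝ φ)

/-- `∃ X ≤ t, φ`, that is `∃ X (|X| ≤ t ∧ φ)`, where `X` is the last string variable of `φ`. -/
def Formula.exSLe {k l : ℕ} (t : NTerm k l) (φ : Formula k (l + 1)) : Formula k l :=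
  .exS (.le (.len (Fin.last l)) t.liftS ⋏ φ)

/-- `∃! x, φ`. -/
def Formula.exUniqueN {k l : ℕ} (φ : Formula (k + 1) l) : Formula k l :=
  .exN (φ ⋏ .allN (φ.rename (extendRen Fin.castSucc) id ➝
    .eq (.var (Fin.last (k + 1))) (.var (Fin.last k).castSucc)))

/-- `∃! X, φ`. -/
def Formula.exUniqueS {k l : ℕ} (φ : Formula k (l + 1)) : Formula k l :=
  .exS (φ ⋏ .allS (φ.rename id (extendRen Fin.castSucc) ➝
    .strEq (Fin.last (l + 1)) (Fin.last l).castSucc))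

/-- Finite conjunctions. -/
def Formula.conj {k l : ℕ} : {n : ℕ} → (Fin n → Formula k l) → Formula k l
  | 0, _ => .eq 0 0
  | _ + 1, φ => φ 0 ⋏ Formula.conj (fun i => φ i.succ)

/-- The `Σ₀ᴮ`-formulas: no string quantifiers, and only bounded number quantifiers. -/
inductive Formula.IsSigmaZeroB : {k l : ℕ} → Formula k l → Prop
  | eq {k l : ℕ} (t u : NTerm k l) : IsSigmaZeroB (.eq t u)
  | le {k l : ℕ} (t u : NTerm k l) : IsSigmaZeroB (.le t u)
  | strEq {k l : ℕ} (X Y : Fin l) : IsSigmaZeroB (.strEq X Y : Formula k l)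
  | mem {k l : ℕ} (t : NTerm k l) (X : Fin l) : IsSigmaZeroB (.mem t X)
  | neg {k l : ℕ} {φ : Formula k l} : IsSigmaZeroB φ → IsSigmaZeroB (.neg φ)
  | and {k l : ℕ} {φ ψ : Formula k l} : IsSigmaZeroB φ → IsSigmaZeroB ψ → IsSigmaZeroB (.and φ ψ)
  | or {k l : ℕ} {φ ψ : Formula k l} : IsSigmaZeroB φ → IsSigmaZeroB ψ → IsSigmaZeroB (.or φ ψ)
  | exLe {k l : ℕ} (t : NTerm k l) {φ : Formula (k + 1) l} :
      IsSigmaZeroB φ → IsSigmaZeroB (.exLe t φ)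
  | allLe {k l : ℕ} (t : NTerm k l) {φ : Formula (k + 1) l} :
      IsSigmaZeroB φ → IsSigmaZeroB (.allLe t φ)

/-! ## Structures, theories, and theorems of a theory -/


/-- Two-sorted structures.  Both equality symbols are interpreted by true equality. -/
structure Structure : Type (u + 1) where
  Num : Type u
  Str : Type u
  strNonempty : Nonempty Str
  zero : Num
  one : Num
  add : Num → Num → Num
  mul : Num → Num → Num
  le : Num → Num → Prop
  len : Str → Num
  mem : Num → Str → Prop

/-- The value of a term. -/
def NTerm.eval (M : Structure.{u}) {k l : ℕ} (v : Fin k → M.Num) (V : Fin l → M.Str) :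
    NTerm k l → M.Num
  | .var i => v i
  | .zero => M.zero
  | .one => M.one
  | .add t u => M.add (t.eval M v V) (u.eval M v V)
  | .mul t u => M.mul (t.eval M v V) (u.eval M v V)
  | .len X => M.len (V X)

/-- Truth of a formula in a structure under an assignment to its free variables. -/
def Formula.Realize (M : Structure.{u}) : {k l : ℕ} → Formula k l →
    (Fin k → M.Num) → (Fin l → M.Str) → Prop
  | _, _, .eq t u, v, V => t.eval M v V = u.eval M v V
  | _, _, .le t u, v, V => M.le (t.eval M v V) (u.eval M v V)
  | _, _, .strEq X Y, _, V => V X = V Y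
  | _, _, .mem t X, v, V => M.mem (t.eval M v V) (V X)
  | _, _, .neg φ, v, V => ¬ φ.Realize M v V
  | _, _, .and φ ψ, v, V => φ.Realize M v V ∧ ψ.Realize M v V
  | _, _, .or φ ψ, v, V => φ.Realize M v V ∨ ψ.Realize M v V
  | k, _, .exN φ, v, V =>
      ∃ a : M.Num, φ.Realize M (Fin.snoc (α := fun _ : Fin (k + 1) => M.Num) v a) V
  | k, _, .allN φ, v, V =>
      ∀ a : M.Num, φ.Realize M (Fin.snoc (α := fun _ : Fin (k + 1) => M.Num) v a) V
  | _, l, .exS φ, v, V =>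
      ∃ A : M.Str, φ.Realize M v (Fin.snoc (α := fun _ : Fin (l + 1) => M.Str) V A)
  | _, l, .allS φ, v, V =>
      ∀ A : M.Str, φ.Realize M v (Fin.snoc (α := fun _ : Fin (l + 1) => M.Str) V A)

/-- `M ⊨ φ`: the universal closure of `φ` is true in `M`. -/
def Structure.Satisfies (M : Structure.{u}) {k l : ℕ} (φ : Formula k l) : Prop :=
  ∀ (v : Fin k → M.Num) (V : Fin l → M.Str), φ.Realize M v V

/-- A set of nonlogical statements, each understood as its universal closure. -/
abbrev Theory := Set (Σ k l : ℕ, Formula k l)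

/-- `T ⊢ φ`.  As usual for two-sorted theories, a theory consists of all logical consequences of
the formulas given for it, over all two-sorted structures (of any universe level `u`), standard
and nonstandard. -/
def Theory.Proves (T : Theory) {k l : ℕ} (φ : Formula k l) : Prop :=
  ∀ M : Structure.{u}, (∀ p ∈ T, M.Satisfies p.2.2) → M.Satisfies φ

/-! ## The theories `V⁰` and `VCC*` -/

/-- The set 2-BASIC: B1 – B12, L1, L2, SE. -/
def twoBasic : Theory :=
  { ⟨1, 0, ∼(.eq (.var 0 + 1) 0)⟩,
    ⟨2, 0, .eq (.var 0 + 1) (.var 1 + 1) ➝ .eq (.var 0) (.var 1)⟩,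
    ⟨1, 0, .eq (.var 0 + 0) (.var 0)⟩,
    ⟨2, 0, .eq (.var 0 + (.var 1 + 1)) ((.var 0 + .var 1) + 1)⟩,
    ⟨1, 0, .eq (.var 0 * 0) 0⟩,
    ⟨2, 0, .eq (.var 0 * (.var 1 + 1)) ((.var 0 * .var 1) + .var 0)⟩,
    ⟨2, 0, (.le (.var 0) (.var 1) ⋏ .le (.var 1) (.var 0)) ➝ .eq (.var 0) (.var 1)⟩,
    ⟨2, 0, .le (.var 0) (.var 0 + .var 1)⟩,
    ⟨1, 0, .le 0 (.var 0)⟩,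
    ⟨2, 0, .le (.var 0) (.var 1) ⋎ .le (.var 1) (.var 0)⟩,
    ⟨2, 0, .le (.var 0) (.var 1) ⭤ .lt (.var 0) (.var 1 + 1)⟩,
    ⟨1, 0, ∼(.eq (.var 0) 0) ➝ .exLe (.var 0) (.eq (.var 1 + 1) (.var 0))⟩,
    ⟨1, 1, .mem (.var 0) 0 ➝ .lt (.var 0) (.len 0)⟩,
    ⟨1, 1, .eq (.var 0 + 1) (.len 0) ➝ .mem (.var 0) 0⟩,
    ⟨0, 2, (.eq (.len 0) (.len 1) ⋏ .allLt (.len 0) (.mem (.var 0) 0 ⭤ .mem (.var 0) 1)) ➝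
      .strEq 0 1⟩ }

/-- The comprehension formula `∃ X ≤ y, ∀ z < y, (X(z) ↔ φ(z))`; here `y` is one of the number
variables, `z` is the last number variable of `φ`, and the new string variable `X` is not
free in `φ`. -/
def comprehension {k l : ℕ} (y : Fin k) (φ : Formula (k + 1) l) : Formula k l :=
  .exSLe (.var y) (.allLt (.var y) (.mem (.var (Fin.last k)) (Fin.last l) ⭤ φ.liftS))

/-- The scheme `Σ₀ᴮ`-COMP. -/
def sigmaZeroBComp : Theory :=
  {p | ∃ (k l : ℕ) (y : Fin k) (φ : Formula (k + 1) l),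
    φ.IsSigmaZeroB ∧ p = ⟨k, l, comprehension y φ⟩}

/-- The theory `V⁰`. -/
def VZero : Theory := twoBasic ∪ sigmaZeroBComp

/-- The pairing term `⟨t, u⟩ = (t + u)(t + u + 1) + 2u`. -/
def NTerm.pair {k l : ℕ} (t u : NTerm k l) : NTerm k l :=
  (t + u) * (t + u + 1) + (1 + 1) * u

/-- `X(t, u)`, that is `X(⟨t, u⟩)`. -/
def Formula.memPair {k l : ℕ} (X : Fin l) (t u : NTerm k l) : Formula k l := .mem (t.pair u) X

/-- `s = (X)ᵗ`: `s` is entry number `t` of the sequence of numbers encoded by `X`, namely the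
least `s` with `X(t, s)`, and `|X|` if there is none. -/
def Formula.seqEntry {k l : ℕ} (X : Fin l) (t s : NTerm k l) : Formula k l :=
  (.lt s (.len X) ⋏ .memPair X t s ⋏ .allLt s ∼(.memPair X t.liftN (.var (Fin.last k)))) ⋎
  (.allLt (.len X) ∼(.memPair X t.liftN (.var (Fin.last k))) ⋏ .eq s (.len X))

/-- `δ_CCV(m, n, X, Y, Z)`: number variables `m = 0`, `n = 1` (wires, gates); string variables
`X = 0`, `Y = 1`, `Z = 2` (gates, input, layers).  Bound: `i = 2` in the first conjunct;
`i = 2`, `x = 3`, `y = 4`, `j = 5` in the second. -/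
def deltaCCV : Formula 2 3 :=
  .allLt (.var 0) (.mem (.var 2) 1 ⭤ .memPair 2 0 (.var 2)) ⋏
  .allLt (.var 1) (.allLt (.var 0) (.allLt (.var 0)
    (.seqEntry 0 (.var 2) (.pair (.var 3) (.var 4)) ➝
      ((.memPair 2 (.var 2 + 1) (.var 3) ⭤
          (.memPair 2 (.var 2) (.var 3) ⋏ .memPair 2 (.var 2) (.var 4))) ⋏
       (.memPair 2 (.var 2 + 1) (.var 4) ⭤
          (.memPair 2 (.var 2) (.var 3) ⋎ .memPair 2 (.var 2) (.var 4))) ⋏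
       .allLt (.var 0) ((∼(.eq (.var 5) (.var 3)) ⋏ ∼(.eq (.var 5) (.var 4))) ➝
          (.memPair 2 (.var 2 + 1) (.var 5) ⭤ .memPair 2 (.var 2) (.var 5)))))))

/-- `CCV`: `∃ Z ≤ ⟨m, n+1⟩ + 1, δ_CCV(m, n, X, Y, Z)`. -/
def formulaCCV : Formula 2 2 := .exSLe (.pair (.var 0) (.var 1 + 1) + 1) deltaCCV

/-- The theory `VCC*`. -/
def VCCStar : Theory := VZero ∪ {⟨2, 2, formulaCCV⟩}

/-! ## Provable many-one `AC⁰` reductions -/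

/-- The graph `y = f(x, X)` of a number function: `y ≤ s ∧ φ(y)`. -/
def numGraph {k l : ℕ} (s : NTerm k l) (φ : Formula (k + 1) l) : Formula (k + 1) l :=
  .le (.var (Fin.last k)) s.liftN ⋏ φ

/-- The graph `Y = F(x, X)` of a string function with bit graph `ψ`:
`|Y| ≤ t ∧ ∀ i < t, (Y(i) ↔ ψ(i))`. -/
def strGraph {k l : ℕ} (t : NTerm k l) (ψ : Formula (k + 1) l) : Formula k (l + 1) :=
  .le (.len (Fin.last l)) t.liftS ⋏
  .allLt t.liftS (.mem (.var (Fin.last k)) (Fin.last l) ⭤ ψ.liftS)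

/-- The formula saying that, if `y = f(x, X)` and `Y = F(x, X)` (for tuples of functions given by
`s, φ` and `t, ψ`), then `P(x, X) ↔ Q(y, Y)`.  The variables `x, y` are the number variables
`0, …, k-1` and `k, …, k+k'-1`, and likewise for the strings. -/
def reductionFormula {k l k' l' : ℕ} (P : Formula k l) (Q : Formula k' l')
    (s : Fin k' → NTerm k l) (φ : Fin k' → Formula (k + 1) l)
    (t : Fin l' → NTerm k l) (ψ : Fin l' → Formula (k + 1) l) : Formula (k + k') (l + l') :=
  (Formula.conj (fun a => (numGraph (s a) (φ a)).rename
      (Fin.snoc (α := fun _ => Fin (k + k')) (Fin.castAdd k') (Fin.natAdd k a))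
      (Fin.castAdd l')) ⋏
   Formula.conj (fun b => (strGraph (t b) (ψ b)).rename
      (Fin.castAdd k')
      (Fin.snoc (α := fun _ => Fin (l + l')) (Fin.castAdd l') (Fin.natAdd l b)))) ➝
  (P.rename (Fin.castAdd k') (Fin.castAdd l') ⭤ Q.rename (Fin.natAdd k) (Fin.natAdd l))

/-- `T` proves that the problem expressed by `P` is many-one `AC⁰` reducible to the problem
expressed by `Q`: there are `AC⁰` functions, given by `Σ₀ᴮ` definitions with number terms as
bounds that are provably total in `V⁰`, which `T` proves to be a reduction. -/
def ProvablyReduces (T : Theory) {k l k' l' : ℕ} (P : Formula k l) (Q : Formula k' l') : Prop :=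
  ∃ (s : Fin k' → NTerm k l) (φ : Fin k' → Formula (k + 1) l)
    (t : Fin l' → NTerm k l) (ψ : Fin l' → Formula (k + 1) l),
    (∀ a, (φ a).IsSigmaZeroB ∧ VZero.Proves.{u} (numGraph (s a) (φ a)).exUniqueN) ∧
    (∀ b, (ψ b).IsSigmaZeroB ∧ VZero.Proves.{u} (strGraph (t b) (ψ b)).exUniqueS) ∧
    T.Proves.{u} (reductionFormula P Q s φ t ψ)

/-! ## The standard structure, `AC⁰`, and `CC` -/

/-- `|X|`: zero if `X` is empty, and `1 + max X` otherwise. -/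
def strLen (X : Finset ℕ) : ℕ := X.sup (fun i => i + 1)

/-- The standard structure: natural numbers and finite sets of natural numbers. -/
def standard : Structure.{0} where
  Num := ℕ
  Str := Finset ℕ
  strNonempty := ⟨∅⟩
  zero := 0
  one := 1
  add := fun a b => a + b
  mul := fun a b => a * b
  le := fun a b => a ≤ b
  len := strLen
  mem := fun a X => a ∈ X

/-- Two-sorted relations (decision problems). -/
abbrev Relation (k l : ℕ) := (Fin k → ℕ) → (Fin l → Finset ℕ) → Prop

/-- A formula represents a relation: it defines it in the standard structure. -/
def Represents {k l : ℕ} (φ : Formula k l) (R : Relation k l) : Prop :=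
  ∀ (x : Fin k → ℕ) (X : Fin l → Finset ℕ), φ.Realize standard x X ↔ R x X

/-- Two-sorted (uniform) `AC⁰`: the relations represented by a `Σ₀ᴮ`-formula, i.e. first-order
definable with `+`, `·` and `≤`. -/
def InACZero {k l : ℕ} (R : Relation k l) : Prop :=
  ∃ φ : Formula k l, φ.IsSigmaZeroB ∧ Represents φ R

/-- `AC⁰` number functions: bounded by a polynomial in the `x`s and the `|X|`s (these polynomials
are the number terms), with graph in `AC⁰`. -/
def InFACZeroNum {k l : ℕ} (f : (Fin k → ℕ) → (Fin l → Finset ℕ) → ℕ) : Prop :=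
  (∃ t : NTerm k l, ∀ x X, f x X ≤ t.eval standard x X) ∧
  InACZero (fun (v : Fin (k + 1) → ℕ) (X : Fin l → Finset ℕ) =>
    v (Fin.last k) = f (fun i => v i.castSucc) X)

/-- `AC⁰` string functions: polynomially bounded length, with bit graph in `AC⁰`. -/
def InFACZeroStr {k l : ℕ} (F : (Fin k → ℕ) → (Fin l → Finset ℕ) → Finset ℕ) : Prop :=
  (∃ t : NTerm k l, ∀ x X, strLen (F x X) ≤ t.eval standard x X) ∧
  InACZero (fun (v : Fin (k + 1) → ℕ) (X : Fin l → Finset ℕ) =>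
    v (Fin.last k) ∈ F (fun i => v i.castSucc) X)

/-- Many-one `AC⁰` reducibility. -/
def ManyOneReduces {k l k' l' : ℕ} (R : Relation k l) (S : Relation k' l') : Prop :=
  ∃ (f : Fin k' → (Fin k → ℕ) → (Fin l → Finset ℕ) → ℕ)
    (F : Fin l' → (Fin k → ℕ) → (Fin l → Finset ℕ) → Finset ℕ),
    (∀ a, InFACZeroNum (f a)) ∧ (∀ b, InFACZeroStr (F b)) ∧
    ∀ x X, R x X ↔ S (fun a => f a x X) (fun b => F b x X)

/-! ## The six problems, as relations -/

/-- The pairing function. -/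
def pairCode (x y : ℕ) : ℕ := (x + y) * (x + y + 1) + 2 * y

/-- The entry `(X)ⁱ` of the sequence encoded by `X`. -/
def seqVal (X : Finset ℕ) (i : ℕ) : ℕ :=
  if h : ((Finset.range (strLen X)).filter (fun y => pairCode i y ∈ X)).Nonempty then
    ((Finset.range (strLen X)).filter (fun y => pairCode i y ∈ X)).min' h
  else strLen X

/-- Gates on `m` wires: comparator gates and negation gates. -/
inductive Gate (m : ℕ) : Type
  | comparator : Fin m → Fin m → Gate m
  | negation : Fin m → Gate m

/-- The effect of a gate on the values of the wires.  A comparator gate `⟨x, y⟩` leaves the smaller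
bit on `x` and the larger bit on `y`. -/
def Gate.step {m : ℕ} (s : Fin m → Bool) : Gate m → (Fin m → Bool)
  | .comparator x y => fun j => if j = x then s x && s y else if j = y then s x || s y else s j
  | .negation x => fun j => if j = x then !(s x) else s j

/-- The values of the wires after all gates of the circuit `C`. -/
def runCircuit {m : ℕ} (C : List (Gate m)) (s : Fin m → Bool) : Fin m → Bool :=
  C.foldl Gate.step s

/-- Gate number `i` encoded by `G`, `N` is `g`: `i ∈ N` marks the negation gates, `(G)ⁱ` is
`⟨x, y⟩` for a comparator gate and `x` for a negation gate. -/
def EncodesGate {m : ℕ} (G N : Finset ℕ) (i : ℕ) : Gate m → Prop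
  | .comparator x y => i ∉ N ∧ seqVal G i = pairCode x y
  | .negation x => i ∈ N ∧ seqVal G i = x

/-- `G`, `N` encode a circuit with `m` wires and `n` gates which outputs one on wire `w` for the
input `I`. -/
def CircuitAccepts (m n w : ℕ) (G I N : Finset ℕ) : Prop :=
  ∃ (hw : w < m) (C : List (Gate m)), C.length = n ∧
    (∀ (i : ℕ) (hi : i < C.length), EncodesGate G N i C[i]) ∧
    runCircuit C (fun j => decide ((j : ℕ) ∈ I)) ⟨w, hw⟩ = true

/-- The lfm-matching of the bipartite graph with `n` top nodes and edge matrix `E`, after the bottom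
nodes `0, …, i-1` have successively been matched to the least available top node. -/
def lfmMatching (n : ℕ) (E : Finset ℕ) : ℕ → Finset (ℕ × ℕ)
  | 0 => ∅
  | i + 1 =>
    let M := lfmMatching n E i
    let A := (Finset.range n).filter (fun j => pairCode i j ∈ E ∧ j ∉ M.image Prod.snd)
    if h : A.Nonempty then insert (i, A.min' h) M else M

/-- All nodes of the bipartite graph with `m` bottom nodes, `n` top nodes and edge matrix `E` have
degree at most three. -/
def DegreeLeThree (m n : ℕ) (E : Finset ℕ) : Prop :=
  (∀ i < m, ((Finset.range n).filter (fun j => pairCode i j ∈ E)).card ≤ 3) ∧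
  (∀ j < n, ((Finset.range m).filter (fun i => pairCode i j ∈ E)).card ≤ 3)

/-- Names of the six problems. -/
inductive Problem : Type
  | ccv | threeVLfmm | vLfmm | ccvNeg | threeLfmm | lfmm

/-- Number of number arguments: `(m, n, w)` for the circuit problems, `(m, n, j)` for the vertex
versions and `(m, n, i, j)` for the edge versions of the matching problems. -/
def Problem.numArity : Problem → ℕ
  | .ccv => 3
  | .threeVLfmm => 3
  | .vLfmm => 3
  | .ccvNeg => 3
  | .threeLfmm => 4
  | .lfmm => 4

/-- Number of string arguments: `(G, I)` for `ccv`, `(G, I, N)` for `ccvNeg`, `(E)` for the matching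
problems. -/
def Problem.strArity : Problem → ℕ
  | .ccv => 2
  | .threeVLfmm => 1
  | .vLfmm => 1
  | .ccvNeg => 3
  | .threeLfmm => 1
  | .lfmm => 1

/-- The comparator circuit value problem. -/
def relCcv : Relation 3 2 := fun x X => CircuitAccepts (x 0) (x 1) (x 2) (X 0) (X 1) ∅

/-- The comparator circuit value problem with negation gates. -/
def relCcvNeg : Relation 3 3 := fun x X =>
  CircuitAccepts (x 0) (x 1) (x 2) (X 0) (X 1) (X 2)

/-- Is the top node `j` matched in the lfm-matching? -/
def relVLfmm : Relation 3 1 := fun x X =>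
  x 2 < x 1 ∧ ∃ i, (i, x 2) ∈ lfmMatching (x 1) (X 0) (x 0)

/-- Does the edge `(i, j)` belong to the lfm-matching? -/
def relLfmm : Relation 4 1 := fun x X =>
  x 2 < x 0 ∧ x 3 < x 1 ∧ (x 2, x 3) ∈ lfmMatching (x 1) (X 0) (x 0)

/-- Restriction of `relVLfmm` to graphs of degree at most three. -/
def relThreeVLfmm : Relation 3 1 := fun x X =>
  DegreeLeThree (x 0) (x 1) (X 0) ∧ relVLfmm x X

/-- Restriction of `relLfmm` to graphs of degree at most three. -/
def relThreeLfmm : Relation 4 1 := fun x X =>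
  DegreeLeThree (x 0) (x 1) (X 0) ∧ relLfmm x X

/-- The six problems as relations. -/
def Problem.rel : (p : Problem) → Relation p.numArity p.strArity
  | .ccv => relCcv
  | .threeVLfmm => relThreeVLfmm
  | .vLfmm => relVLfmm
  | .ccvNeg => relCcvNeg
  | .threeLfmm => relThreeLfmm
  | .lfmm => relLfmm

/-- The class `CC`. -/
def InCC {k l : ℕ} (R : Relation k l) : Prop := ManyOneReduces R relCcv

/-- `R` is `CC`-complete: `CC` is the closure of `R` under many-one `AC⁰` reducibility. -/
def IsCCComplete {k l : ℕ} (R : Relation k l) : Prop :=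
  ∀ (k' l' : ℕ) (S : Relation k' l'), InCC S ↔ ManyOneReduces S R

/-! ## The six problems, as formulas -/

/-- `w < m`, every gate is a pair of wires, and
`∃ Z ≤ ⟨m, n+1⟩ + 1, (δ_CCV(m, n, G, I, Z) ∧ Z(n, w))`.
Numbers `m = 0`, `n = 1`, `w = 2` (bound: `i = 3`, `x = 4`, `y = 5`); strings `G = 0`, `I = 1`,
`Z = 2`. -/
def formulaCcv : Formula 3 2 :=
  .lt (.var 2) (.var 0) ⋏
  .allLt (.var 1) (.exLt (.var 0) (.exLt (.var 0)
    (.seqEntry 0 (.var 3) (.pair (.var 4) (.var 5))))) ⋏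
  .exSLe (.pair (.var 0) (.var 1 + 1) + 1)
    (deltaCCV.rename Fin.castSucc id ⋏ .memPair 2 (.var 1) (.var 2))

/-- The analogue of `δ_CCV` for circuits with negation gates: numbers `m = 0`, `n = 1` (bound:
`i = 2`, `x = 3`, `y = 4`, `j = 5`, and `i = 2`, `x = 3`, `j = 4` in the last conjunct);
strings `G = 0`, `I = 1`, `N = 2`, `Z = 3`. -/
def deltaCcvNeg : Formula 2 4 :=
  .allLt (.var 0) (.mem (.var 2) 1 ⭤ .memPair 3 0 (.var 2)) ⋏
  .allLt (.var 1) (.allLt (.var 0) (.allLt (.var 0)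
    ((∼(.mem (.var 2) 2) ⋏ .seqEntry 0 (.var 2) (.pair (.var 3) (.var 4))) ➝
      ((.memPair 3 (.var 2 + 1) (.var 3) ⭤
          (.memPair 3 (.var 2) (.var 3) ⋏ .memPair 3 (.var 2) (.var 4))) ⋏
       (.memPair 3 (.var 2 + 1) (.var 4) ⭤
          (.memPair 3 (.var 2) (.var 3) ⋎ .memPair 3 (.var 2) (.var 4))) ⋏
       .allLt (.var 0) ((∼(.eq (.var 5) (.var 3)) ⋏ ∼(.eq (.var 5) (.var 4))) ➝
          (.memPair 3 (.var 2 + 1) (.var 5) ⭤ .memPair 3 (.var 2) (.var 5))))))) ⋏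
  .allLt (.var 1) (.allLt (.var 0)
    ((.mem (.var 2) 2 ⋏ .seqEntry 0 (.var 2) (.var 3)) ➝
      ((.memPair 3 (.var 2 + 1) (.var 3) ⭤ ∼(.memPair 3 (.var 2) (.var 3))) ⋏
       .allLt (.var 0) (∼(.eq (.var 4) (.var 3)) ➝
          (.memPair 3 (.var 2 + 1) (.var 4) ⭤ .memPair 3 (.var 2) (.var 4))))))

/-- As `formulaCcv`, for circuits with negation gates; strings `G = 0`, `I = 1`, `N = 2`, `Z = 3`. -/
def formulaCcvNeg : Formula 3 3 :=
  .lt (.var 2) (.var 0) ⋏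
  .allLt (.var 1) (.exLt (.var 0)
    ((.mem (.var 3) 2 ⋏ .seqEntry 0 (.var 3) (.var 4)) ⋎
     (∼(.mem (.var 3) 2) ⋏
        .exLt (.var 0) (.seqEntry 0 (.var 3) (.pair (.var 4) (.var 5)))))) ⋏
  .exSLe (.pair (.var 0) (.var 1 + 1) + 1)
    (deltaCcvNeg.rename Fin.castSucc id ⋏ .memPair 3 (.var 1) (.var 2))

/-- `δ_LFMM(m, n, E, L)`: numbers `m = 0`, `n = 1`, strings `E = 0`, `L = 1`; for all `i = 2 < m` and
`j = 3 < n`, `L(i, j)` holds iff `E(i, j)`, and `¬ L(i, k)` for all `k = 4 < j`, and `¬ L(ℓ, j)` for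
all `ℓ = 4 < i`, and for all `k = 4 < j` either `¬ E(i, k)` or `L(i', k)` for some `i' = 5 < i`. -/
def deltaLFMM : Formula 2 2 :=
  .allLt (.var 0) (.allLt (.var 1) (.memPair 1 (.var 2) (.var 3) ⭤
    (.memPair 0 (.var 2) (.var 3) ⋏
     .allLt (.var 3) ∼(.memPair 1 (.var 2) (.var 4)) ⋏
     .allLt (.var 2) ∼(.memPair 1 (.var 4) (.var 3)) ⋏
     .allLt (.var 3) (∼(.memPair 0 (.var 2) (.var 4)) ⋎
       .exLt (.var 2) (.memPair 1 (.var 5) (.var 4))))))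

/-- Numbers `m = 0`, `n = 1`, `j = 2` (bound: `i = 3`); strings `E = 0`, `L = 1`: `j < n` and
`∃ L ≤ ⟨m, n⟩ + 1, (δ_LFMM(m, n, E, L) ∧ ∃ i < m, L(i, j))`. -/
def formulaVLfmm : Formula 3 1 :=
  .lt (.var 2) (.var 1) ⋏
  .exSLe (.pair (.var 0) (.var 1) + 1)
    (deltaLFMM.rename Fin.castSucc id ⋏ .exLt (.var 0) (.memPair 1 (.var 3) (.var 2)))

/-- Numbers `m = 0`, `n = 1`, `i = 2`, `j = 3`; strings `E = 0`, `L = 1`: `i < m`, `j < n` and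
`∃ L ≤ ⟨m, n⟩ + 1, (δ_LFMM(m, n, E, L) ∧ L(i, j))`. -/
def formulaLfmm : Formula 4 1 :=
  .lt (.var 2) (.var 0) ⋏ .lt (.var 3) (.var 1) ⋏
  .exSLe (.pair (.var 0) (.var 1) + 1)
    (deltaLFMM.rename (Fin.castAdd 2) id ⋏ .memPair 1 (.var 2) (.var 3))

/-- Numbers `m = 0`, `n = 1`; string `E = 0`: no node `2` has four distinct neighbours
`3 > 4 > 5 > 6` on the other side. -/
def formulaDegree : Formula 2 1 :=
  .allLt (.var 0) ∼(.exLt (.var 1) (.exLt (.var 3) (.exLt (.var 4) (.exLt (.var 5)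
    (.memPair 0 (.var 2) (.var 3) ⋏ .memPair 0 (.var 2) (.var 4) ⋏
     .memPair 0 (.var 2) (.var 5) ⋏ .memPair 0 (.var 2) (.var 6)))))) ⋏
  .allLt (.var 1) ∼(.exLt (.var 0) (.exLt (.var 3) (.exLt (.var 4) (.exLt (.var 5)
    (.memPair 0 (.var 3) (.var 2) ⋏ .memPair 0 (.var 4) (.var 2) ⋏
     .memPair 0 (.var 5) (.var 2) ⋏ .memPair 0 (.var 6) (.var 2))))))

/-- Restriction of `formulaVLfmm` to graphs of degree at most three. -/
def formulaThreeVLfmm : Formula 3 1 := formulaDegree.rename Fin.castSucc id ⋏ formulaVLfmm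

/-- Restriction of `formulaLfmm` to graphs of degree at most three. -/
def formulaThreeLfmm : Formula 4 1 := formulaDegree.rename (Fin.castAdd 2) id ⋏ formulaLfmm

/-- The six problems as formulas of the vocabulary of `VCC*`. -/
def Problem.formula : (p : Problem) → Formula p.numArity p.strArity
  | .ccv => formulaCcv
  | .threeVLfmm => formulaThreeVLfmm
  | .vLfmm => formulaVLfmm
  | .ccvNeg => formulaCcvNeg
  | .threeLfmm => formulaThreeLfmm
  | .lfmm => formulaLfmm

end TwoSorted

/-!
# Six problems equivalent to the comparator circuit value problem

The equivalences are explicit reductions, forming the cycle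

  `ccv → threeVLfmm → vLfmm → lfmm → ccvNeg → ccv`

together with the detour `ccv → threeLfmm → lfmm`.

* From comparator circuits to lfm-matchings of graphs of degree three (`gadgetGraph`): the top nodes
  are arranged in rows, one for each layer of the circuit, and a top node is taken by a bottom node
  of the preceding rows if and only if its wire carries one.  A further bottom node takes a top node
  that is still free, so that only the bottom nodes at occupied top nodes go on to the next row.
  There, the one or two bottom nodes that come from the wires of a gate fill first the node for the
  disjunction and then the node for the conjunction; `topSlot` arranges the row in this order.  This
  is `compStep_occupied`.
* From matched vertices to matched edges (`vertexGraph`): a further bottom node, which comes last and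
  is adjacent to the given top node and to a new one, is matched to the new one if and only if the
  given one has been taken.
* From lfm-matchings to circuits (`lfmGate`): treat the pairs of a bottom and a top node in
  lexicographic order, with a comparator gate for each edge.  A wire of a bottom node carries one as
  long as the node is free, a wire of a top node carries one as soon as the node is taken
  (`LfmLayers.invariant`).  Whether a given edge is matched is then read off with the help of one
  negation gate (`edgeCircuit_output`).
* From circuits with negation gates to comparator circuits (`simCircuit`): every value is carried
  together with its negation.  A comparator gate is accompanied by the dual gate on the negations,
  and a negation gate exchanges two wires with the help of a wire that carries zero
  (`comparator_simulation`, `negation_simulation`).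

Correctness of these reductions uses only that layers of comparator circuits exist, which is the
axiom of `VCC*` (`IsVCC.exists_layers`); layers and matchings of the other kinds are read off from
them by comprehension, and are unique by induction.

To obtain provable reductions, the arguments are carried out in an arbitrary model of `V⁰`, where
comprehension gives induction for definable relations and hence the laws of an ordered semiring.
That the reductions are `AC⁰` functions requires that one `Σ₀ᴮ`-formula defines them in all models.
Accordingly, definability is treated for a family of structures at once (`Def`, `DefN`, `DefS`), by
closure properties in place of formulas, and `UniformlyReduces` is reducibility in this sense.
`problems_equivalent` holds for every family of models of `V⁰`.  For the family of all models it
gives provable reductions, by `UniformlyReduces.provablyReduces`.  For the standard structure it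
gives many-one `AC⁰` reductions, by `manyOneReduces_iff`, between the relations that the formulas
represent (`represents_formula`); completeness follows because these reductions compose.
-/

universe w

set_option linter.unusedSectionVars false

namespace TwoSorted

/-! ### Renaming and realization -/

theorem snoc_comp_extendRen {α : Type*} {a b : ℕ} (f : Fin a → Fin b) (v : Fin b → α) (x : α) :
    (fun i => Fin.snoc (α := fun _ => α) v x (extendRen f i)) =
      Fin.snoc (α := fun _ => α) (fun i => v (f i)) x := by
  funext i
  refine Fin.lastCases ?_ (fun j => ?_) i <;> simp [extendRen]

theorem NTerm.eval_rename (M : Structure.{u}) {k l k' l' : ℕ} (f : Fin k → Fin k')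
    (g : Fin l → Fin l') (v : Fin k' → M.Num) (V : Fin l' → M.Str) (t : NTerm k l) :
    (t.rename f g).eval M v V = t.eval M (fun i => v (f i)) (fun i => V (g i)) := by
  induction t with
  | var | zero | one | len => rfl
  | add t u ht hu => simp [NTerm.rename, NTerm.eval, ht, hu]
  | mul t u ht hu => simp [NTerm.rename, NTerm.eval, ht, hu]

theorem Formula.realize_rename (M : Structure.{u}) {k l : ℕ} (φ : Formula k l) :
    ∀ {k' l' : ℕ} (f : Fin k → Fin k') (g : Fin l → Fin l') (v : Fin k' → M.Num)
      (V : Fin l' → M.Str), (φ.rename f g).Realize M v V ↔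
        φ.Realize M (fun i => v (f i)) (fun i => V (g i)) := by
  induction φ with
  | eq | le | strEq | mem => intros; simp [Formula.rename, Formula.Realize, NTerm.eval_rename]
  | neg φ h => intros; simp [Formula.rename, Formula.Realize, h]
  | and φ ψ h h' | or φ ψ h h' => intros; simp [Formula.rename, Formula.Realize, h, h']
  | exN φ h | allN φ h | exS φ h | allS φ h =>
    intros; simp [Formula.rename, Formula.Realize, h, snoc_comp_extendRen]

section Realize
variable (M : Structure.{u}) {k l : ℕ} (v : Fin k → M.Num) (V : Fin l → M.Str)

theorem NTerm.eval_liftN (t : NTerm k l) (a : M.Num) :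
    t.liftN.eval M (Fin.snoc (α := fun _ => M.Num) v a) V = t.eval M v V := by
  simp [NTerm.liftN, NTerm.eval_rename]

theorem NTerm.eval_liftS (t : NTerm k l) (A : M.Str) :
    t.liftS.eval M v (Fin.snoc (α := fun _ => M.Str) V A) = t.eval M v V := by
  simp [NTerm.liftS, NTerm.eval_rename]

theorem Formula.realize_liftS (φ : Formula k l) (A : M.Str) :
    φ.liftS.Realize M v (Fin.snoc (α := fun _ => M.Str) V A) ↔ φ.Realize M v V := by
  simp [Formula.liftS, Formula.realize_rename]

theorem Formula.realize_imp (φ ψ : Formula k l) :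
    (φ ➝ ψ).Realize M v V ↔ (φ.Realize M v V → ψ.Realize M v V) := by
  simp only [Formula.imp, Formula.Realize]; tauto

theorem Formula.realize_iff (φ ψ : Formula k l) :
    (φ ⭤ ψ).Realize M v V ↔ (φ.Realize M v V ↔ ψ.Realize M v V) := by
  simp only [Formula.iff, Formula.Realize, Formula.realize_imp]; tauto

theorem Formula.realize_exLe (t : NTerm k l) (φ : Formula (k + 1) l) :
    (Formula.exLe t φ).Realize M v V ↔
      ∃ a, M.le a (t.eval M v V) ∧ φ.Realize M (Fin.snoc (α := fun _ => M.Num) v a) V := by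
  simp [Formula.exLe, Formula.Realize, NTerm.eval_liftN, NTerm.eval]

theorem Formula.realize_allLe (t : NTerm k l) (φ : Formula (k + 1) l) :
    (Formula.allLe t φ).Realize M v V ↔
      ∀ a, M.le a (t.eval M v V) → φ.Realize M (Fin.snoc (α := fun _ => M.Num) v a) V := by
  simp [Formula.allLe, Formula.Realize, Formula.realize_imp, NTerm.eval_liftN, NTerm.eval]

theorem Formula.realize_exSLe (t : NTerm k l) (φ : Formula k (l + 1)) :
    (Formula.exSLe t φ).Realize M v V ↔
      ∃ A, M.le (M.len A) (t.eval M v V) ∧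
        φ.Realize M v (Fin.snoc (α := fun _ => M.Str) V A) := by
  simp [Formula.exSLe, Formula.Realize, NTerm.eval_liftS, NTerm.eval]

theorem Formula.realize_conj {n : ℕ} (φ : Fin n → Formula k l) :
    (Formula.conj φ).Realize M v V ↔ ∀ i, (φ i).Realize M v V := by
  induction n with
  | zero => simp [Formula.conj, Formula.Realize]
  | succ n ih => simp [Formula.conj, Formula.Realize, ih, Fin.forall_fin_succ]

end Realize

/-! ### Definability over a family of structures -/

/-- Polynomial number functions over a family of structures `S i`: built from the given number
functions `nums`, the lengths of the given string functions `strs`, and `n` number variables.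
These are the values of the number terms. -/
inductive IsTerm {ι : Type w} (S : ι → Structure.{u}) (nums : Set (∀ i, (S i).Num))
    (strs : Set (∀ i, (S i).Str)) (n : ℕ) : (∀ i, (Fin n → (S i).Num) → (S i).Num) → Prop
  | coord (a : Fin n) : IsTerm S nums strs n (fun _ v => v a)
  | num (f : ∀ i, (S i).Num) : f ∈ nums → IsTerm S nums strs n (fun i _ => f i)
  | len (F : ∀ i, (S i).Str) : F ∈ strs → IsTerm S nums strs n (fun i _ => (S i).len (F i))
  | zero : IsTerm S nums strs n (fun i _ => (S i).zero)
  | one : IsTerm S nums strs n (fun i _ => (S i).one)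
  | add {t s : ∀ i, (Fin n → (S i).Num) → (S i).Num} : IsTerm S nums strs n t →
      IsTerm S nums strs n s → IsTerm S nums strs n (fun i v => (S i).add (t i v) (s i v))
  | mul {t s : ∀ i, (Fin n → (S i).Num) → (S i).Num} : IsTerm S nums strs n t →
      IsTerm S nums strs n s → IsTerm S nums strs n (fun i v => (S i).mul (t i v) (s i v))

/-- `Σ₀ᴮ`-definable relations over a family of structures `S i`, uniformly in `i`.  The
relations have `n` number arguments, and the defining formulas may use the given number functions
`nums` and string functions `strs` of `i` as further free variables. -/
inductive Def {ι : Type w} (S : ι → Structure.{u}) (nums : Set (∀ i, (S i).Num))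
    (strs : Set (∀ i, (S i).Str)) : (n : ℕ) → (∀ i, (Fin n → (S i).Num) → Prop) → Prop
  | term_eq {n : ℕ} {t s : ∀ i, (Fin n → (S i).Num) → (S i).Num} : IsTerm S nums strs n t →
      IsTerm S nums strs n s → Def S nums strs n (fun i v => t i v = s i v)
  | term_le {n : ℕ} {t s : ∀ i, (Fin n → (S i).Num) → (S i).Num} : IsTerm S nums strs n t →
      IsTerm S nums strs n s → Def S nums strs n (fun i v => (S i).le (t i v) (s i v))
  | str_eq {n : ℕ} {F G : ∀ i, (S i).Str} : F ∈ strs → G ∈ strs →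
      Def S nums strs n (fun i _ => F i = G i)
  | term_mem {n : ℕ} {t : ∀ i, (Fin n → (S i).Num) → (S i).Num} {F : ∀ i, (S i).Str} :
      IsTerm S nums strs n t → F ∈ strs →
      Def S nums strs n (fun i v => (S i).mem (t i v) (F i))
  | not {n : ℕ} {P : ∀ i, (Fin n → (S i).Num) → Prop} : Def S nums strs n P →
      Def S nums strs n (fun i v => ¬ P i v)
  | and {n : ℕ} {P Q : ∀ i, (Fin n → (S i).Num) → Prop} : Def S nums strs n P →
      Def S nums strs n Q → Def S nums strs n (fun i v => P i v ∧ Q i v)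
  | term_ex {n : ℕ} {P : ∀ i, (Fin (n + 1) → (S i).Num) → Prop}
      {t : ∀ i, (Fin n → (S i).Num) → (S i).Num} : IsTerm S nums strs n t →
      Def S nums strs (n + 1) P →
      Def S nums strs n (fun i v => ∃ x, (S i).le x (t i v) ∧
        P i (Fin.snoc (α := fun _ => (S i).Num) v x))

section
variable {ι : Type w} {S : ι → Structure.{u}} {nums : Set (∀ i, (S i).Num)}
  {strs : Set (∀ i, (S i).Str)} {n : ℕ}

theorem Def.congr {P Q : ∀ i, (Fin n → (S i).Num) → Prop} (h : Def S nums strs n P)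
    (hPQ : ∀ i v, P i v ↔ Q i v) : Def S nums strs n Q := by
  have : P = Q := by funext i v; exact propext (hPQ i v)
  exact this ▸ h

theorem IsTerm.mono {nums' : Set (∀ i, (S i).Num)} {strs' : Set (∀ i, (S i).Str)}
    (hn : nums ⊆ nums') (hs : strs ⊆ strs') {t : ∀ i, (Fin n → (S i).Num) → (S i).Num}
    (h : IsTerm S nums strs n t) : IsTerm S nums' strs' n t := by
  induction h with
  | coord a => exact .coord a
  | num f hf => exact .num f (hn hf)
  | len F hF => exact .len F (hs hF)
  | zero => exact .zero
  | one => exact .one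
  | add _ _ h h' => exact .add h h'
  | mul _ _ h h' => exact .mul h h'

theorem Def.mono {nums' : Set (∀ i, (S i).Num)} {strs' : Set (∀ i, (S i).Str)}
    (hn : nums ⊆ nums') (hs : strs ⊆ strs') {P : ∀ i, (Fin n → (S i).Num) → Prop}
    (h : Def S nums strs n P) : Def S nums' strs' n P := by
  induction h with
  | term_eq ht hs' => exact .term_eq (ht.mono hn hs) (hs'.mono hn hs)
  | term_le ht hs' => exact .term_le (ht.mono hn hs) (hs'.mono hn hs)
  | str_eq hF hG => exact .str_eq (hs hF) (hs hG)
  | term_mem ht hF => exact .term_mem (ht.mono hn hs) (hs hF)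
  | not _ h => exact .not h
  | and _ _ h h' => exact .and h h'
  | term_ex ht _ h => exact .term_ex (ht.mono hn hs) h

theorem IsTerm.exists_finite {t : ∀ i, (Fin n → (S i).Num) → (S i).Num}
    (h : IsTerm S nums strs n t) : ∃ N ⊆ nums, ∃ A ⊆ strs, N.Finite ∧ A.Finite ∧
      IsTerm S N A n t := by
  induction h with
  | coord a => exact ⟨∅, by simp, ∅, by simp, by simp, by simp, .coord a⟩
  | num f hf => exact ⟨{f}, by simpa, ∅, by simp, by simp, by simp, .num f rfl⟩
  | len F hF => exact ⟨∅, by simp, {F}, by simpa, by simp, by simp, .len F rfl⟩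
  | zero => exact ⟨∅, by simp, ∅, by simp, by simp, by simp, .zero⟩
  | one => exact ⟨∅, by simp, ∅, by simp, by simp, by simp, .one⟩
  | add _ _ h h' =>
    obtain ⟨N, hN, A, hA, hNf, hAf, h⟩ := h
    obtain ⟨N', hN', A', hA', hNf', hAf', h'⟩ := h'
    exact ⟨N ∪ N', Set.union_subset hN hN', A ∪ A', Set.union_subset hA hA', hNf.union hNf',
      hAf.union hAf', .add (h.mono Set.subset_union_left Set.subset_union_left)
        (h'.mono Set.subset_union_right Set.subset_union_right)⟩
  | mul _ _ h h' =>
    obtain ⟨N, hN, A, hA, hNf, hAf, h⟩ := h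
    obtain ⟨N', hN', A', hA', hNf', hAf', h'⟩ := h'
    exact ⟨N ∪ N', Set.union_subset hN hN', A ∪ A', Set.union_subset hA hA', hNf.union hNf',
      hAf.union hAf', .mul (h.mono Set.subset_union_left Set.subset_union_left)
        (h'.mono Set.subset_union_right Set.subset_union_right)⟩

/-- A definition uses only finitely many parameters. -/
theorem Def.exists_finite {P : ∀ i, (Fin n → (S i).Num) → Prop}
    (h : Def S nums strs n P) : ∃ N ⊆ nums, ∃ A ⊆ strs, N.Finite ∧ A.Finite ∧
      Def S N A n P := by
  have two : ∀ {p q r : Set (∀ i, (S i).Num) → Set (∀ i, (S i).Str) → Prop}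
      (_ : ∃ N ⊆ nums, ∃ A ⊆ strs, N.Finite ∧ A.Finite ∧ p N A)
      (_ : ∃ N ⊆ nums, ∃ A ⊆ strs, N.Finite ∧ A.Finite ∧ q N A)
      (_ : ∀ {N A N' A'}, N ⊆ N' → A ⊆ A' → p N A → p N' A')
      (_ : ∀ {N A N' A'}, N ⊆ N' → A ⊆ A' → q N A → q N' A')
      (_ : ∀ {N A}, p N A → q N A → r N A),
      ∃ N ⊆ nums, ∃ A ⊆ strs, N.Finite ∧ A.Finite ∧ r N A := by
    rintro p q r ⟨N, hN, A, hA, hNf, hAf, h⟩ ⟨N', hN', A', hA', hNf', hAf', h'⟩ mp mq hr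
    exact ⟨N ∪ N', Set.union_subset hN hN', A ∪ A', Set.union_subset hA hA', hNf.union hNf',
      hAf.union hAf', hr (mp Set.subset_union_left Set.subset_union_left h)
        (mq Set.subset_union_right Set.subset_union_right h')⟩
  induction h with
  | term_eq ht hs =>
    exact two ht.exists_finite hs.exists_finite (fun a b h => h.mono a b)
      (fun a b h => h.mono a b) .term_eq
  | term_le ht hs =>
    exact two ht.exists_finite hs.exists_finite (fun a b h => h.mono a b)
      (fun a b h => h.mono a b) .term_le
  | @str_eq _ F G hF hG =>
    exact ⟨∅, by simp, {F, G}, by simp [Set.insert_subset_iff, *], by simp, by simp,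
      .str_eq (by simp) (by simp)⟩
  | @term_mem _ _ F ht hF =>
    exact two (p := fun N A => IsTerm _ N A _ _) (q := fun N A => F ∈ A) ht.exists_finite
      ⟨∅, by simp, {F}, by simpa, by simp, by simp, by simp⟩ (fun a b h => h.mono a b)
      (fun a b h => b h) .term_mem
  | not _ h =>
    obtain ⟨N, hN, A, hA, hNf, hAf, h⟩ := h
    exact ⟨N, hN, A, hA, hNf, hAf, .not h⟩
  | and _ _ h h' =>
    exact two h h' (fun a b h => h.mono a b) (fun a b h => h.mono a b) .and
  | term_ex ht _ h =>
    exact two ht.exists_finite h (fun a b h => h.mono a b) (fun a b h => h.mono a b) .term_ex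

/-- A polynomial number function is the value of a number term whose free variables are the
parameters and the arguments. -/
theorem IsTerm.exists_nterm {k l : ℕ} {a : Fin k → ∀ i, (S i).Num} {A : Fin l → ∀ i, (S i).Str}
    {t : ∀ i, (Fin n → (S i).Num) → (S i).Num}
    (h : IsTerm S (Set.range a) (Set.range A) n t) :
    ∃ s : NTerm (k + n) l, ∀ i v,
      s.eval (S i) (Fin.append (fun j => a j i) v) (fun j => A j i) = t i v := by
  induction h with
  | coord b => exact ⟨.var (Fin.natAdd k b), fun i v => by simp [NTerm.eval]⟩
  | num f hf =>
    obtain ⟨j, rfl⟩ := hf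
    exact ⟨.var (Fin.castAdd n j), fun i v => by simp [NTerm.eval]⟩
  | len F hF =>
    obtain ⟨j, rfl⟩ := hF
    exact ⟨.len j, fun i v => rfl⟩
  | zero => exact ⟨.zero, fun _ _ => rfl⟩
  | one => exact ⟨.one, fun _ _ => rfl⟩
  | add _ _ h h' =>
    obtain ⟨s, hs⟩ := h
    obtain ⟨s', hs'⟩ := h'
    exact ⟨.add s s', fun i v => by simp [NTerm.eval, hs, hs']⟩
  | mul _ _ h h' =>
    obtain ⟨s, hs⟩ := h
    obtain ⟨s', hs'⟩ := h'
    exact ⟨.mul s s', fun i v => by simp [NTerm.eval, hs, hs']⟩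

theorem append_snoc_eq {α : Type*} {k n : ℕ} (a : Fin k → α) (v : Fin n → α) (x : α) :
    (Fin.append a (Fin.snoc (α := fun _ => α) v x) : Fin (k + (n + 1)) → α) =
      Fin.snoc (α := fun _ => α) (Fin.append a v) x := by
  exact Fin.append_snoc a v x

/-- A definable relation is defined by a `Σ₀ᴮ`-formula whose free variables are the
parameters and the arguments. -/
theorem Def.exists_formula {k l : ℕ} {a : Fin k → ∀ i, (S i).Num} {A : Fin l → ∀ i, (S i).Str}
    {P : ∀ i, (Fin n → (S i).Num) → Prop}
    (h : Def S (Set.range a) (Set.range A) n P) :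
    ∃ φ : Formula (k + n) l, φ.IsSigmaZeroB ∧ ∀ i v,
      φ.Realize (S i) (Fin.append (fun j => a j i) v) (fun j => A j i) ↔ P i v := by
  induction h with
  | term_eq ht hs =>
    obtain ⟨t, ht⟩ := ht.exists_nterm
    obtain ⟨s, hs⟩ := hs.exists_nterm
    exact ⟨.eq t s, .eq _ _, fun i v => by simp [Formula.Realize, ht, hs]⟩
  | term_le ht hs =>
    obtain ⟨t, ht⟩ := ht.exists_nterm
    obtain ⟨s, hs⟩ := hs.exists_nterm
    exact ⟨.le t s, .le _ _, fun i v => by simp [Formula.Realize, ht, hs]⟩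
  | str_eq hF hG =>
    obtain ⟨j, rfl⟩ := hF
    obtain ⟨j', rfl⟩ := hG
    exact ⟨.strEq j j', .strEq _ _, fun i v => by simp [Formula.Realize]⟩
  | term_mem ht hF =>
    obtain ⟨t, ht⟩ := ht.exists_nterm
    obtain ⟨j, rfl⟩ := hF
    exact ⟨.mem t j, .mem _ _, fun i v => by simp [Formula.Realize, ht]⟩
  | not _ h =>
    obtain ⟨φ, hφ, h⟩ := h
    exact ⟨.neg φ, .neg hφ, fun i v => by simp [Formula.Realize, h]⟩
  | and _ _ h h' =>
    obtain ⟨φ, hφ, h⟩ := h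
    obtain ⟨ψ, hψ, h'⟩ := h'
    exact ⟨.and φ ψ, .and hφ hψ, fun i v => by simp [Formula.Realize, h, h']⟩
  | term_ex ht _ h =>
    obtain ⟨t, ht⟩ := ht.exists_nterm
    obtain ⟨φ, hφ, h⟩ := h
    refine ⟨Formula.exLe t φ, .exLe t hφ, fun i v => ?_⟩
    rw [Formula.realize_exLe]
    simp_rw [ht, ← append_snoc_eq, h]

theorem Set.Finite.exists_range_fin {α : Type*} {s : Set α} (h : s.Finite) :
    ∃ (k : ℕ) (f : Fin k → α), Set.range f = s := by
  obtain ⟨k, f, -, hf⟩ := h.fin_param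
  exact ⟨k, f, hf⟩

/-- Every definable relation is defined by a `Σ₀ᴮ`-formula with parameters. -/
theorem Def.exists_formula_params {P : ∀ i, (Fin n → (S i).Num) → Prop}
    (h : Def S nums strs n P) :
    ∃ (k l : ℕ) (a : Fin k → ∀ i, (S i).Num) (A : Fin l → ∀ i, (S i).Str)
      (φ : Formula (k + n) l), φ.IsSigmaZeroB ∧ ∀ i v,
      φ.Realize (S i) (Fin.append (fun j => a j i) v) (fun j => A j i) ↔ P i v := by
  obtain ⟨N, -, B, -, hN, hB, h⟩ := h.exists_finite
  obtain ⟨k, a, rfl⟩ := Set.Finite.exists_range_fin hN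
  obtain ⟨l, A, rfl⟩ := Set.Finite.exists_range_fin hB
  obtain ⟨φ, hφ, h⟩ := h.exists_formula
  exact ⟨k, l, a, A, φ, hφ, h⟩

theorem IsTerm.rename {n' : ℕ} (f : Fin n → Fin n')
    {t : ∀ i, (Fin n → (S i).Num) → (S i).Num} (h : IsTerm S nums strs n t) :
    IsTerm S nums strs n' (fun i v => t i (fun a => v (f a))) := by
  induction h with
  | coord a => exact .coord (f a)
  | num g hg => exact .num g hg
  | len F hF => exact .len F hF
  | zero => exact .zero
  | one => exact .one
  | add _ _ h h' => exact .add h h'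
  | mul _ _ h h' => exact .mul h h'

/-- Variables may be renamed, and dummy variables added. -/
theorem Def.rename {P : ∀ i, (Fin n → (S i).Num) → Prop} (h : Def S nums strs n P) :
    ∀ {n' : ℕ} (f : Fin n → Fin n'),
      Def S nums strs n' (fun i v => P i (fun a => v (f a))) := by
  induction h with
  | term_eq ht hs => intro n' f; exact .term_eq (ht.rename f) (hs.rename f)
  | term_le ht hs => intro n' f; exact .term_le (ht.rename f) (hs.rename f)
  | str_eq hF hG => intro n' f; exact .str_eq hF hG
  | term_mem ht hF => intro n' f; exact .term_mem (ht.rename f) hF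
  | not _ h => intro n' f; exact .not (h f)
  | and _ _ h h' => intro n' f; exact .and (h f) (h' f)
  | term_ex ht _ h =>
    intro n' f
    refine (Def.term_ex (ht.rename f) (h (extendRen f))).congr fun i v => ?_
    simp only [snoc_comp_extendRen]

end

/-! ### Induction in models of `V⁰` -/

/-- The structure `M` is a model of `V⁰`. -/
class IsVZero (M : Structure.{u}) : Prop where
  sat : ∀ p ∈ VZero, M.Satisfies p.2.2

theorem snoc_last_eq {α : Type*} {n : ℕ} (v : Fin n → α) (x : α) :
    (Fin.snoc (α := fun _ => α) v x : Fin (n + 1) → α) (Fin.last n) = x := by simp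

section
variable (M : Structure.{u}) [IsVZero M]

theorem IsVZero.basic {k l : ℕ} {φ : Formula k l}
    (h : (⟨k, l, φ⟩ : Σ k l : ℕ, Formula k l) ∈ twoBasic)
    (v : Fin k → M.Num) (V : Fin l → M.Str) : φ.Realize M v V :=
  IsVZero.sat (M := M) _ (Or.inl h) v V

variable {M}
theorem add_one_ne (x : M.Num) : M.add x M.one ≠ M.zero := by
  have := IsVZero.basic M (φ := ∼(.eq (.var 0 + 1) 0)) (by simp [twoBasic]) ![x] ![]
  exact this

theorem add_one_inj' {x y : M.Num} (h : M.add x M.one = M.add y M.one) : x = y := by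
  have := IsVZero.basic M (k := 2) (l := 0)
    (φ := .eq (.var 0 + 1) (.var 1 + 1) ➝ .eq (.var 0) (.var 1)) (by simp [twoBasic]) ![x, y] ![]
  rw [Formula.realize_imp] at this
  exact this h

theorem add_zero' (x : M.Num) : M.add x M.zero = x := by
  have := IsVZero.basic M (k := 1) (l := 0) (φ := .eq (.var 0 + 0) (.var 0))
    (by simp [twoBasic]) ![x] ![]
  exact this

theorem add_succ' (x y : M.Num) : M.add x (M.add y M.one) = M.add (M.add x y) M.one := by
  have := IsVZero.basic M (k := 2) (l := 0)
    (φ := .eq (.var 0 + (.var 1 + 1)) ((.var 0 + .var 1) + 1))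
    (by simp [twoBasic]) ![x, y] ![]
  exact this

theorem mul_zero' (x : M.Num) : M.mul x M.zero = M.zero := by
  have := IsVZero.basic M (k := 1) (l := 0) (φ := .eq (.var 0 * 0) 0) (by simp [twoBasic]) ![x] ![]
  exact this

theorem mul_succ' (x y : M.Num) : M.mul x (M.add y M.one) = M.add (M.mul x y) x := by
  have := IsVZero.basic M (k := 2) (l := 0)
    (φ := .eq (.var 0 * (.var 1 + 1)) ((.var 0 * .var 1) + .var 0))
    (by simp [twoBasic]) ![x, y] ![]
  exact this

theorem le_antisymm' {x y : M.Num} (h : M.le x y) (h' : M.le y x) : x = y := by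
  have := IsVZero.basic M (k := 2) (l := 0)
    (φ := (.le (.var 0) (.var 1) ⋏ .le (.var 1) (.var 0)) ➝ .eq (.var 0) (.var 1))
    (by simp [twoBasic]) ![x, y] ![]
  rw [Formula.realize_imp] at this
  exact this ⟨h, h'⟩

theorem le_add_right' (x y : M.Num) : M.le x (M.add x y) := by
  have := IsVZero.basic M (k := 2) (l := 0) (φ := .le (.var 0) (.var 0 + .var 1)) (by simp [twoBasic])
    ![x, y] ![]
  exact this

theorem zero_le' (x : M.Num) : M.le M.zero x :=
  IsVZero.basic M (k := 1) (l := 0) (φ := .le 0 (.var 0)) (by simp [twoBasic]) ![x] ![]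

theorem le_total' (x y : M.Num) : M.le x y ∨ M.le y x :=
  IsVZero.basic M (k := 2) (l := 0) (φ := .le (.var 0) (.var 1) ⋎ .le (.var 1) (.var 0))
    (by simp [twoBasic]) ![x, y] ![]

theorem le_iff_lt_succ' (x y : M.Num) :
    M.le x y ↔ M.le x (M.add y M.one) ∧ x ≠ M.add y M.one := by
  have := IsVZero.basic M (k := 2) (l := 0)
    (φ := .le (.var 0) (.var 1) ⭤ .lt (.var 0) (.var 1 + 1)) (by simp [twoBasic]) ![x, y] ![]
  rw [Formula.realize_iff] at this
  exact this

theorem exists_pred' {x : M.Num} (h : x ≠ M.zero) : ∃ y, M.le y x ∧ M.add y M.one = x := by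
  have := IsVZero.basic M (k := 1) (l := 0)
    (φ := ∼(.eq (.var 0) 0) ➝ .exLe (.var 0) (.eq (.var 1 + 1) (.var 0))) (by simp [twoBasic])
    ![x] ![]
  rw [Formula.realize_imp, Formula.realize_exLe] at this
  exact this h

theorem mem_lt_len {x : M.Num} {X : M.Str} (h : M.mem x X) :
    M.le x (M.len X) ∧ x ≠ M.len X := by
  have := IsVZero.basic M (k := 1) (l := 1)
    (φ := .mem (.var 0) 0 ➝ .lt (.var 0) (.len 0)) (by simp [twoBasic]) ![x] ![X]
  rw [Formula.realize_imp] at this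
  exact this h

theorem mem_of_add_one_eq_len {x : M.Num} {X : M.Str} (h : M.add x M.one = M.len X) :
    M.mem x X := by
  have := IsVZero.basic M (k := 1) (l := 1)
    (φ := .eq (.var 0 + 1) (.len 0) ➝ .mem (.var 0) 0) (by simp [twoBasic]) ![x] ![X]
  rw [Formula.realize_imp] at this
  exact this h

theorem str_ext' {X Y : M.Str} (h : M.len X = M.len Y)
    (h' : ∀ x, M.le x (M.len X) ∧ x ≠ M.len X → (M.mem x X ↔ M.mem x Y)) : X = Y := by
  have := IsVZero.basic M (k := 0) (l := 2)
    (φ := (.eq (.len 0) (.len 1) ⋏ .allLt (.len 0) (.mem (.var 0) 0 ⭤ .mem (.var 0) 1)) ➝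
      .strEq 0 1) (by simp [twoBasic]) ![] ![X, Y]
  rw [Formula.realize_imp] at this
  refine this ⟨h, ?_⟩
  rw [Formula.allLt, Formula.realize_allLe]
  intro a ha
  rw [Formula.realize_imp, Formula.realize_iff]
  intro ha'
  exact h' a ⟨ha, ha'⟩

/-- Comprehension for relations definable with parameters. -/
theorem Def.exists_str {ι : Type w} {S : ι → Structure.{u}} {nums : Set (∀ i, (S i).Num)}
    {strs : Set (∀ i, (S i).Str)} {n : ℕ} {P : ∀ i, (Fin (n + 1) → (S i).Num) → Prop}
    (h : Def S nums strs (n + 1) P) (i : ι) [IsVZero (S i)] (v : Fin n → (S i).Num)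
    (b : (S i).Num) :
    ∃ X, (S i).le ((S i).len X) b ∧ ∀ z, (S i).le z b ∧ z ≠ b →
      ((S i).mem z X ↔ P i (Fin.snoc (α := fun _ => (S i).Num) v z)) := by
  -- the bound `b` is one more variable, inserted before the last one
  obtain ⟨k, l, a, A, φ, hφ, h⟩ :=
    (h.rename (n' := n + 1 + 1) (extendRen Fin.castSucc)).exists_formula_params
  have hb := IsVZero.sat (M := S i) ⟨k + (n + 1), l, comprehension (Fin.last (k + n)) φ⟩
    (Or.inr ⟨_, _, _, φ, hφ, rfl⟩)
    (Fin.append (fun j => a j i) (Fin.snoc (α := fun _ => (S i).Num) v b)) (fun j => A j i)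
  simp only [comprehension, Formula.realize_exSLe, Formula.allLt, Formula.realize_allLe,
    Formula.realize_imp, Formula.realize_iff, Formula.Realize, Formula.realize_liftS] at hb
  obtain ⟨X, hX, hb⟩ := hb
  have e : Fin.append (fun j => a j i) (Fin.snoc (α := fun _ => (S i).Num) v b)
      (Fin.last (k + n)) = b := by
    rw [append_snoc_eq]; exact snoc_last_eq _ _
  simp only [NTerm.eval, NTerm.eval_liftN] at hX hb
  rw [e] at hX hb
  refine ⟨X, hX, fun z hz => ?_⟩
  have := hb z hz.1 (by rw [snoc_last_eq]; exact hz.2)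
  rw [snoc_last_eq, snoc_last_eq] at this
  rw [this]
  have h2 := h i (Fin.snoc (α := fun _ => (S i).Num) (Fin.snoc (α := fun _ => (S i).Num) v b) z)
  rw [append_snoc_eq] at h2
  erw [h2]
  rw [snoc_comp_extendRen]
  simp

end

section
variable {M : Structure.{u}} [IsVZero M]

/-- Relations on the numbers of `M` definable with arbitrary parameters from `M`. -/
abbrev ParamDef (M : Structure.{u}) (n : ℕ) (P : (Fin n → M.Num) → Prop) : Prop :=
  Def (fun _ : Unit => M) Set.univ Set.univ n (fun _ v => P v)

theorem IsTerm.param {n : ℕ} (x : M.Num) :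
    IsTerm (fun _ : Unit => M) Set.univ Set.univ n (fun _ _ => x) :=
  .num (fun _ => x) (Set.mem_univ _)

theorem le_refl' (x : M.Num) : M.le x x := by
  simpa [add_zero'] using le_add_right' x M.zero

/-- Induction for relations definable with parameters: it follows from comprehension, because a
nonempty string has a largest element, the predecessor of its length. -/
theorem induction' {P : M.Num → Prop} (hP : ParamDef M 1 (fun v => P (v 0)))
    (h0 : P M.zero) (hs : ∀ x, P x → P (M.add x M.one)) (b : M.Num) : P b := by
  -- The set of all `z < b` such that `P` holds up to `z` is empty or has a largest element.
  have hQ : ParamDef M 1 (fun v => ∀ y, M.le y (v 0) → P y) := by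
    refine (Def.not (Def.term_ex (.coord 0) (Def.not (hP.rename (fun _ => Fin.last 1))))).congr
      fun i v => ?_
    simp only [not_exists, not_and, not_not]
    exact Iff.rfl
  obtain ⟨Y, hY, hY'⟩ := hQ.exists_str () ![] b
  replace hY' : ∀ z, M.le z b ∧ z ≠ b → (M.mem z Y ↔ ∀ y, M.le y z → P y) := hY'
  have hzero : ∀ y, M.le y M.zero → P y := fun y hy => by rwa [le_antisymm' hy (zero_le' y)]
  by_cases hl : M.len Y = M.zero
  · by_cases hb : M.zero = b
    · exact hb ▸ h0
    · have := mem_lt_len ((hY' M.zero ⟨zero_le' b, hb⟩).2 hzero)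
      exact absurd hl.symm this.2
  · obtain ⟨c, -, hc⟩ := exists_pred' hl
    have hcY : M.mem c Y := mem_of_add_one_eq_len hc
    have hcb : M.le c b ∧ c ≠ b := by
      rw [← hc] at hY
      have hne : c ≠ M.add c M.one := ((le_iff_lt_succ' c c).1 (le_refl' c)).2
      constructor
      · rcases le_total' c b with h | h
        · exact h
        · have h2 := (le_iff_lt_succ' b c).1 h
          exact absurd (le_antisymm' h2.1 hY) h2.2
      · rintro rfl
        exact hne (le_antisymm' (le_add_right' _ _) hY)
    have hc' := (hY' c hcb).1 hcY
    have hall : ∀ y, M.le y (M.len Y) → P y := by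
      intro y hy
      by_cases hyl : y = M.len Y
      · rw [hyl, ← hc]; exact hs c (hc' c (le_refl' c))
      · rw [← hc] at hy hyl
        exact hc' y ((le_iff_lt_succ' y c).2 ⟨hy, hyl⟩)
    by_cases hlb : M.len Y = b
    · rw [← hlb]; exact hall _ (le_refl' _)
    · have := mem_lt_len ((hY' (M.len Y) ⟨hY, hlb⟩).2 hall)
      exact absurd rfl this.2

/-! ### The ordered semiring of numbers -/

theorem zero_add' (x : M.Num) : M.add M.zero x = x := by
  refine induction' (P := fun x => M.add M.zero x = x)
    (.term_eq (.add .zero (.coord 0)) (.coord 0)) (add_zero' _) (fun x h => ?_) x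
  rw [add_succ', h]

theorem succ_add' (x y : M.Num) :
    M.add (M.add x M.one) y = M.add (M.add x y) M.one := by
  refine induction' (P := fun y => M.add (M.add x M.one) y = M.add (M.add x y) M.one)
    (.term_eq (.add (.add (.param x) .one) (.coord 0)) (.add (.add (.param x) (.coord 0)) .one))
    (by simp only [add_zero']) (fun y h => ?_) y
  rw [add_succ', h, add_succ']

theorem add_comm' (x y : M.Num) : M.add x y = M.add y x := by
  refine induction' (P := fun y => M.add x y = M.add y x)
    (.term_eq (.add (.param x) (.coord 0)) (.add (.coord 0) (.param x)))
    (by rw [add_zero', zero_add']) (fun y h => ?_) y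
  rw [add_succ', h, succ_add']

theorem add_assoc' (x y z : M.Num) : M.add (M.add x y) z = M.add x (M.add y z) := by
  refine induction' (P := fun z => M.add (M.add x y) z = M.add x (M.add y z))
    (.term_eq (.add (.add (.param x) (.param y)) (.coord 0))
      (.add (.param x) (.add (.param y) (.coord 0))))
    (by simp only [add_zero']) (fun y h => ?_) z
  rw [add_succ', h, add_succ', add_succ']

theorem add_right_cancel' {x y z : M.Num} : M.add x z = M.add y z → x = y := by
  refine induction' (P := fun z => M.add x z = M.add y z → x = y)
    ((Def.not (.and (.term_eq (.add (.param x) (.coord 0)) (.add (.param y) (.coord 0)))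
      (.not (.term_eq (.param x) (.param y))))).congr fun _ v => by tauto)
    (by simp only [add_zero', imp_self]) (fun z h e => ?_) z
  rw [add_succ', add_succ'] at e
  exact h (add_one_inj' e)

theorem mul_one' (x : M.Num) : M.mul x M.one = x := by
  have := mul_succ' x M.zero
  rwa [zero_add', mul_zero', zero_add'] at this

theorem zero_mul' (x : M.Num) : M.mul M.zero x = M.zero := by
  refine induction' (P := fun x => M.mul M.zero x = M.zero)
    (.term_eq (.mul .zero (.coord 0)) .zero) (mul_zero' _) (fun x h => ?_) x
  rw [mul_succ', h, add_zero']

theorem mul_add' (x y z : M.Num) : M.mul x (M.add y z) = M.add (M.mul x y) (M.mul x z) := by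
  refine induction' (P := fun z => M.mul x (M.add y z) = M.add (M.mul x y) (M.mul x z))
    (.term_eq (.mul (.param x) (.add (.param y) (.coord 0)))
      (.add (.mul (.param x) (.param y)) (.mul (.param x) (.coord 0))))
    (by simp only [add_zero', mul_zero']) (fun z h => ?_) z
  rw [add_succ', mul_succ', h, mul_succ', add_assoc']

theorem succ_mul' (x y : M.Num) : M.mul (M.add x M.one) y = M.add (M.mul x y) y := by
  refine induction' (P := fun y => M.mul (M.add x M.one) y = M.add (M.mul x y) y)
    (.term_eq (.mul (.add (.param x) .one) (.coord 0))
      (.add (.mul (.param x) (.coord 0)) (.coord 0)))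
    (by simp only [add_zero', mul_zero']) (fun y h => ?_) y
  rw [mul_succ', h, mul_succ', add_assoc', add_assoc']
  congr 1
  rw [add_succ', add_succ', add_comm' y x]

theorem mul_comm' (x y : M.Num) : M.mul x y = M.mul y x := by
  refine induction' (P := fun y => M.mul x y = M.mul y x)
    (.term_eq (.mul (.param x) (.coord 0)) (.mul (.coord 0) (.param x)))
    (by rw [mul_zero', zero_mul']) (fun y h => ?_) y
  rw [mul_succ', h, succ_mul']

theorem mul_assoc' (x y z : M.Num) : M.mul (M.mul x y) z = M.mul x (M.mul y z) := by
  refine induction' (P := fun z => M.mul (M.mul x y) z = M.mul x (M.mul y z))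
    (.term_eq (.mul (.mul (.param x) (.param y)) (.coord 0))
      (.mul (.param x) (.mul (.param y) (.coord 0))))
    (by simp only [mul_zero']) (fun y h => ?_) z
  rw [mul_succ', h, mul_succ', mul_add']

/-- The order is the one given by addition.  The difference is bounded in the proof, because
induction is available for bounded quantifiers only. -/
theorem exists_add_of_le' {x y : M.Num} : M.le x y → ∃ z, M.add x z = y := by
  suffices M.le x y → ∃ z, M.le z y ∧ M.add x z = y by
    intro h
    obtain ⟨z, -, hz⟩ := this h
    exact ⟨z, hz⟩
  refine induction' (P := fun y => M.le x y → ∃ z, M.le z y ∧ M.add x z = y) ?_ ?_ ?_ y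
  · have h1 : ParamDef M 2 (fun w => M.add x (w 1) = w 0) :=
      .term_eq (.add (.param x) (.coord 1)) (.coord 0)
    have h2 := Def.term_ex (.coord 0) h1
    refine (Def.not (.and (.term_le (.param x) (.coord 0)) (.not h2))).congr fun _ v => ?_
    have e : ∀ z, (Fin.snoc (α := fun _ => M.Num) v z : Fin 2 → M.Num) 1 = z ∧
      (Fin.snoc (α := fun _ => M.Num) v z : Fin 2 → M.Num) 0 = v 0 := fun z => ⟨rfl, rfl⟩
    simp only [(e _).1, (e _).2, not_and, not_not]
  · intro h
    exact ⟨M.zero, le_refl' _, by rw [le_antisymm' h (zero_le' _), add_zero']⟩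
  · intro y ih h
    by_cases hxy : x = M.add y M.one
    · exact ⟨M.zero, zero_le' _, by rw [add_zero', hxy]⟩
    · obtain ⟨z, hz, e⟩ := ih ((le_iff_lt_succ' x y).2 ⟨h, hxy⟩)
      refine ⟨M.add z M.one, ?_, by rw [add_succ', e]⟩
      rw [← e, ← add_succ', add_comm' x]
      exact le_add_right' _ _

theorem le_trans' {x y z : M.Num} (h : M.le x y) (h' : M.le y z) : M.le x z := by
  obtain ⟨a, rfl⟩ := exists_add_of_le' h
  obtain ⟨b, rfl⟩ := exists_add_of_le' h'
  rw [add_assoc']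
  exact le_add_right' _ _

instance : Zero M.Num := ⟨M.zero⟩
instance : One M.Num := ⟨M.one⟩
instance : Add M.Num := ⟨M.add⟩
instance : Mul M.Num := ⟨M.mul⟩

/-- The numbers of a model of `V⁰` form a commutative semiring. -/
noncomputable instance : CommSemiring M.Num where
  add_assoc := add_assoc'
  zero_add := zero_add'
  add_zero := add_zero'
  add_comm := add_comm'
  left_distrib := mul_add'
  right_distrib x y z := by
    change M.mul (M.add x y) z = M.add (M.mul x z) (M.mul y z)
    rw [mul_comm', mul_add', mul_comm' z, mul_comm' z]
  zero_mul := zero_mul'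
  mul_zero := mul_zero'
  mul_assoc := mul_assoc'
  one_mul x := by
    change M.mul M.one x = x
    rw [mul_comm', mul_one']
  mul_one := mul_one'
  mul_comm := mul_comm'
  nsmul := nsmulRec

noncomputable instance : LinearOrder M.Num where
  le := M.le
  le_refl := le_refl'
  le_trans _ _ _ := le_trans'
  le_antisymm _ _ := le_antisymm'
  le_total := le_total'
  toDecidableLE := Classical.decRel _

theorem num_le_iff_exists_add {x y : M.Num} : x ≤ y ↔ ∃ z, y = x + z := by
  constructor
  · intro h
    obtain ⟨z, hz⟩ := exists_add_of_le' h
    exact ⟨z, hz.symm⟩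
  · rintro ⟨z, rfl⟩
    exact le_add_right' _ _

theorem num_lt_add_one_iff {x y : M.Num} : x < y + 1 ↔ x ≤ y := by
  rw [lt_iff_le_and_ne]
  exact (le_iff_lt_succ' x y).symm

theorem num_add_one_le_iff {x y : M.Num} : x + 1 ≤ y ↔ x < y := by
  rw [← not_lt, num_lt_add_one_iff, not_le]

theorem num_zero_le (x : M.Num) : 0 ≤ x := zero_le' x

instance : Nontrivial M.Num := ⟨0, 1, fun h => by
  have := add_one_ne (M := M) M.zero
  rw [zero_add'] at this
  exact this h.symm⟩

instance : IsCancelAdd M.Num :=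
  { add_left_cancel := fun x y z h => by
      have h : x + y = x + z := h
      rw [add_comm x, add_comm x] at h
      exact add_right_cancel' h
    add_right_cancel := fun x y z h => add_right_cancel' h }

instance : IsOrderedAddMonoid M.Num where
  add_le_add_left x y h z := by
    obtain ⟨c, rfl⟩ := num_le_iff_exists_add.1 h
    exact num_le_iff_exists_add.2 ⟨c, by ring⟩

instance : ZeroLEOneClass M.Num := ⟨num_zero_le 1⟩

theorem num_pos_iff {x : M.Num} : 0 < x ↔ x ≠ 0 := by
  rw [lt_iff_le_and_ne, ne_comm]
  exact ⟨fun h => h.2, fun h => ⟨num_zero_le x, h⟩⟩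

theorem num_exists_pred {x : M.Num} (h : 0 < x) : ∃ y, x = y + 1 := by
  obtain ⟨y, -, hy⟩ := exists_pred' (num_pos_iff.1 h)
  exact ⟨y, hy.symm⟩

theorem num_mul_lt {x y z : M.Num} (hz : 0 < z) (h : x < y) : x * z < y * z := by
  obtain ⟨c, rfl⟩ := num_le_iff_exists_add.1 (num_add_one_le_iff.2 h)
  obtain ⟨d, rfl⟩ := num_exists_pred hz
  rw [← num_add_one_le_iff]
  exact num_le_iff_exists_add.2 ⟨d + c * (d + 1), by ring⟩

instance : IsStrictOrderedRing M.Num where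
  mul_lt_mul_of_pos_left := fun z hz x y h => by
    rw [mul_comm z, mul_comm z]; exact num_mul_lt hz h
  mul_lt_mul_of_pos_right := fun z hz x y h => num_mul_lt hz h
  le_of_add_le_add_left := fun x y z h => le_of_add_le_add_left h

/-! ### Strings -/

instance : Membership M.Num M.Str := ⟨fun X x => M.mem x X⟩

theorem lt_len_of_mem {x : M.Num} {X : M.Str} (h : x ∈ X) : x < M.len X :=
  lt_iff_le_and_ne.2 (mem_lt_len h)

theorem mem_of_succ_eq_len {x : M.Num} {X : M.Str} (h : x + 1 = M.len X) : x ∈ X :=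
  mem_of_add_one_eq_len h

theorem len_le_iff {X : M.Str} {b : M.Num} : M.len X ≤ b ↔ ∀ x ∈ X, x < b := by
  refine ⟨fun h x hx => (lt_len_of_mem hx).trans_le h, fun h => ?_⟩
  by_contra! hb
  obtain ⟨y, hy⟩ := num_exists_pred ((num_zero_le b).trans_lt hb)
  have := h y (mem_of_succ_eq_len hy.symm)
  rw [hy, num_lt_add_one_iff] at hb
  exact absurd this (not_lt.2 hb)

theorem str_ext {X Y : M.Str} (h : ∀ x, x ∈ X ↔ x ∈ Y) : X = Y := by
  refine str_ext' (le_antisymm (α := M.Num) ?_ ?_) fun x _ => h x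
  · exact len_le_iff.2 fun x hx => lt_len_of_mem ((h x).1 hx)
  · exact len_le_iff.2 fun x hx => lt_len_of_mem ((h x).2 hx)

/-- Induction for relations definable with parameters, in terms of the semiring operations. -/
theorem num_induction {P : M.Num → Prop} (hP : ParamDef M 1 (fun v => P (v 0)))
    (h0 : P 0) (hs : ∀ x, P x → P (x + 1)) (b : M.Num) : P b :=
  induction' hP h0 hs b

/-! ### Realization of formulas in models of `V⁰` -/

section
variable (v : Fin k → M.Num) (V : Fin l → M.Str)

theorem Formula.realize_le (t s : NTerm k l) :
    (Formula.le t s).Realize M v V ↔ t.eval M v V ≤ s.eval M v V := Iff.rfl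

theorem Formula.realize_mem (t : NTerm k l) (X : Fin l) :
    (Formula.mem t X).Realize M v V ↔ t.eval M v V ∈ V X := Iff.rfl

theorem Formula.realize_lt (t s : NTerm k l) :
    (Formula.lt t s).Realize M v V ↔ t.eval M v V < s.eval M v V := by
  rw [lt_iff_le_and_ne]; exact Iff.rfl

theorem Formula.realize_exLt (t : NTerm k l) (φ : Formula (k + 1) l) :
    (Formula.exLt t φ).Realize M v V ↔
      ∃ a, a < t.eval M v V ∧ φ.Realize M (Fin.snoc (α := fun _ => M.Num) v a) V := by
  simp only [Formula.exLt, realize_exLe, Formula.Realize, NTerm.eval_liftN, lt_iff_le_and_ne]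
  simp only [NTerm.eval, Fin.snoc_last, and_assoc]
  exact Iff.rfl

theorem Formula.realize_allLt (t : NTerm k l) (φ : Formula (k + 1) l) :
    (Formula.allLt t φ).Realize M v V ↔
      ∀ a, a < t.eval M v V → φ.Realize M (Fin.snoc (α := fun _ => M.Num) v a) V := by
  simp only [Formula.allLt, realize_allLe, Formula.realize_imp, Formula.Realize, NTerm.eval_liftN,
    lt_iff_le_and_ne]
  simp only [NTerm.eval, Fin.snoc_last, and_imp]
  exact Iff.rfl

end
end

/-! ### Definable number and string functions -/

/-- The pairing function `⟨x, y⟩` in a model of `V⁰`. -/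
def pr {R : Type*} [CommSemiring R] (x y : R) : R := (x + y) * (x + y + 1) + (1 + 1) * y

section
variable {ι : Type w} (S : ι → Structure.{u}) [∀ i, IsVZero (S i)] (nums : Set (∀ i, (S i).Num))
  (strs : Set (∀ i, (S i).Str)) (n : ℕ)

/-- Number functions with a `Σ₀ᴮ`-definable graph that are bounded by a number term. -/
def DefN (f : ∀ i, (Fin n → (S i).Num) → (S i).Num) : Prop :=
  (∃ t, IsTerm S nums strs n t ∧ ∀ i v, f i v ≤ t i v) ∧
  Def S nums strs (n + 1) (fun i w => w (Fin.last n) = f i (fun a => w a.castSucc))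

/-- String functions with a `Σ₀ᴮ`-definable bit graph whose length is bounded by a number term. -/
def DefS (F : ∀ i, (Fin n → (S i).Num) → (S i).Str) : Prop :=
  (∃ t, IsTerm S nums strs n t ∧ ∀ i v, (S i).len (F i v) ≤ t i v) ∧
  Def S nums strs (n + 1) (fun i w => w (Fin.last n) ∈ F i (fun a => w a.castSucc))

end

section
variable {ι : Type w} {S : ι → Structure.{u}} [∀ i, IsVZero (S i)] {nums : Set (∀ i, (S i).Num)}
  {strs : Set (∀ i, (S i).Str)} {n : ℕ}

theorem IsTerm.add' {t s : ∀ i, (Fin n → (S i).Num) → (S i).Num} (h : IsTerm S nums strs n t)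
    (h' : IsTerm S nums strs n s) : IsTerm S nums strs n (fun i v => t i v + s i v) := h.add h'

theorem IsTerm.mul' {t s : ∀ i, (Fin n → (S i).Num) → (S i).Num} (h : IsTerm S nums strs n t)
    (h' : IsTerm S nums strs n s) : IsTerm S nums strs n (fun i v => t i v * s i v) := h.mul h'

theorem Def.or {P Q : ∀ i, (Fin n → (S i).Num) → Prop} (hP : Def S nums strs n P)
    (hQ : Def S nums strs n Q) : Def S nums strs n (fun i v => P i v ∨ Q i v) :=
  (hP.not.and hQ.not).not.congr fun _ _ => by tauto

theorem Def.imp {P Q : ∀ i, (Fin n → (S i).Num) → Prop} (hP : Def S nums strs n P)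
    (hQ : Def S nums strs n Q) : Def S nums strs n (fun i v => P i v → Q i v) :=
  (hP.and hQ.not).not.congr fun _ _ => by tauto

theorem Def.iff {P Q : ∀ i, (Fin n → (S i).Num) → Prop} (hP : Def S nums strs n P)
    (hQ : Def S nums strs n Q) : Def S nums strs n (fun i v => P i v ↔ Q i v) :=
  ((hP.imp hQ).and (hQ.imp hP)).congr fun _ _ => by tauto

/-- Substitution of a definable function for the last variable of a definable relation. -/
theorem Def.subst {P : ∀ i, (Fin n → (S i).Num) → (S i).Num → Prop}
    {f : ∀ i, (Fin n → (S i).Num) → (S i).Num} (hf : DefN S nums strs n f)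
    (h : Def S nums strs (n + 1) (fun i w => P i (fun a => w a.castSucc) (w (Fin.last n)))) :
    Def S nums strs n (fun i v => P i v (f i v)) := by
  obtain ⟨⟨t, ht, hle⟩, hf⟩ := hf
  refine (Def.term_ex ht (hf.and h)).congr fun i v => ?_
  simp only [Fin.snoc_last, Fin.snoc_castSucc]
  constructor
  · rintro ⟨x, -, rfl, h⟩; exact h
  · intro h; exact ⟨_, hle i v, rfl, h⟩

theorem IsTerm.defN {t : ∀ i, (Fin n → (S i).Num) → (S i).Num} (h : IsTerm S nums strs n t) :
    DefN S nums strs n t :=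
  ⟨⟨t, h, fun _ _ => le_rfl⟩, .term_eq (.coord _) (h.rename Fin.castSucc)⟩

theorem DefN.rename {f : ∀ i, (Fin n → (S i).Num) → (S i).Num} (h : DefN S nums strs n f)
    {n' : ℕ} (g : Fin n → Fin n') : DefN S nums strs n' (fun i v => f i (fun a => v (g a))) := by
  obtain ⟨⟨t, ht, hle⟩, hf⟩ := h
  refine ⟨⟨_, ht.rename g, fun i v => hle i _⟩, (hf.rename (extendRen g)).congr fun i v => ?_⟩
  simp [extendRen]

theorem DefS.rename {F : ∀ i, (Fin n → (S i).Num) → (S i).Str} (h : DefS S nums strs n F)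
    {n' : ℕ} (g : Fin n → Fin n') : DefS S nums strs n' (fun i v => F i (fun a => v (g a))) := by
  obtain ⟨⟨t, ht, hle⟩, hf⟩ := h
  refine ⟨⟨_, ht.rename g, fun i v => hle i _⟩, (hf.rename (extendRen g)).congr fun i v => ?_⟩
  simp [extendRen]

theorem DefN.of_le {f g : ∀ i, (Fin n → (S i).Num) → (S i).Num} (hg : DefN S nums strs n g)
    (hle : ∀ i v, f i v ≤ g i v)
    (hf : Def S nums strs (n + 1) (fun i w => w (Fin.last n) = f i (fun a => w a.castSucc))) :
    DefN S nums strs n f := by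
  obtain ⟨⟨t, ht, h⟩, -⟩ := hg
  exact ⟨⟨t, ht, fun i v => (hle i v).trans (h i v)⟩, hf⟩

theorem DefN.coord (a : Fin n) : DefN S nums strs n (fun _ v => v a) := (IsTerm.coord a).defN

theorem DefN.num {f : ∀ i, (S i).Num} (h : f ∈ nums) : DefN S nums strs n (fun i _ => f i) :=
  (IsTerm.num f h).defN

theorem DefN.zero : DefN S nums strs n (fun _ _ => 0) := IsTerm.zero.defN

theorem DefN.one : DefN S nums strs n (fun _ _ => 1) := IsTerm.one.defN

theorem DefN.param {M : Structure.{u}} [IsVZero M] (x : M.Num) :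
    DefN (fun _ : Unit => M) Set.univ Set.univ n (fun _ _ => x) :=
  .num (f := fun _ => x) (Set.mem_univ _)

theorem Def.eq {f g : ∀ i, (Fin n → (S i).Num) → (S i).Num} (hf : DefN S nums strs n f)
    (hg : DefN S nums strs n g) : Def S nums strs n (fun i v => f i v = g i v) :=
  Def.subst (P := fun i v x => x = g i v) hf hg.2

theorem Def.le {f g : ∀ i, (Fin n → (S i).Num) → (S i).Num} (hf : DefN S nums strs n f)
    (hg : DefN S nums strs n g) : Def S nums strs n (fun i v => f i v ≤ g i v) :=
  Def.subst (P := fun i v x => x ≤ g i v) hf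
    (Def.subst (P := fun _ v x => v (Fin.last n) ≤ x) (hg.rename Fin.castSucc)
      (.term_le (.coord _) (.coord _)))

theorem Def.lt {f g : ∀ i, (Fin n → (S i).Num) → (S i).Num} (hf : DefN S nums strs n f)
    (hg : DefN S nums strs n g) : Def S nums strs n (fun i v => f i v < g i v) :=
  (Def.le hg hf).not.congr fun _ _ => by rw [not_le]

theorem Def.ne {f g : ∀ i, (Fin n → (S i).Num) → (S i).Num} (hf : DefN S nums strs n f)
    (hg : DefN S nums strs n g) : Def S nums strs n (fun i v => f i v ≠ g i v) :=
  (Def.eq hf hg).not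

theorem DefN.add {f g : ∀ i, (Fin n → (S i).Num) → (S i).Num} (hf : DefN S nums strs n f)
    (hg : DefN S nums strs n g) : DefN S nums strs n (fun i v => f i v + g i v) := by
  obtain ⟨⟨t, ht, htle⟩, -⟩ := id hf
  obtain ⟨⟨s, hs, hsle⟩, -⟩ := id hg
  refine ⟨⟨_, ht.add' hs, fun i v => add_le_add (htle i v) (hsle i v)⟩, ?_⟩
  refine Def.subst (P := fun i w x => w (Fin.last n) = x + g i (fun a => w a.castSucc))
    (hf.rename Fin.castSucc) ?_
  refine Def.subst (P := fun i w x => w (Fin.last n).castSucc = w (Fin.last (n + 1)) + x)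
    (hg.rename fun a => a.castSucc.castSucc) ?_
  exact .term_eq (.coord _) (.add (.coord _) (.coord _))

theorem DefN.mul {f g : ∀ i, (Fin n → (S i).Num) → (S i).Num} (hf : DefN S nums strs n f)
    (hg : DefN S nums strs n g) : DefN S nums strs n (fun i v => f i v * g i v) := by
  obtain ⟨⟨t, ht, htle⟩, -⟩ := id hf
  obtain ⟨⟨s, hs, hsle⟩, -⟩ := id hg
  refine ⟨⟨_, ht.mul' hs, fun i v =>
    mul_le_mul (htle i v) (hsle i v) (num_zero_le _) (num_zero_le _)⟩, ?_⟩
  refine Def.subst (P := fun i w x => w (Fin.last n) = x * g i (fun a => w a.castSucc))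
    (hf.rename Fin.castSucc) ?_
  refine Def.subst (P := fun i w x => w (Fin.last n).castSucc = w (Fin.last (n + 1)) * x)
    (hg.rename fun a => a.castSucc.castSucc) ?_
  exact .term_eq (.coord _) (.mul (.coord _) (.coord _))

theorem DefN.pr {f g : ∀ i, (Fin n → (S i).Num) → (S i).Num} (hf : DefN S nums strs n f)
    (hg : DefN S nums strs n g) : DefN S nums strs n (fun i v => pr (f i v) (g i v)) :=
  ((hf.add hg).mul ((hf.add hg).add .one)).add ((DefN.one.add .one).mul hg)

theorem Def.exLe {Q : ∀ i, (Fin n → (S i).Num) → (S i).Num → Prop}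
    {f : ∀ i, (Fin n → (S i).Num) → (S i).Num} (hf : DefN S nums strs n f)
    (h : Def S nums strs (n + 1) (fun i w => Q i (fun a => w a.castSucc) (w (Fin.last n)))) :
    Def S nums strs n (fun i v => ∃ x, x ≤ f i v ∧ Q i v x) := by
  refine Def.subst (P := fun i v y => ∃ x, x ≤ y ∧ Q i v x) hf ?_
  refine (Def.term_ex (.coord (Fin.last n)) (h.rename (extendRen Fin.castSucc))).congr fun i v => ?_
  simp only [extendRen, Fin.snoc_last, Fin.snoc_castSucc]
  exact Iff.rfl

theorem Def.exLt {Q : ∀ i, (Fin n → (S i).Num) → (S i).Num → Prop}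
    {f : ∀ i, (Fin n → (S i).Num) → (S i).Num} (hf : DefN S nums strs n f)
    (h : Def S nums strs (n + 1) (fun i w => Q i (fun a => w a.castSucc) (w (Fin.last n)))) :
    Def S nums strs n (fun i v => ∃ x, x < f i v ∧ Q i v x) := by
  refine (Def.exLe (Q := fun i v x => x < f i v ∧ Q i v x) hf
    ((Def.lt (.coord _) (hf.rename _)).and h)).congr fun i v => ?_
  exact ⟨fun ⟨x, _, h⟩ => ⟨x, h⟩, fun ⟨x, h⟩ => ⟨x, h.1.le, h⟩⟩

theorem Def.allLe {Q : ∀ i, (Fin n → (S i).Num) → (S i).Num → Prop}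
    {f : ∀ i, (Fin n → (S i).Num) → (S i).Num} (hf : DefN S nums strs n f)
    (h : Def S nums strs (n + 1) (fun i w => Q i (fun a => w a.castSucc) (w (Fin.last n)))) :
    Def S nums strs n (fun i v => ∀ x, x ≤ f i v → Q i v x) :=
  (Def.exLe (Q := fun i v x => ¬ Q i v x) hf h.not).not.congr fun i v => by
    simp only [not_exists, not_and, not_not]

theorem Def.allLt {Q : ∀ i, (Fin n → (S i).Num) → (S i).Num → Prop}
    {f : ∀ i, (Fin n → (S i).Num) → (S i).Num} (hf : DefN S nums strs n f)
    (h : Def S nums strs (n + 1) (fun i w => Q i (fun a => w a.castSucc) (w (Fin.last n)))) :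
    Def S nums strs n (fun i v => ∀ x, x < f i v → Q i v x) :=
  (Def.exLt (Q := fun i v x => ¬ Q i v x) hf h.not).not.congr fun i v => by
    simp only [not_exists, not_and, not_not]

theorem Def.mem {f : ∀ i, (Fin n → (S i).Num) → (S i).Num}
    {F : ∀ i, (Fin n → (S i).Num) → (S i).Str} (hf : DefN S nums strs n f)
    (hF : DefS S nums strs n F) : Def S nums strs n (fun i v => f i v ∈ F i v) :=
  Def.subst (P := fun i v x => x ∈ F i v) hf hF.2

theorem DefS.str {F : ∀ i, (S i).Str} (h : F ∈ strs) : DefS S nums strs n (fun i _ => F i) :=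
  ⟨⟨_, .len F h, fun _ _ => le_rfl⟩, .term_mem (.coord _) h⟩

theorem DefS.param {M : Structure.{u}} [IsVZero M] (X : M.Str) :
    DefS (fun _ : Unit => M) Set.univ Set.univ n (fun _ _ => X) :=
  .str (F := fun _ => X) (Set.mem_univ _)

/-- The length of `X` is the strict upper bound of `X` that is zero or the successor of an element
of `X`. -/
theorem DefN.len {F : ∀ i, (Fin n → (S i).Num) → (S i).Str} (hF : DefS S nums strs n F) :
    DefN S nums strs n (fun i v => (S i).len (F i v)) := by
  obtain ⟨t, ht, hle⟩ := hF.1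
  refine ⟨⟨t, ht, hle⟩, ?_⟩
  have hd : Def S nums strs (n + 1) (fun i w =>
      (∀ z, z ≤ t i (fun a => w a.castSucc) → z ∈ F i (fun a => w a.castSucc) →
        z < w (Fin.last n)) ∧
      (w (Fin.last n) = 0 ∨ ∃ z, z ≤ w (Fin.last n) ∧ (z + 1 = w (Fin.last n) ∧
        z ∈ F i (fun a => w a.castSucc)))) := by
    refine .and (.allLe (ht.defN.rename Fin.castSucc)
      (.imp (.mem (.coord _) (hF.rename fun a => a.castSucc.castSucc)) (.lt (.coord _) (.coord _))))
      (.or (.eq (.coord _) .zero) (.exLe (.coord _) (.and (.eq (.add (.coord _) .one) (.coord _))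
        (.mem (.coord _) (hF.rename fun a => a.castSucc.castSucc)))))
  refine hd.congr fun i w => ?_
  constructor
  · rintro ⟨h1, h2⟩
    refine le_antisymm ?_ (len_le_iff.2 fun x hx => h1 x ?_ hx)
    · rcases h2 with h2 | ⟨z, -, h2, h3⟩
      · rw [h2]; exact num_zero_le _
      · rw [← h2, num_add_one_le_iff]; exact lt_len_of_mem h3
    · exact (lt_len_of_mem hx).le.trans (hle i _)
  · intro h
    refine ⟨fun z _ hz => h ▸ lt_len_of_mem hz, ?_⟩
    rcases (num_zero_le (w (Fin.last n))).eq_or_lt with h0 | h0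
    · exact Or.inl h0.symm
    · obtain ⟨y, hy⟩ := num_exists_pred h0
      refine Or.inr ⟨y, ?_, hy.symm, mem_of_succ_eq_len (hy ▸ h)⟩
      rw [hy]; exact (num_lt_add_one_iff.2 le_rfl).le

theorem Def.strEq {F G : ∀ i, (Fin n → (S i).Num) → (S i).Str} (hF : DefS S nums strs n F)
    (hG : DefS S nums strs n G) : Def S nums strs n (fun i v => F i v = G i v) := by
  refine (Def.and (Def.allLt (Q := fun i v x => x ∈ F i v → x ∈ G i v) (.len hF)
    (.imp (.mem (.coord _) (hF.rename _)) (.mem (.coord _) (hG.rename _))))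
    (Def.allLt (Q := fun i v x => x ∈ G i v → x ∈ F i v) (.len hG)
    (.imp (.mem (.coord _) (hG.rename _)) (.mem (.coord _) (hF.rename _))))).congr fun i v => ?_
  constructor
  · rintro ⟨h, h'⟩
    exact str_ext fun x => ⟨fun hx => h x (lt_len_of_mem hx) hx,
      fun hx => h' x (lt_len_of_mem hx) hx⟩
  · intro h
    rw [h]
    exact ⟨fun _ _ h => h, fun _ _ h => h⟩

theorem DefN.ite {P : ∀ i, (Fin n → (S i).Num) → Prop} {_ : ∀ i v, Decidable (P i v)}
    (hP : Def S nums strs n P)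
    {f g : ∀ i, (Fin n → (S i).Num) → (S i).Num} (hf : DefN S nums strs n f)
    (hg : DefN S nums strs n g) :
    DefN S nums strs n (fun i v => if P i v then f i v else g i v) := by
  refine DefN.of_le (hf.add hg) (fun i v => ?_) ?_
  · split_ifs
    · exact le_add_of_nonneg_right (num_zero_le _)
    · exact le_add_of_nonneg_left (num_zero_le _)
  · refine (Def.or ((hP.rename Fin.castSucc).and hf.2)
      ((hP.rename Fin.castSucc).not.and hg.2)).congr fun i v => ?_
    split_ifs with h <;> simp [h]

/-! ### Comprehension and the least number principle -/

theorem exists_least_of_mem {M : Structure.{u}} [IsVZero M] {X : M.Str} {x : M.Num} (hx : x ∈ X) :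
    ∃ y ∈ X, ∀ z < y, z ∉ X := by
  by_contra! h
  refine num_induction (P := fun x => ∀ y ≤ x, y ∉ X) ?_ ?_ ?_ x x le_rfl hx
  · exact .allLe (.coord _) (.not (.mem (.coord _) (.param X)))
  · intro y hy hyX
    obtain ⟨z, hz, -⟩ := h y hyX
    exact absurd (hz.trans_le hy) (not_lt.2 (num_zero_le z))
  · intro x ih y hy hyX
    obtain ⟨z, hz, hzX⟩ := h y hyX
    exact ih z (num_lt_add_one_iff.1 (hz.trans_le hy)) hzX

open Classical in
/-- The string of length at most `b` whose elements are the `z < b` satisfying `P`, if it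
exists. -/
noncomputable def mkStr (M : Structure.{u}) [IsVZero M] (b : M.Num) (P : M.Num → Prop) : M.Str :=
  if h : ∃ X, M.len X ≤ b ∧ ∀ z < b, z ∈ X ↔ P z then h.choose else Classical.choice M.strNonempty

open Classical in
/-- The least `y < b` satisfying `P`, or `b` if there is none. -/
noncomputable def least (M : Structure.{u}) [IsVZero M] (b : M.Num) (P : M.Num → Prop) : M.Num :=
  if h : ∃ y, y < b ∧ P y ∧ ∀ z < y, ¬ P z then h.choose else b

/-- Comprehension provides the string `mkStr` for definable relations. -/
theorem Def.mem_mkStr {Q : ∀ i, (Fin n → (S i).Num) → (S i).Num → Prop}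
    (h : Def S nums strs (n + 1) (fun i w => Q i (fun a => w a.castSucc) (w (Fin.last n))))
    (i : ι) (v : Fin n → (S i).Num) {b z : (S i).Num} :
    z ∈ mkStr (S i) b (Q i v) ↔ z < b ∧ Q i v z := by
  have hex : ∃ X, (S i).len X ≤ b ∧ ∀ z < b, z ∈ X ↔ Q i v z := by
    obtain ⟨X, hX, h⟩ := h.exists_str i v b
    refine ⟨X, hX, fun z hz => ?_⟩
    have := h z (lt_iff_le_and_ne.1 hz)
    simp only [Fin.snoc_last, Fin.snoc_castSucc] at this
    exact this
  rw [mkStr, dif_pos hex]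
  obtain ⟨h1, h2⟩ := hex.choose_spec
  exact ⟨fun h => have hb := (lt_len_of_mem h).trans_le h1; ⟨hb, (h2 z hb).1 h⟩,
    fun h => (h2 z h.1).2 h.2⟩

theorem Def.exists_least {Q : ∀ i, (Fin n → (S i).Num) → (S i).Num → Prop}
    (h : Def S nums strs (n + 1) (fun i w => Q i (fun a => w a.castSucc) (w (Fin.last n))))
    (i : ι) (v : Fin n → (S i).Num) {y : (S i).Num} (hy : Q i v y) :
    ∃ y, Q i v y ∧ ∀ z < y, ¬ Q i v z := by
  have hm := fun z => h.mem_mkStr i v (b := y + 1) (z := z)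
  obtain ⟨x, hx, hx'⟩ := exists_least_of_mem ((hm y).2 ⟨num_lt_add_one_iff.2 le_rfl, hy⟩)
  rw [hm] at hx
  exact ⟨x, hx.2, fun z hz hQ => hx' z hz ((hm z).2 ⟨hz.trans hx.1, hQ⟩)⟩

/-- Strong induction for relations definable with parameters. -/
theorem num_strong_induction {M : Structure.{u}} [IsVZero M] {P : M.Num → Prop}
    (hP : ParamDef M 1 (fun v => P (v 0))) (h : ∀ x, (∀ y < x, P y) → P x) (x : M.Num) : P x := by
  by_contra hx
  obtain ⟨y, hy, hy'⟩ := Def.exists_least (Q := fun _ _ x => ¬ P x) (n := 0)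
    hP.not () ![] hx
  exact hy (h y fun z hz => not_not.1 (hy' z hz))

theorem least_eq {M : Structure.{u}} [IsVZero M] {P : M.Num → Prop} {b y : M.Num} (hb : y < b)
    (hy : P y) (hmin : ∀ z < y, ¬ P z) : least M b P = y := by
  have hex : ∃ y, y < b ∧ P y ∧ ∀ z < y, ¬ P z := ⟨y, hb, hy, hmin⟩
  rw [least, dif_pos hex]
  obtain ⟨-, h1, h2⟩ := hex.choose_spec
  refine le_antisymm (not_lt.1 fun h => h2 y h hy) (not_lt.1 fun h => hmin _ h h1)

theorem least_eq_of_unique {M : Structure.{u}} [IsVZero M] {P : M.Num → Prop} {b y : M.Num}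
    (hb : y < b) (hP : ∀ z, P z ↔ z = y) : least M b P = y :=
  least_eq hb ((hP y).2 rfl) fun z hz h => hz.ne ((hP z).1 h)

theorem least_le {M : Structure.{u}} [IsVZero M] {P : M.Num → Prop} {b : M.Num} :
    least M b P ≤ b := by
  rw [least]
  split_ifs with h
  · exact h.choose_spec.1.le
  · exact le_rfl

theorem Def.eq_least_iff {Q : ∀ i, (Fin n → (S i).Num) → (S i).Num → Prop}
    (h : Def S nums strs (n + 1) (fun i w => Q i (fun a => w a.castSucc) (w (Fin.last n))))
    (i : ι) (v : Fin n → (S i).Num) {b y : (S i).Num} :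
    y = least (S i) b (Q i v) ↔ y ≤ b ∧ (y < b → Q i v y) ∧ ∀ z < y, ¬ Q i v z := by
  by_cases hex : ∃ y, y < b ∧ Q i v y ∧ ∀ z < y, ¬ Q i v z
  · obtain ⟨x, hx, hx', hx''⟩ := hex
    rw [least_eq hx hx' hx'']
    constructor
    · rintro rfl; exact ⟨hx.le, fun _ => hx', hx''⟩
    · rintro ⟨h1, h2, h3⟩
      have hxy : y ≤ x := not_lt.1 fun h => h3 x h hx'
      exact le_antisymm hxy (not_lt.1 fun h => hx'' _ h (h2 (hxy.trans_lt hx)))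
  · rw [least, dif_neg hex]
    constructor
    · rintro rfl
      refine ⟨le_rfl, fun h => absurd h (lt_irrefl _), fun z hz hQ => hex ?_⟩
      obtain ⟨x, hx, hx'⟩ := h.exists_least i v hQ
      exact ⟨x, (not_lt.1 fun h => hx' z h hQ).trans_lt hz, hx, hx'⟩
    · rintro ⟨h1, h2, h3⟩
      by_contra hne
      exact hex ⟨y, lt_of_le_of_ne h1 hne, h2 (lt_of_le_of_ne h1 hne), h3⟩

theorem DefN.least {Q : ∀ i, (Fin n → (S i).Num) → (S i).Num → Prop}
    {b : ∀ i, (Fin n → (S i).Num) → (S i).Num} (hb : DefN S nums strs n b)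
    (h : Def S nums strs (n + 1) (fun i w => Q i (fun a => w a.castSucc) (w (Fin.last n)))) :
    DefN S nums strs n (fun i v => least (S i) (b i v) (Q i v)) := by
  refine hb.of_le (fun i v => least_le) ?_
  have hd : Def S nums strs (n + 1) (fun i w =>
      w (Fin.last n) ≤ b i (fun a => w a.castSucc) ∧ (w (Fin.last n) < b i (fun a => w a.castSucc) →
        Q i (fun a => w a.castSucc) (w (Fin.last n))) ∧
      ∀ z, z < w (Fin.last n) → ¬ Q i (fun a => w a.castSucc) z) := by
    refine .and (.le (.coord _) (hb.rename _)) (.and (.imp (.lt (.coord _) (hb.rename _)) h)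
      (.allLt (.coord _) (.not ?_)))
    refine (h.rename (extendRen Fin.castSucc)).congr fun i v => ?_
    simp [extendRen]
  exact hd.congr fun i w => (h.eq_least_iff i _).symm

theorem DefS.mkStr {Q : ∀ i, (Fin n → (S i).Num) → (S i).Num → Prop}
    {b : ∀ i, (Fin n → (S i).Num) → (S i).Num} (hb : DefN S nums strs n b)
    (h : Def S nums strs (n + 1) (fun i w => Q i (fun a => w a.castSucc) (w (Fin.last n)))) :
    DefS S nums strs n (fun i v => mkStr (S i) (b i v) (Q i v)) := by
  obtain ⟨⟨t, ht, hle⟩, -⟩ := id hb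
  refine ⟨⟨t, ht, fun i v => (len_le_iff.2 fun x hx => ?_).trans (hle i v)⟩, ?_⟩
  · exact ((h.mem_mkStr i v).1 hx).1
  · exact ((Def.lt (.coord _) (hb.rename Fin.castSucc)).and h).congr fun i w =>
      (h.mem_mkStr i _).symm

/-! ### Substitution of definable functions into formulas -/

theorem DefN.eval {k l : ℕ} {f : Fin k → ∀ i, (Fin n → (S i).Num) → (S i).Num}
    {F : Fin l → ∀ i, (Fin n → (S i).Num) → (S i).Str} (hf : ∀ a, DefN S nums strs n (f a))
    (hF : ∀ b, DefS S nums strs n (F b)) (t : NTerm k l) :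
    DefN S nums strs n (fun i v => t.eval (S i) (fun a => f a i v) (fun b => F b i v)) := by
  induction t with
  | var a => exact hf a
  | zero => exact .zero
  | one => exact .one
  | add _ _ h h' => exact h.add h'
  | mul _ _ h h' => exact h.mul h'
  | len b => exact .len (hF b)

/-- A relation obtained from a `Σ₀ᴮ`-formula by substitution of definable functions is definable. -/
theorem Def.realize {k l : ℕ} {φ : Formula k l} (hφ : φ.IsSigmaZeroB) :
    ∀ {n : ℕ} {f : Fin k → ∀ i, (Fin n → (S i).Num) → (S i).Num}
    {F : Fin l → ∀ i, (Fin n → (S i).Num) → (S i).Str}, (∀ a, DefN S nums strs n (f a)) →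
    (∀ b, DefS S nums strs n (F b)) →
    Def S nums strs n (fun i v => φ.Realize (S i) (fun a => f a i v) (fun b => F b i v)) := by
  have key : ∀ {k n : ℕ} {f : Fin k → ∀ i, (Fin n → (S i).Num) → (S i).Num},
      (∀ a, DefN S nums strs n (f a)) → ∃ f' : Fin (k + 1) → ∀ i, (Fin (n + 1) → (S i).Num) →
        (S i).Num, (∀ a, DefN S nums strs (n + 1) (f' a)) ∧ ∀ i w, (fun a => f' a i w) =
          Fin.snoc (α := fun _ => (S i).Num) (fun a => f a i (fun b => w b.castSucc))
            (w (Fin.last n)) := by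
    intro k n f hf
    refine ⟨fun a i w => Fin.snoc (α := fun _ => (S i).Num)
      (fun a => f a i (fun b => w b.castSucc)) (w (Fin.last n)) a, fun a => ?_, fun _ _ => rfl⟩
    refine Fin.lastCases ?_ (fun a => ?_) a
    · simpa using DefN.coord _
    · simpa using (hf a).rename Fin.castSucc
  induction hφ with
  | eq t s => intro n f F hf hF; exact .eq (.eval hf hF t) (.eval hf hF s)
  | le t s => intro n f F hf hF; exact .le (.eval hf hF t) (.eval hf hF s)
  | strEq X Y => intro n f F hf hF; exact .strEq (hF X) (hF Y)
  | mem t X => intro n f F hf hF; exact .mem (.eval hf hF t) (hF X)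
  | neg _ h => intro n f F hf hF; exact .not (h hf hF)
  | and _ _ h h' => intro n f F hf hF; exact .and (h hf hF) (h' hf hF)
  | or _ _ h h' => intro n f F hf hF; exact .or (h hf hF) (h' hf hF)
  | exLe t _ h =>
    intro n f F hf hF
    obtain ⟨f', hf', e⟩ := key hf
    have h1 := h hf' (fun b => (hF b).rename Fin.castSucc)
    simp_rw [e] at h1
    refine (Def.exLe (.eval hf hF t) (Q := fun i v x => Formula.Realize (S i) _
      (Fin.snoc (α := fun _ => (S i).Num) (fun a => f a i v) x) (fun b => F b i v)) h1).congr
      fun i v => ?_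
    rw [Formula.realize_exLe]
    exact Iff.rfl
  | allLe t _ h =>
    intro n f F hf hF
    obtain ⟨f', hf', e⟩ := key hf
    have h1 := h hf' (fun b => (hF b).rename Fin.castSucc)
    simp_rw [e] at h1
    refine (Def.allLe (.eval hf hF t) (Q := fun i v x => Formula.Realize (S i) _
      (Fin.snoc (α := fun _ => (S i).Num) (fun a => f a i v) x) (fun b => F b i v)) h1).congr
      fun i v => ?_
    rw [Formula.realize_allLe]
    exact Iff.rfl

end

/-- Definability by recursion on the shape of a relation: the hypothesis is filled in by applying
the closure properties. -/
theorem Def.auto {ι : Type w} {S : ι → Structure.{u}} [∀ i, IsVZero (S i)]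
    {nums : Set (∀ i, (S i).Num)} {strs : Set (∀ i, (S i).Str)} {n : ℕ}
    {P : ∀ i, (Fin n → (S i).Num) → Prop}
    (h : Def S nums strs n P := by
      with_reducible apply_rules (maxDepth := 300) [Def.ne, Def.not, Def.and, Def.or, Def.imp,
        Def.iff, Def.exLt,
        Def.exLe, Def.allLt, Def.allLe, Def.eq, Def.le, Def.lt, Def.mem, DefN.param, DefN.coord,
        DefN.zero, DefN.one, DefN.pr, DefN.add, DefN.mul, DefN.len, DefN.least, DefN.ite,
        DefS.param]) :
    Def S nums strs n P := h

/-! ### Pairs and rows -/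

section
variable {M : Structure.{u}} [IsVZero M]

theorem pr_lt_of_add_lt {x y x' y' : M.Num} (h : x + y < x' + y') : pr x y < pr x' y' := by
  obtain ⟨d, hd⟩ := num_le_iff_exists_add.1 (num_add_one_le_iff.2 h)
  rw [← num_add_one_le_iff]
  refine num_le_iff_exists_add.2
    ⟨x + x + 1 + d * (x + y) + d * (x + y) + d + d + d + d * d + y' + y', ?_⟩
  rw [pr, pr, hd]
  ring

theorem pr_inj {x y x' y' : M.Num} : pr x y = pr x' y' ↔ x = x' ∧ y = y' := by
  refine ⟨fun h => ?_, fun ⟨h, h'⟩ => by rw [h, h']⟩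
  have hs : x + y = x' + y' := by
    rcases lt_trichotomy (x + y) (x' + y') with h' | h' | h'
    · exact absurd h (pr_lt_of_add_lt h').ne
    · exact h'
    · exact absurd h (pr_lt_of_add_lt h').ne'
  rw [pr, pr, hs] at h
  grind

theorem le_pr_left (x y : M.Num) : x ≤ pr x y :=
  num_le_iff_exists_add.2 ⟨(x + y) * (x + y) + y + y + y, by rw [pr]; ring⟩

theorem le_pr_right (x y : M.Num) : y ≤ pr x y :=
  num_le_iff_exists_add.2 ⟨(x + y) * (x + y) + x + y + y, by rw [pr]; ring⟩

theorem pr_le_pr {x y x' y' : M.Num} (h : x ≤ x') (h' : y ≤ y') : pr x y ≤ pr x' y' := by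
  obtain ⟨a, rfl⟩ := num_le_iff_exists_add.1 h
  obtain ⟨b, rfl⟩ := num_le_iff_exists_add.1 h'
  refine num_le_iff_exists_add.2
    ⟨(x + y) * (a + b) + (a + b) * (x + a + (y + b) + 1) + b + b, ?_⟩
  rw [pr, pr]
  ring

theorem pr_lt_pr {x y x' y' : M.Num} (h : x < x') (h' : y ≤ y') : pr x y < pr x' y' :=
  pr_lt_of_add_lt (add_lt_add_of_lt_of_le h h')

theorem pr_zero : pr (0 : M.Num) 0 = 0 := by simp [pr]

theorem row_lt {W t t' s : M.Num} (hs : s < W) (h : t < t') (s' : M.Num) :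
    t * W + s < t' * W + s' := by
  obtain ⟨d, rfl⟩ := num_le_iff_exists_add.1 (num_add_one_le_iff.2 h)
  have : (t + 1 + d) * W + s' = t * W + W + (d * W + s') := by ring
  rw [this]
  have := num_zero_le (d * W + s')
  grind

theorem row_lt_iff {W t t' s s' : M.Num} (hs : s < W) (hs' : s' < W) :
    t * W + s < t' * W + s' ↔ t < t' ∨ t = t' ∧ s < s' := by
  rcases lt_trichotomy t t' with h | rfl | h
  · simp [h, row_lt hs h]
  · simp
  · simp [h.not_gt, h.ne', (row_lt hs' h s).le]

/-- The number `t * W + s` with `s < W` determines its row `t` and its column `s`. -/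
theorem row_inj {W t t' s s' : M.Num} (hs : s < W) (hs' : s' < W) :
    t * W + s = t' * W + s' ↔ t = t' ∧ s = s' := by
  refine ⟨fun h => ?_, fun ⟨h, h'⟩ => by rw [h, h']⟩
  rcases lt_trichotomy t t' with h' | rfl | h'
  · exact absurd h (row_lt hs h' _).ne
  · exact ⟨rfl, add_left_cancel h⟩
  · exact absurd h (row_lt hs' h' _).ne'

theorem row_lt_mul {W t T s : M.Num} (hs : s < W) (h : t < T) : t * W + s < T * W := by
  simpa using row_lt hs h 0

/-! ### Matrices and sequences as strings -/

/-- The string coding the matrix `R` with `m` rows and `n` columns. -/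
noncomputable def relStr (M : Structure.{u}) [IsVZero M] (m n : M.Num)
    (R : M.Num → M.Num → Prop) : M.Str :=
  mkStr M (pr m n) (fun z => ∃ a, a < m ∧ ∃ b, b < n ∧ (z = pr a b ∧ R a b))

end

section
variable {ι : Type w} {S : ι → Structure.{u}} [∀ i, IsVZero (S i)] {nums : Set (∀ i, (S i).Num)}
  {strs : Set (∀ i, (S i).Str)} {n : ℕ}

theorem Def.relStr_aux {R : ∀ i, (Fin n → (S i).Num) → (S i).Num → (S i).Num → Prop}
    {b c : ∀ i, (Fin n → (S i).Num) → (S i).Num}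
    (hb : DefN S nums strs n b) (hc : DefN S nums strs n c)
    (h : Def S nums strs (n + 1 + 1) (fun i w => R i (fun a => w a.castSucc.castSucc)
      (w (Fin.last n).castSucc) (w (Fin.last (n + 1))))) :
    Def S nums strs (n + 1) (fun i w => ∃ x, x < b i (fun a => w a.castSucc) ∧
      ∃ y, y < c i (fun a => w a.castSucc) ∧ (w (Fin.last n) = pr x y ∧
        R i (fun a => w a.castSucc) x y)) := by
  refine .exLt (hb.rename _) (.exLt (hc.rename fun a => a.castSucc.castSucc)
    (.and (.eq (.coord _) (.pr (.coord _) (.coord _))) ?_))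
  exact h.rename (extendRen (extendRen Fin.castSucc)) |>.congr fun i w => by simp [extendRen]

theorem Def.mem_relStr {R : ∀ i, (Fin n → (S i).Num) → (S i).Num → (S i).Num → Prop}
    {b c : ∀ i, (Fin n → (S i).Num) → (S i).Num}
    (hb : DefN S nums strs n b) (hc : DefN S nums strs n c)
    (h : Def S nums strs (n + 1 + 1) (fun i w => R i (fun a => w a.castSucc.castSucc)
      (w (Fin.last n).castSucc) (w (Fin.last (n + 1)))))
    (i : ι) (v : Fin n → (S i).Num) {x y : (S i).Num} :
    pr x y ∈ relStr (S i) (b i v) (c i v) (R i v) ↔ x < b i v ∧ y < c i v ∧ R i v x y := by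
  refine (Def.mem_mkStr
    (Q := fun i v z => ∃ x, x < b i v ∧ ∃ y, y < c i v ∧ (z = pr x y ∧ R i v x y))
    (Def.relStr_aux hb hc h) i v).trans ?_
  constructor
  · rintro ⟨-, a, ha, d, hd, e, h⟩
    obtain ⟨rfl, rfl⟩ := pr_inj.1 e
    exact ⟨ha, hd, h⟩
  · rintro ⟨ha, hd, h⟩
    exact ⟨pr_lt_pr ha hd.le, x, ha, y, hd, rfl, h⟩

theorem DefS.relStr {R : ∀ i, (Fin n → (S i).Num) → (S i).Num → (S i).Num → Prop}
    {b c : ∀ i, (Fin n → (S i).Num) → (S i).Num}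
    (hb : DefN S nums strs n b) (hc : DefN S nums strs n c)
    (h : Def S nums strs (n + 1 + 1) (fun i w => R i (fun a => w a.castSucc.castSucc)
      (w (Fin.last n).castSucc) (w (Fin.last (n + 1))))) :
    DefS S nums strs n (fun i v => relStr (S i) (b i v) (c i v) (R i v)) :=
  .mkStr (hb.pr hc) (Def.relStr_aux hb hc h)

/-- The number `(X)ⁱ` in a model of `V⁰`. -/
noncomputable def seq (M : Structure.{u}) [IsVZero M] (X : M.Str) (i : M.Num) : M.Num :=
  least M (M.len X) (fun y => pr i y ∈ X)

/-- The first component of a pair; it is bounded by `c` for all `c`. -/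
noncomputable def fstPr (M : Structure.{u}) [IsVZero M] (c : M.Num) : M.Num :=
  least M c (fun x => ∃ y, y ≤ c ∧ c = pr x y)

/-- The second component of a pair; it is bounded by `c` for all `c`. -/
noncomputable def sndPr (M : Structure.{u}) [IsVZero M] (c : M.Num) : M.Num :=
  least M c (fun y => ∃ x, x ≤ c ∧ c = pr x y)

theorem DefN.seq {X : ∀ i, (Fin n → (S i).Num) → (S i).Str}
    {f : ∀ i, (Fin n → (S i).Num) → (S i).Num} (hX : DefS S nums strs n X)
    (hf : DefN S nums strs n f) : DefN S nums strs n (fun i v => seq (S i) (X i v) (f i v)) :=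
  .least (.len hX) (.mem (.pr (hf.rename _) (.coord _)) (hX.rename _))

theorem DefN.fstPr {f : ∀ i, (Fin n → (S i).Num) → (S i).Num}
    (hf : DefN S nums strs n f) : DefN S nums strs n (fun i v => fstPr (S i) (f i v)) :=
  .least hf (.exLe (hf.rename _) (.eq (hf.rename fun a => a.castSucc.castSucc)
    (.pr (.coord _) (.coord _))))

theorem DefN.sndPr {f : ∀ i, (Fin n → (S i).Num) → (S i).Num}
    (hf : DefN S nums strs n f) : DefN S nums strs n (fun i v => sndPr (S i) (f i v)) :=
  .least hf (.exLe (hf.rename _) (.eq (hf.rename fun a => a.castSucc.castSucc)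
    (.pr (.coord _) (.coord _))))

end

section
variable {M : Structure.{u}} [IsVZero M]

theorem least_eq_of_unique_le {P : M.Num → Prop} {b y : M.Num}
    (hb : y ≤ b) (hP : ∀ z, P z ↔ z = y) : least M b P = y := by
  rcases hb.lt_or_eq with hb | rfl
  · exact least_eq_of_unique hb hP
  · rw [least, dif_neg]
    rintro ⟨x, hx, hx', -⟩
    exact hx.ne ((hP x).1 hx')

theorem fstPr_pr (x y : M.Num) : fstPr M (pr x y) = x := by
  refine least_eq_of_unique_le (le_pr_left x y) fun z => ?_
  constructor
  · rintro ⟨_, -, h⟩; exact (pr_inj.1 h).1.symm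
  · rintro rfl; exact ⟨y, le_pr_right _ _, rfl⟩

theorem sndPr_pr (x y : M.Num) : sndPr M (pr x y) = y := by
  refine least_eq_of_unique_le (le_pr_right x y) fun z => ?_
  constructor
  · rintro ⟨_, -, h⟩; exact (pr_inj.1 h).2.symm
  · rintro rfl; exact ⟨x, le_pr_left _ _, rfl⟩

theorem eq_seq_iff {X : M.Str} {i s : M.Num} : s = seq M X i ↔
    (s < M.len X ∧ pr i s ∈ X ∧ ∀ z < s, pr i z ∉ X) ∨
      ((∀ z < M.len X, pr i z ∉ X) ∧ s = M.len X) := by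
  have hd : ParamDef M 1 (fun v => pr i (v 0) ∈ X) := .auto
  rw [seq, Def.eq_least_iff (n := 0) (Q := fun _ _ y => pr i y ∈ X) hd () ![]]
  constructor
  · rintro ⟨h1, h2, h3⟩
    rcases h1.lt_or_eq with h | rfl
    · exact .inl ⟨h, h2 h, h3⟩
    · exact .inr ⟨h3, rfl⟩
  · rintro (⟨h1, h2, h3⟩ | ⟨h1, rfl⟩)
    · exact ⟨h1.le, fun _ => h2, h3⟩
    · exact ⟨le_rfl, fun h => absurd h (lt_irrefl _), h1⟩

theorem seq_eq_of_unique {X : M.Str} {i s : M.Num} (h : ∀ z, pr i z ∈ X ↔ z = s) :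
    seq M X i = s :=
  least_eq_of_unique ((le_pr_right i s).trans_lt (lt_len_of_mem ((h s).2 rfl))) h

end

/-! ### The meaning of the six formulas in models of `V⁰` -/

section
variable (M : Structure.{u}) [IsVZero M]

/-- The values `s`, `s'` of the wires before and after a comparator gate `⟨x, y⟩`. -/
def CompStep {α : Type*} [LT α] (m x y : α) (s s' : α → Prop) : Prop :=
  (s' x ↔ s x ∧ s y) ∧ (s' y ↔ s x ∨ s y) ∧ ∀ j < m, j ≠ x ∧ j ≠ y → (s' j ↔ s j)

/-- The values `s`, `s'` of the wires before and after a negation gate on `x`. -/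
def NegStep {α : Type*} [LT α] (m x : α) (s s' : α → Prop) : Prop :=
  (s' x ↔ ¬ s x) ∧ ∀ j < m, j ≠ x → (s' j ↔ s j)

/-- `δ_CCV` in a model. -/
def DeltaCCV (m n : M.Num) (X Y Z : M.Str) : Prop :=
  (∀ j < m, j ∈ Y ↔ pr 0 j ∈ Z) ∧
  ∀ i < n, ∀ x < m, ∀ y < m, pr x y = seq M X i →
    CompStep m x y (fun j => pr i j ∈ Z) (fun j => pr (i + 1) j ∈ Z)

/-- Every gate of the circuit `G` is a pair of wires. -/
def ValidCcv (m n : M.Num) (G : M.Str) : Prop :=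
  ∀ i < n, ∃ x < m, ∃ y < m, pr x y = seq M G i

/-- `δ_CCV` for circuits with negation gates, in a model. -/
def DeltaCcvNeg (m n : M.Num) (G I N Z : M.Str) : Prop :=
  (∀ j < m, j ∈ I ↔ pr 0 j ∈ Z) ∧
  (∀ i < n, ∀ x < m, ∀ y < m, i ∉ N ∧ pr x y = seq M G i →
    CompStep m x y (fun j => pr i j ∈ Z) (fun j => pr (i + 1) j ∈ Z)) ∧
  (∀ i < n, ∀ x < m, i ∈ N ∧ x = seq M G i →
    NegStep m x (fun j => pr i j ∈ Z) (fun j => pr (i + 1) j ∈ Z))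

/-- Every gate of the circuit `G`, `N` is a wire or a pair of wires. -/
def ValidCcvNeg (m n : M.Num) (G N : M.Str) : Prop :=
  ∀ i < n, ∃ x < m, (i ∈ N ∧ x = seq M G i) ∨ (i ∉ N ∧ ∃ y < m, pr x y = seq M G i)

/-- `δ_LFMM` in a model. -/
def DeltaLFMM (m n : M.Num) (E L : M.Str) : Prop :=
  ∀ i < m, ∀ j < n, (pr i j ∈ L ↔ pr i j ∈ E ∧ (∀ k < j, pr i k ∉ L) ∧ (∀ l < i, pr l j ∉ L) ∧
    ∀ k < j, pr i k ∉ E ∨ ∃ i' < i, pr i' k ∈ L)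

/-- No node has four distinct neighbours. -/
def DegreeThree (m n : M.Num) (E : M.Str) : Prop :=
  (∀ i < m, ¬ ∃ a < n, ∃ b < a, ∃ c < b, ∃ d < c,
    pr i a ∈ E ∧ pr i b ∈ E ∧ pr i c ∈ E ∧ pr i d ∈ E) ∧
  (∀ j < n, ¬ ∃ a < m, ∃ b < a, ∃ c < b, ∃ d < c,
    pr a j ∈ E ∧ pr b j ∈ E ∧ pr c j ∈ E ∧ pr d j ∈ E)

variable {M} {k l : ℕ} (v : Fin k → M.Num) (V : Fin l → M.Str)

theorem Formula.realize_memPair (X : Fin l) (t s : NTerm k l) :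
    (Formula.memPair X t s).Realize M v V ↔ pr (t.eval M v V) (s.eval M v V) ∈ V X := Iff.rfl

theorem Formula.realize_seqEntry (X : Fin l) (t s : NTerm k l) :
    (Formula.seqEntry X t s).Realize M v V ↔ s.eval M v V = seq M (V X) (t.eval M v V) := by
  rw [eq_seq_iff]
  simp only [Formula.seqEntry, Formula.Realize, Formula.realize_lt, Formula.realize_allLt,
    Formula.realize_memPair, NTerm.eval_liftN, NTerm.eval, Fin.snoc_last]

theorem Formula.realize_and (φ ψ : Formula k l) :
    (φ ⋏ ψ).Realize M v V ↔ φ.Realize M v V ∧ ψ.Realize M v V := Iff.rfl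

theorem Formula.realize_or (φ ψ : Formula k l) :
    (φ ⋎ ψ).Realize M v V ↔ φ.Realize M v V ∨ ψ.Realize M v V := Iff.rfl

theorem Formula.realize_neg (φ : Formula k l) :
    (∼φ).Realize M v V ↔ ¬ φ.Realize M v V := Iff.rfl

theorem Formula.realize_eq (t s : NTerm k l) :
    (Formula.eq t s).Realize M v V ↔ t.eval M v V = s.eval M v V := Iff.rfl

theorem realize_deltaCCV (v : Fin 2 → M.Num) (V : Fin 3 → M.Str) :
    deltaCCV.Realize M v V ↔ DeltaCCV M (v 0) (v 1) (V 0) (V 1) (V 2) := by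
  simp only [deltaCCV, Formula.realize_and, Formula.realize_allLt, Formula.realize_imp,
    Formula.realize_iff, Formula.realize_seqEntry, Formula.realize_memPair, Formula.realize_mem,
    Formula.realize_or, Formula.realize_neg, Formula.realize_eq]
  exact Iff.rfl

theorem realize_formulaCCV (v : Fin 2 → M.Num) (V : Fin 2 → M.Str) :
    formulaCCV.Realize M v V ↔ ∃ Z, M.len Z ≤ pr (v 0) (v 1 + 1) + 1 ∧
      DeltaCCV M (v 0) (v 1) (V 0) (V 1) Z := by
  simp only [formulaCCV, Formula.realize_exSLe, realize_deltaCCV]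
  exact Iff.rfl

theorem realize_formulaCcv (v : Fin 3 → M.Num) (V : Fin 2 → M.Str) :
    formulaCcv.Realize M v V ↔ v 2 < v 0 ∧ ValidCcv M (v 0) (v 1) (V 0) ∧
      ∃ Z, M.len Z ≤ pr (v 0) (v 1 + 1) + 1 ∧
        DeltaCCV M (v 0) (v 1) (V 0) (V 1) Z ∧ pr (v 1) (v 2) ∈ Z := by
  simp only [formulaCcv, Formula.realize_and, Formula.realize_exSLe, Formula.realize_rename,
    realize_deltaCCV, Formula.realize_allLt, Formula.realize_exLt, Formula.realize_lt,
    Formula.realize_seqEntry, Formula.realize_memPair]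
  exact Iff.rfl

theorem realize_formulaCcvNeg (v : Fin 3 → M.Num) (V : Fin 3 → M.Str) :
    formulaCcvNeg.Realize M v V ↔ v 2 < v 0 ∧ ValidCcvNeg M (v 0) (v 1) (V 0) (V 2) ∧
      ∃ Z, M.len Z ≤ pr (v 0) (v 1 + 1) + 1 ∧
        DeltaCcvNeg M (v 0) (v 1) (V 0) (V 1) (V 2) Z ∧ pr (v 1) (v 2) ∈ Z := by
  simp only [formulaCcvNeg, deltaCcvNeg, Formula.realize_and, Formula.realize_exSLe,
    Formula.realize_rename, Formula.realize_allLt, Formula.realize_exLt, Formula.realize_lt,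
    Formula.realize_seqEntry, Formula.realize_memPair,
    Formula.realize_imp, Formula.realize_mem,
    Formula.realize_iff, Formula.realize_or, Formula.realize_neg, Formula.realize_eq]
  exact Iff.rfl

theorem realize_deltaLFMM (v : Fin 2 → M.Num) (V : Fin 2 → M.Str) :
    deltaLFMM.Realize M v V ↔ DeltaLFMM M (v 0) (v 1) (V 0) (V 1) := by
  simp only [deltaLFMM, Formula.realize_and, Formula.realize_allLt, Formula.realize_exLt,
    Formula.realize_iff, Formula.realize_memPair, Formula.realize_or, Formula.realize_neg]
  exact Iff.rfl

theorem realize_formulaVLfmm (v : Fin 3 → M.Num) (V : Fin 1 → M.Str) :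
    formulaVLfmm.Realize M v V ↔ v 2 < v 1 ∧ ∃ L, M.len L ≤ pr (v 0) (v 1) + 1 ∧
      DeltaLFMM M (v 0) (v 1) (V 0) L ∧ ∃ i < v 0, pr i (v 2) ∈ L := by
  simp only [formulaVLfmm, Formula.realize_and, Formula.realize_exSLe, Formula.realize_rename,
    realize_deltaLFMM, Formula.realize_exLt, Formula.realize_lt, Formula.realize_memPair]
  exact Iff.rfl

theorem realize_formulaLfmm (v : Fin 4 → M.Num) (V : Fin 1 → M.Str) :
    formulaLfmm.Realize M v V ↔ v 2 < v 0 ∧ v 3 < v 1 ∧ ∃ L, M.len L ≤ pr (v 0) (v 1) + 1 ∧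
      DeltaLFMM M (v 0) (v 1) (V 0) L ∧ pr (v 2) (v 3) ∈ L := by
  simp only [formulaLfmm, Formula.realize_and, Formula.realize_exSLe, Formula.realize_rename,
    realize_deltaLFMM, Formula.realize_lt, Formula.realize_memPair]
  exact Iff.rfl

theorem realize_formulaDegree (v : Fin 2 → M.Num) (V : Fin 1 → M.Str) :
    formulaDegree.Realize M v V ↔ DegreeThree M (v 0) (v 1) (V 0) := by
  simp only [formulaDegree, Formula.realize_and, Formula.realize_allLt, Formula.realize_exLt,
    Formula.realize_neg, Formula.realize_memPair]
  exact Iff.rfl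

theorem realize_formulaThreeVLfmm (v : Fin 3 → M.Num) (V : Fin 1 → M.Str) :
    formulaThreeVLfmm.Realize M v V ↔
      DegreeThree M (v 0) (v 1) (V 0) ∧ formulaVLfmm.Realize M v V := by
  simp only [formulaThreeVLfmm, Formula.realize_and, Formula.realize_rename, realize_formulaDegree]
  exact Iff.rfl

theorem realize_formulaThreeLfmm (v : Fin 4 → M.Num) (V : Fin 1 → M.Str) :
    formulaThreeLfmm.Realize M v V ↔
      DegreeThree M (v 0) (v 1) (V 0) ∧ formulaLfmm.Realize M v V := by
  simp only [formulaThreeLfmm, Formula.realize_and, Formula.realize_rename, realize_formulaDegree]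
  exact Iff.rfl

end

/-! ### Layers of circuits -/

section
variable {M : Structure.{u}} [IsVZero M]

/-- The values after a comparator gate are determined by the values before it. -/
theorem CompStep.congr {m x y : M.Num} {s s' t t' : M.Num → Prop} (hx : x < m) (hy : y < m)
    (h : CompStep m x y s s') (h' : CompStep m x y t t') (hst : ∀ j < m, s j ↔ t j) :
    ∀ j < m, s' j ↔ t' j := by
  intro j hj
  by_cases hjx : j = x
  · rw [hjx, h.1, h'.1, hst x hx, hst y hy]
  · by_cases hjy : j = y
    · rw [hjy, h.2.1, h'.2.1, hst x hx, hst y hy]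
    · rw [h.2.2 j hj ⟨hjx, hjy⟩, h'.2.2 j hj ⟨hjx, hjy⟩, hst j hj]

/-- A comparator gate `⟨x, x⟩` does nothing. -/
theorem CompStep.self {m x : M.Num} {s s' : M.Num → Prop} (h : CompStep m x x s s') :
    ∀ j < m, s' j ↔ s j := by
  intro j hj
  by_cases hjx : j = x
  · rw [hjx, h.1, and_self_iff]
  · exact h.2.2 j hj ⟨hjx, hjx⟩

theorem NegStep.congr {m x : M.Num} {s s' t t' : M.Num → Prop} (hx : x < m)
    (h : NegStep m x s s') (h' : NegStep m x t t') (hst : ∀ j < m, s j ↔ t j) :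
    ∀ j < m, s' j ↔ t' j := by
  intro j hj
  by_cases hjx : j = x
  · rw [hjx, h.1, h'.1, hst x hx]
  · rw [h.2 j hj hjx, h'.2 j hj hjx, hst j hj]

theorem CompStep.transfer {m x y : M.Num} {s s' t t' : M.Num → Prop} (hx : x < m) (hy : y < m)
    (h : CompStep m x y s s') (hst : ∀ j < m, t j ↔ s j) (hst' : ∀ j < m, t' j ↔ s' j) :
    CompStep m x y t t' := by
  refine ⟨?_, ?_, fun j hj hne => ?_⟩
  · rw [hst' x hx, hst x hx, hst y hy]; exact h.1
  · rw [hst' y hy, hst x hx, hst y hy]; exact h.2.1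
  · rw [hst' j hj, hst j hj]; exact h.2.2 j hj hne

theorem NegStep.transfer {m x : M.Num} {s s' t t' : M.Num → Prop} (hx : x < m)
    (h : NegStep m x s s') (hst : ∀ j < m, t j ↔ s j) (hst' : ∀ j < m, t' j ↔ s' j) :
    NegStep m x t t' := by
  refine ⟨?_, fun j hj hne => ?_⟩
  · rw [hst' x hx, hst x hx]; exact h.1
  · rw [hst' j hj, hst j hj]; exact h.2 j hj hne

theorem DeltaCCV.transfer {m n : M.Num} {G I Z Z' : M.Str} (h : DeltaCCV M m n G I Z)
    (hZ : ∀ k ≤ n, ∀ j < m, (pr k j ∈ Z' ↔ pr k j ∈ Z)) : DeltaCCV M m n G I Z' :=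
  ⟨fun j hj => (h.1 j hj).trans (hZ 0 (num_zero_le _) j hj).symm, fun i hi x hx y hy e =>
    (h.2 i hi x hx y hy e).transfer hx hy (hZ i hi.le) (hZ _ (num_add_one_le_iff.2 hi))⟩

theorem DeltaCcvNeg.transfer {m n : M.Num} {G I N Z Z' : M.Str} (h : DeltaCcvNeg M m n G I N Z)
    (hZ : ∀ k ≤ n, ∀ j < m, (pr k j ∈ Z' ↔ pr k j ∈ Z)) : DeltaCcvNeg M m n G I N Z' :=
  ⟨fun j hj => (h.1 j hj).trans (hZ 0 (num_zero_le _) j hj).symm, fun i hi x hx y hy e =>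
    (h.2.1 i hi x hx y hy e).transfer hx hy (hZ i hi.le) (hZ _ (num_add_one_le_iff.2 hi)),
    fun i hi x hx e =>
    (h.2.2 i hi x hx e).transfer hx (hZ i hi.le) (hZ _ (num_add_one_le_iff.2 hi))⟩

/-- Layers which agree on the input, and with each layer also on the next one, agree throughout. -/
theorem layers_unique {m n : M.Num} {Z Z' : M.Str} (h0 : ∀ j < m, pr 0 j ∈ Z ↔ pr 0 j ∈ Z')
    (hs : ∀ k < n, (∀ j < m, pr k j ∈ Z ↔ pr k j ∈ Z') →
      ∀ j < m, pr (k + 1) j ∈ Z ↔ pr (k + 1) j ∈ Z') :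
    ∀ k ≤ n, ∀ j < m, pr k j ∈ Z ↔ pr k j ∈ Z' := by
  intro k
  refine num_induction (P := fun k => k ≤ n → ∀ j < m, (pr k j ∈ Z ↔ pr k j ∈ Z')) .auto
    (fun _ => h0) (fun k ih hk => ?_) k
  rw [num_add_one_le_iff] at hk
  exact hs k hk (ih hk.le)

theorem DeltaCCV.unique {m n : M.Num} {G I Z Z' : M.Str} (hv : ValidCcv M m n G)
    (h : DeltaCCV M m n G I Z) (h' : DeltaCCV M m n G I Z') :
    ∀ k ≤ n, ∀ j < m, pr k j ∈ Z ↔ pr k j ∈ Z' := by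
  refine layers_unique (fun j hj => (h.1 j hj).symm.trans (h'.1 j hj)) fun k hk ih => ?_
  obtain ⟨x, hx, y, hy, e⟩ := hv k hk
  exact (h.2 k hk x hx y hy e).congr hx hy (h'.2 k hk x hx y hy e) ih

theorem DeltaCcvNeg.unique {m n : M.Num} {G I N Z Z' : M.Str} (hv : ValidCcvNeg M m n G N)
    (h : DeltaCcvNeg M m n G I N Z) (h' : DeltaCcvNeg M m n G I N Z') :
    ∀ k ≤ n, ∀ j < m, pr k j ∈ Z ↔ pr k j ∈ Z' := by
  refine layers_unique (fun j hj => (h.1 j hj).symm.trans (h'.1 j hj)) fun k hk ih => ?_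
  obtain ⟨x, hx, e | ⟨hN, y, hy, e⟩⟩ := hv k hk
  · exact (h.2.2 k hk x hx e).congr hx (h'.2.2 k hk x hx e) ih
  · exact (h.2.1 k hk x hx y hy ⟨hN, e⟩).congr hx hy (h'.2.1 k hk x hx y hy ⟨hN, e⟩) ih

/-- A string of layers can be cut off at the bound that the formulas require. -/
theorem exists_truncation (m n : M.Num) (Z : M.Str) : ∃ Z', M.len Z' ≤ pr m (n + 1) + 1 ∧
    ∀ k ≤ n, ∀ j < m, (pr k j ∈ Z' ↔ pr k j ∈ Z) := by
  have hd : ParamDef M 1 (fun v => v 0 ∈ Z) := .auto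
  have hm := fun z => Def.mem_mkStr (Q := fun _ _ z => z ∈ Z) (n := 0) hd () ![]
    (b := pr m (n + 1) + 1) (z := z)
  refine ⟨mkStr M (pr m (n + 1) + 1) (fun z => z ∈ Z), ?_, fun k hk j hj => ?_⟩
  · exact len_le_iff.2 fun x hx => ((hm x).1 hx).1
  · refine (hm _).trans (and_iff_right ?_)
    rw [num_lt_add_one_iff]
    refine (pr_lt_of_add_lt ?_).le
    have := num_lt_add_one_iff.2 hk
    rw [add_comm m]
    exact add_lt_add this hj

/-- Layers are unique, so any string of layers decides the instance. -/
theorem realize_formulaCcv_iff {v : Fin 3 → M.Num} {V : Fin 2 → M.Str} {Z : M.Str}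
    (hZ : DeltaCCV M (v 0) (v 1) (V 0) (V 1) Z) :
    formulaCcv.Realize M v V ↔
      v 2 < v 0 ∧ ValidCcv M (v 0) (v 1) (V 0) ∧ pr (v 1) (v 2) ∈ Z := by
  rw [realize_formulaCcv]
  refine and_congr_right fun hw => and_congr_right fun hv => ⟨?_, fun h => ?_⟩
  · rintro ⟨Z', -, hZ', h⟩
    exact (hZ.unique hv hZ' _ le_rfl _ hw).2 h
  · obtain ⟨Z', hl, hZ'⟩ := exists_truncation (v 0) (v 1) Z
    exact ⟨Z', hl, hZ.transfer hZ', (hZ' _ le_rfl _ hw).2 h⟩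

/-- Layers are unique, so any string of layers decides the instance. -/
theorem realize_formulaCcvNeg_iff {v : Fin 3 → M.Num} {V : Fin 3 → M.Str} {Z : M.Str}
    (hZ : DeltaCcvNeg M (v 0) (v 1) (V 0) (V 1) (V 2) Z) :
    formulaCcvNeg.Realize M v V ↔
      v 2 < v 0 ∧ ValidCcvNeg M (v 0) (v 1) (V 0) (V 2) ∧ pr (v 1) (v 2) ∈ Z := by
  rw [realize_formulaCcvNeg]
  refine and_congr_right fun hw => and_congr_right fun hv => ⟨?_, fun h => ?_⟩
  · rintro ⟨Z', -, hZ', h⟩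
    exact (hZ.unique hv hZ' _ le_rfl _ hw).2 h
  · obtain ⟨Z', hl, hZ'⟩ := exists_truncation (v 0) (v 1) Z
    exact ⟨Z', hl, hZ.transfer hZ', (hZ' _ le_rfl _ hw).2 h⟩

/-! ### Lfm-matchings -/

/-- `L` is the lfm-matching of `E`.  The last clause of `δ_LFMM` is redundant. -/
def IsLfm (M : Structure.{u}) [IsVZero M] (m n : M.Num) (E L : M.Str) : Prop :=
  ∀ i < m, ∀ j < n, (pr i j ∈ L ↔ pr i j ∈ E ∧ (∀ k < j, pr i k ∉ L) ∧ ∀ l < i, pr l j ∉ L)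

theorem deltaLFMM_iff_isLfm {m n : M.Num} {E L : M.Str} :
    DeltaLFMM M m n E L ↔ IsLfm M m n E L := by
  constructor
  · intro h i hi j hj
    refine ⟨fun hL => ?_, fun ⟨hE, h1, h2⟩ => ?_⟩
    · obtain ⟨a, b, c, -⟩ := (h i hi j hj).1 hL
      exact ⟨a, b, c⟩
    · refine (h i hi j hj).2 ⟨hE, h1, h2, fun k => ?_⟩
      -- the least available neighbour below `j` would be matched to `i`
      refine num_strong_induction
        (P := fun k => k < j → (pr i k ∉ E ∨ ∃ i' < i, pr i' k ∈ L)) .auto ?_ k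
      intro k ih hk
      by_contra! hc
      exact h1 k hk ((h i hi k (hk.trans hj)).2 ⟨hc.1, fun k' hk' => h1 k' (hk'.trans hk), hc.2,
        fun k' hk' => ih k' hk' (hk'.trans hk)⟩)
  · intro h i hi j hj
    rw [h i hi j hj]
    refine ⟨fun ⟨hE, h1, h2⟩ => ⟨hE, h1, h2, fun k hk => ?_⟩, fun ⟨hE, h1, h2, _⟩ => ⟨hE, h1, h2⟩⟩
    by_contra! hc
    exact h1 k hk ((h i hi k (hk.trans hj)).2 ⟨hc.1, fun k' hk' => h1 k' (hk'.trans hk), hc.2⟩)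

/-- Lfm-matchings are unique, by an outer induction on bottom nodes and an inner one on top nodes. -/
theorem IsLfm.unique {m n : M.Num} {E L L' : M.Str} (h : IsLfm M m n E L)
    (h' : IsLfm M m n E L') : ∀ i < m, ∀ j < n, pr i j ∈ L ↔ pr i j ∈ L' := by
  intro i
  refine num_strong_induction
    (P := fun i => i < m → ∀ j < n, (pr i j ∈ L ↔ pr i j ∈ L')) .auto ?_ i
  intro i ih hi j
  refine num_strong_induction (P := fun j => j < n → (pr i j ∈ L ↔ pr i j ∈ L')) .auto ?_ j
  intro j ih' hj
  rw [h i hi j hj, h' i hi j hj]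
  refine and_congr_right fun _ => and_congr ?_ ?_
  · exact forall₂_congr fun k hk => not_congr (ih' k hk (hk.trans hj))
  · exact forall₂_congr fun l hl => not_congr (ih l hl (hl.trans hi) j hj)

/-- An lfm-matching restricts to an initial part of the graph: whether `(i, j)` is matched depends
only on edges `(i', j')` with `i' ≤ i` and `j' ≤ j`. -/
theorem IsLfm.congr {m n m' n' : M.Num} {E E' L : M.Str} (h : IsLfm M m n E L) (hm : m' ≤ m)
    (hn : n' ≤ n) (hE : ∀ i < m', ∀ j < n', pr i j ∈ E ↔ pr i j ∈ E') : IsLfm M m' n' E' L :=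
  fun i hi j hj => by rw [h i (hi.trans_le hm) j (hj.trans_le hn), hE i hi j hj]

/-- An lfm-matching can be cut off at the bound that the formulas require. -/
theorem IsLfm.exists_bounded {m n : M.Num} {E L : M.Str} (h : IsLfm M m n E L) :
    ∃ L', M.len L' ≤ pr m n + 1 ∧ IsLfm M m n E L' ∧
      ∀ i < m, ∀ j < n, (pr i j ∈ L' ↔ pr i j ∈ L) := by
  have hd : ParamDef M 1 (fun v => v 0 ∈ L) := .auto
  have hm := fun z => Def.mem_mkStr (Q := fun _ _ z => z ∈ L) (n := 0) hd () ![]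
    (b := pr m n + 1) (z := z)
  have hL : ∀ i < m, ∀ j < n, (pr i j ∈ mkStr M (pr m n + 1) (fun z => z ∈ L) ↔ pr i j ∈ L) :=
    fun i hi j hj => (hm _).trans (and_iff_right (num_lt_add_one_iff.2 (pr_le_pr hi.le hj.le)))
  refine ⟨_, len_le_iff.2 fun x hx => ((hm x).1 hx).1, fun i hi j hj => ?_, hL⟩
  rw [hL i hi j hj, h i hi j hj]
  refine and_congr_right fun _ => and_congr ?_ ?_
  · exact forall₂_congr fun k hk => not_congr (hL i hi k (hk.trans hj)).symm
  · exact forall₂_congr fun l hl => not_congr (hL l (hl.trans hi) j hj).symm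

/-- Lfm-matchings are unique, so any of them decides the instance. -/
theorem realize_formulaVLfmm_iff {v : Fin 3 → M.Num} {V : Fin 1 → M.Str} {L : M.Str}
    (hL : IsLfm M (v 0) (v 1) (V 0) L) :
    formulaVLfmm.Realize M v V ↔ v 2 < v 1 ∧ ∃ i < v 0, pr i (v 2) ∈ L := by
  rw [realize_formulaVLfmm]
  refine and_congr_right fun hj => ⟨?_, ?_⟩
  · rintro ⟨L', -, hL', i, hi, h⟩
    exact ⟨i, hi, (hL.unique (deltaLFMM_iff_isLfm.1 hL') i hi _ hj).2 h⟩
  · rintro ⟨i, hi, h⟩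
    obtain ⟨L', hl, hL', e⟩ := hL.exists_bounded
    exact ⟨L', hl, deltaLFMM_iff_isLfm.2 hL', i, hi, (e i hi _ hj).2 h⟩

/-- Lfm-matchings are unique, so any of them decides the instance. -/
theorem realize_formulaLfmm_iff {v : Fin 4 → M.Num} {V : Fin 1 → M.Str} {L : M.Str}
    (hL : IsLfm M (v 0) (v 1) (V 0) L) :
    formulaLfmm.Realize M v V ↔ v 2 < v 0 ∧ v 3 < v 1 ∧ pr (v 2) (v 3) ∈ L := by
  rw [realize_formulaLfmm]
  refine and_congr_right fun hi => and_congr_right fun hj => ⟨?_, ?_⟩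
  · rintro ⟨L', -, hL', h⟩
    exact (hL.unique (deltaLFMM_iff_isLfm.1 hL') _ hi _ hj).2 h
  · intro h
    obtain ⟨L', hl, hL', e⟩ := hL.exists_bounded
    exact ⟨L', hl, deltaLFMM_iff_isLfm.2 hL', (e _ hi _ hj).2 h⟩

end

/-! ### Models of `VCC*` -/

/-- The structure `M` is a model of `VCC*`.  The bound on the length of `Z` in the axiom is omitted,
as any `Z` can be cut off at that bound. -/
class IsVCC (M : Structure.{u}) : Prop extends IsVZero M where
  exists_layers : ∀ (m n : M.Num) (X Y : M.Str), ∃ Z, DeltaCCV M m n X Y Z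

theorem isVCC_iff {M : Structure.{u}} : IsVCC M ↔ ∀ p ∈ VCCStar, M.Satisfies p.2.2 := by
  constructor
  · rintro h p (hp | rfl)
    · exact IsVZero.sat p hp
    · intro v V
      refine (realize_formulaCCV v V).2 ?_
      obtain ⟨Z, hZ⟩ := IsVCC.exists_layers (v 0) (v 1) (V 0) (V 1)
      obtain ⟨Z', hl, hZ'⟩ := exists_truncation (v 0) (v 1) Z
      exact ⟨Z', hl, hZ.transfer hZ'⟩
  · intro h
    have : IsVZero M := ⟨fun p hp => h p (Or.inl hp)⟩
    refine ⟨fun m n X Y => ?_⟩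
    obtain ⟨Z, -, hZ⟩ := (realize_formulaCCV ![m, n] ![X, Y]).1
      (h ⟨2, 2, formulaCCV⟩ (Or.inr rfl) ![m, n] ![X, Y])
    exact ⟨Z, hZ⟩

/-- A definable function can be coded as a sequence. -/
theorem seq_relStr {M : Structure.{u}} [IsVZero M] {m n k : M.Num} {g : M.Num → M.Num}
    (hg : DefN (fun _ : Unit => M) Set.univ Set.univ 1 (fun _ v => g (v 0)))
    (hk : k < n) (hgk : g k < m) : seq M (relStr M n m (fun k y => y = g k)) k = g k := by
  refine seq_eq_of_unique fun z => ?_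
  have h2 : Def (fun _ : Unit => M) Set.univ Set.univ 2 (fun _ v => v 1 = g (v 0)) :=
    .eq (.coord 1) (hg.rename (fun _ => 0))
  refine (Def.mem_relStr (n := 0) (R := fun _ _ k y => y = g k) (b := fun _ _ => n)
    (c := fun _ _ => m) (.param n) (.param m) h2 () ![]).trans ?_
  constructor
  · rintro ⟨-, -, h⟩; exact h
  · rintro rfl; exact ⟨hk, hgk, rfl⟩

/-- Every definable comparator circuit has layers. -/
theorem IsVCC.exists_layers_of_def {M : Structure.{u}} [IsVCC M] (m n : M.Num)
    {g : M.Num → M.Num} {P : M.Num → Prop}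
    (hg : DefN (fun _ : Unit => M) Set.univ Set.univ 1 (fun _ v => g (v 0)))
    (hP : ParamDef M 1 (fun v => P (v 0))) :
    ∃ Z : M.Str, (∀ j < m, pr 0 j ∈ Z ↔ P j) ∧ ∀ k < n, ∀ x < m, ∀ y < m, g k = pr x y →
      CompStep m x y (fun j => pr k j ∈ Z) (fun j => pr (k + 1) j ∈ Z) := by
  obtain ⟨Z, hZ0, hZ⟩ := IsVCC.exists_layers m n (relStr M n (pr m m) (fun k y => y = g k))
    (mkStr M m P)
  refine ⟨Z, fun j hj => ?_, fun k hk x hx y hy e => hZ k hk x hx y hy ?_⟩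
  · rw [← hZ0 j hj]
    exact (Def.mem_mkStr (Q := fun _ _ z => P z) (n := 0) hP () ![]).trans (and_iff_right hj)
  · rw [seq_relStr hg hk (e ▸ pr_lt_pr hx hy.le), e]

/-! ### Simulating negation gates by comparator gates -/

section
variable {M : Structure.{u}} [IsVZero M]

theorem add_self_inj {x y : M.Num} : x + x = y + y ↔ x = y := by
  refine ⟨fun h => ?_, fun h => by rw [h]⟩
  rcases lt_trichotomy x y with h' | h' | h'
  · exact absurd h (add_lt_add h' h').ne
  · exact h'
  · exact absurd h (add_lt_add h' h').ne'

theorem add_self_ne_add_self_add_one (x y : M.Num) : x + x ≠ y + y + 1 := by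
  intro h
  rcases lt_or_ge y x with h' | h'
  · have := num_add_one_le_iff.2 h'
    have h0 : (0 : M.Num) < 1 := zero_lt_one
    grind
  · have h0 : (0 : M.Num) < 1 := zero_lt_one
    grind

theorem add_self_add_one_lt {x y : M.Num} (h : x < y) : x + x + 1 < y + y := by
  have := num_add_one_le_iff.2 h
  have h0 : (0 : M.Num) < 1 := zero_lt_one
  grind

/-- The values `s` of `2m + 1` wires that represent the values of `m` wires: the wires `2j + 1`
carry the negations of the wires `2j`, and the wire `2m` carries zero. -/
def DualRail (m : M.Num) (s : M.Num → Prop) : Prop :=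
  (∀ j < m, s (j + j + 1) ↔ ¬ s (j + j)) ∧ ¬ s (m + m)

/-- A comparator gate `⟨x, y⟩` is simulated by `⟨2x, 2y⟩` on the wires, its dual `⟨2y + 1, 2x + 1⟩`
on their negations, and an idle gate, which makes the number of gates three as for negations. -/
theorem comparator_simulation {m x y : M.Num} {s₀ s₁ s₂ s₃ : M.Num → Prop} (hx : x < m)
    (hy : y < m) (h₀ : DualRail m s₀) (h₁ : CompStep (m + m + 1) (x + x) (y + y) s₀ s₁)
    (h₂ : CompStep (m + m + 1) (y + y + 1) (x + x + 1) s₁ s₂)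
    (h₃ : CompStep (m + m + 1) 0 0 s₂ s₃) :
    CompStep m x y (fun j => s₀ (j + j)) (fun j => s₃ (j + j)) ∧ DualRail m s₃ := by
  have even_lt : ∀ j < m, j + j < m + m + 1 := fun j hj =>
    num_lt_add_one_iff.2 (add_lt_add hj hj).le
  have odd_lt : ∀ j < m, j + j + 1 < m + m + 1 := fun j hj =>
    num_lt_add_one_iff.2 (add_self_add_one_lt hj).le
  have ev : ∀ j < m, (s₃ (j + j) ↔ s₁ (j + j)) := fun j hj => by
    rw [h₃.self _ (even_lt j hj), h₂.2.2 _ (even_lt j hj)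
      ⟨add_self_ne_add_self_add_one _ _, add_self_ne_add_self_add_one _ _⟩]
  have od : ∀ j < m, (s₁ (j + j + 1) ↔ s₀ (j + j + 1)) := fun j hj =>
    h₁.2.2 _ (odd_lt j hj)
      ⟨(add_self_ne_add_self_add_one _ _).symm, (add_self_ne_add_self_add_one _ _).symm⟩
  have od3 : ∀ j < m, (s₃ (j + j + 1) ↔ s₂ (j + j + 1)) := fun j hj => h₃.self _ (odd_lt j hj)
  have ev0 : ∀ j < m, j ≠ x ∧ j ≠ y → (s₁ (j + j) ↔ s₀ (j + j)) := fun j hj hne =>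
    h₁.2.2 _ (even_lt j hj) ⟨by rw [Ne, add_self_inj]; exact hne.1,
      by rw [Ne, add_self_inj]; exact hne.2⟩
  have step : CompStep m x y (fun j => s₀ (j + j)) (fun j => s₃ (j + j)) :=
    ⟨by simpa only [ev x hx] using h₁.1, by simpa only [ev y hy] using h₁.2.1,
      fun j hj hne => by simpa only [ev j hj] using ev0 j hj hne⟩
  refine ⟨step, fun j hj => ?_, ?_⟩
  · rw [od3 j hj, ev j hj]
    by_cases hjy : j = y
    · rw [hjy, h₂.1, od y hy, od x hx, h₁.2.1, h₀.1 x hx, h₀.1 y hy]; tauto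
    · by_cases hjx : j = x
      · rw [hjx, h₂.2.1, od y hy, od x hx, h₁.1, h₀.1 x hx, h₀.1 y hy]; tauto
      · rw [ev0 j hj ⟨hjx, hjy⟩, h₂.2.2 _ (odd_lt j hj), od j hj, h₀.1 j hj]
        rw [Ne, Ne, add_right_cancel_iff, add_right_cancel_iff, add_self_inj, add_self_inj]
        exact ⟨hjy, hjx⟩
  · have lt : m + m < m + m + 1 := num_lt_add_one_iff.2 le_rfl
    rw [h₃.self _ lt, h₂.2.2 _ lt
      ⟨add_self_ne_add_self_add_one _ _, add_self_ne_add_self_add_one _ _⟩, h₁.2.2 _ lt]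
    · exact h₀.2
    · rw [Ne, Ne, add_self_inj, add_self_inj]; exact ⟨hx.ne', hy.ne'⟩

/-- Three comparator gates that exchange the values of `2x` and `2x + 1` by way of the wire `2m`,
which carries zero before and after. -/
theorem negation_simulation {m x : M.Num} {s₀ s₁ s₂ s₃ : M.Num → Prop} (hx : x < m)
    (h₀ : DualRail m s₀) (h₁ : CompStep (m + m + 1) (x + x) (m + m) s₀ s₁)
    (h₂ : CompStep (m + m + 1) (x + x + 1) (x + x) s₁ s₂)
    (h₃ : CompStep (m + m + 1) (m + m) (x + x + 1) s₂ s₃) :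
    NegStep m x (fun j => s₀ (j + j)) (fun j => s₃ (j + j)) ∧ DualRail m s₃ := by
  have even_lt : ∀ j < m, j + j < m + m + 1 := fun j hj =>
    num_lt_add_one_iff.2 (add_lt_add hj hj).le
  have odd_lt : ∀ j < m, j + j + 1 < m + m + 1 := fun j hj =>
    num_lt_add_one_iff.2 (add_self_add_one_lt hj).le
  have lt : m + m < m + m + 1 := num_lt_add_one_iff.2 le_rfl
  have eo : ∀ a b : M.Num, a + a ≠ b + b + 1 := add_self_ne_add_self_add_one
  have ee : ∀ a b : M.Num, a ≠ b → a + a ≠ b + b := fun a b h => by rwa [Ne, add_self_inj]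
  have a3 : s₃ (x + x) ↔ s₂ (x + x) := h₃.2.2 _ (even_lt x hx) ⟨ee _ _ hx.ne, eo _ _⟩
  have b1 : s₁ (x + x + 1) ↔ s₀ (x + x + 1) :=
    h₁.2.2 _ (odd_lt x hx) ⟨(eo _ _).symm, (eo _ _).symm⟩
  have t2 : s₂ (m + m) ↔ s₁ (m + m) := h₂.2.2 _ lt ⟨eo _ _, ee _ _ hx.ne'⟩
  have hev : ∀ j < m, j ≠ x → (s₃ (j + j) ↔ s₀ (j + j)) := fun j hj hne => by
    rw [h₃.2.2 _ (even_lt j hj) ⟨ee _ _ hj.ne, eo _ _⟩,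
      h₂.2.2 _ (even_lt j hj) ⟨eo _ _, ee _ _ hne⟩,
      h₁.2.2 _ (even_lt j hj) ⟨ee _ _ hne, ee _ _ hj.ne⟩]
  have hod : ∀ j < m, j ≠ x → (s₃ (j + j + 1) ↔ s₀ (j + j + 1)) := fun j hj hne => by
    have h : j + j + 1 ≠ x + x + 1 := by rw [Ne, add_right_cancel_iff]; exact ee _ _ hne
    rw [h₃.2.2 _ (odd_lt j hj) ⟨(eo _ _).symm, h⟩, h₂.2.2 _ (odd_lt j hj) ⟨h, (eo _ _).symm⟩,
      h₁.2.2 _ (odd_lt j hj) ⟨(eo _ _).symm, (eo _ _).symm⟩]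
  have e1 := h₁.1
  have e2 := h₁.2.1
  have e3 := h₂.1
  have e4 := h₂.2.1
  have e5 := h₃.1
  have e6 := h₃.2.1
  have d := h₀.1 x hx
  have d' := h₀.2
  refine ⟨⟨?_, fun j hj hne => hev j hj hne⟩, fun j hj => ?_, ?_⟩
  · change s₃ (x + x) ↔ ¬ s₀ (x + x)
    rw [a3, e4, b1, e1, d]
    simp [d']
  · by_cases hjx : j = x
    · rw [hjx, e6, a3, t2, e2, e3, e4, b1, e1, d]
      simp [d']
    · rw [hev j hj hjx, hod j hj hjx, h₀.1 j hj]
  · rw [e5, e3, e1]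
    simp [d']

end

open Classical in
/-- The wire `x` of gate number `i`: a negation gate on `x`, or a comparator gate `⟨x, y⟩`. -/
noncomputable def gateX (M : Structure.{u}) [IsVZero M] (G N : M.Str) (i : M.Num) : M.Num :=
  if i ∈ N then seq M G i else fstPr M (seq M G i)

open Classical in
/-- The first of the three gates that simulate gate number `i`. -/
noncomputable def simGate₀ (M : Structure.{u}) [IsVZero M] (m : M.Num) (G N : M.Str) (i : M.Num) :
    M.Num :=
  if i ∈ N then pr (gateX M G N i + gateX M G N i) (m + m)
  else pr (gateX M G N i + gateX M G N i) (sndPr M (seq M G i) + sndPr M (seq M G i))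

open Classical in
/-- The second of the three gates that simulate gate number `i`. -/
noncomputable def simGate₁ (M : Structure.{u}) [IsVZero M] (G N : M.Str) (i : M.Num) :
    M.Num :=
  if i ∈ N then pr (gateX M G N i + gateX M G N i + 1) (gateX M G N i + gateX M G N i)
  else pr (sndPr M (seq M G i) + sndPr M (seq M G i) + 1) (gateX M G N i + gateX M G N i + 1)

open Classical in
/-- The third of the three gates that simulate gate number `i`. -/
noncomputable def simGate₂ (M : Structure.{u}) [IsVZero M] (m : M.Num) (G N : M.Str) (i : M.Num) :
    M.Num :=
  if i ∈ N then pr (m + m) (gateX M G N i + gateX M G N i + 1) else pr 0 0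

/-- The comparator circuit that simulates the circuit `G`, `N` with negation gates. -/
noncomputable def simCircuit (M : Structure.{u}) [IsVZero M] (m n : M.Num) (G N : M.Str) : M.Str :=
  relStr M (n + n + n) (pr (m + m + 1) (m + m + 1)) (fun k y => ∃ i, i < n ∧
    ((k = i + i + i ∧ y = simGate₀ M m G N i) ∨ (k = i + i + i + 1 ∧ y = simGate₁ M G N i) ∨
      (k = i + i + i + 1 + 1 ∧ y = simGate₂ M m G N i)))

/-- The input of the simulating circuit: the input, its negation, and a zero. -/
noncomputable def simInput (M : Structure.{u}) [IsVZero M] (m : M.Num) (I : M.Str) : M.Str :=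
  mkStr M (m + m + 1) (fun z => ∃ j, j < m ∧ ((z = j + j ∧ j ∈ I) ∨ (z = j + j + 1 ∧ j ∉ I)))

section
variable {ι : Type w} {S : ι → Structure.{u}} [∀ i, IsVZero (S i)] {nums : Set (∀ i, (S i).Num)}
  {strs : Set (∀ i, (S i).Str)} {n : ℕ} {G N I : ∀ i, (Fin n → (S i).Num) → (S i).Str}
  {f m l : ∀ i, (Fin n → (S i).Num) → (S i).Num}

theorem DefN.gateX (hG : DefS S nums strs n G) (hN : DefS S nums strs n N)
    (hf : DefN S nums strs n f) :
    DefN S nums strs n (fun i v => gateX (S i) (G i v) (N i v) (f i v)) :=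
  .ite (.mem hf hN) (.seq hG hf) (.fstPr (.seq hG hf))

theorem DefN.simGate₀ (hm : DefN S nums strs n m) (hG : DefS S nums strs n G)
    (hN : DefS S nums strs n N) (hf : DefN S nums strs n f) :
    DefN S nums strs n (fun i v => simGate₀ (S i) (m i v) (G i v) (N i v) (f i v)) :=
  .ite (.mem hf hN) (.pr (.add (.gateX hG hN hf) (.gateX hG hN hf)) (.add hm hm))
    (.pr (.add (.gateX hG hN hf) (.gateX hG hN hf))
      (.add (.sndPr (.seq hG hf)) (.sndPr (.seq hG hf))))

theorem DefN.simGate₁ (hG : DefS S nums strs n G)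
    (hN : DefS S nums strs n N) (hf : DefN S nums strs n f) :
    DefN S nums strs n (fun i v => simGate₁ (S i) (G i v) (N i v) (f i v)) :=
  .ite (.mem hf hN) (.pr (.add (.add (.gateX hG hN hf) (.gateX hG hN hf)) .one)
      (.add (.gateX hG hN hf) (.gateX hG hN hf)))
    (.pr (.add (.add (.sndPr (.seq hG hf)) (.sndPr (.seq hG hf))) .one)
      (.add (.add (.gateX hG hN hf) (.gateX hG hN hf)) .one))

theorem DefN.simGate₂ (hm : DefN S nums strs n m) (hG : DefS S nums strs n G)
    (hN : DefS S nums strs n N) (hf : DefN S nums strs n f) :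
    DefN S nums strs n (fun i v => simGate₂ (S i) (m i v) (G i v) (N i v) (f i v)) :=
  .ite (.mem hf hN) (.pr (.add hm hm) (.add (.add (.gateX hG hN hf) (.gateX hG hN hf)) .one))
    (.pr .zero .zero)

theorem Def.simCircuit_aux (hm : DefN S nums strs n m) (hl : DefN S nums strs n l)
    (hG : DefS S nums strs n G) (hN : DefS S nums strs n N) :
    Def S nums strs (n + 1 + 1) (fun i w =>
      (fun i v k y => ∃ x, x < l i v ∧
        ((k = x + x + x ∧ y = TwoSorted.simGate₀ (S i) (m i v) (G i v) (N i v) x) ∨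
          (k = x + x + x + 1 ∧ y = TwoSorted.simGate₁ (S i) (G i v) (N i v) x) ∨
          (k = x + x + x + 1 + 1 ∧ y = TwoSorted.simGate₂ (S i) (m i v) (G i v) (N i v) x)))
        i (fun a => w a.castSucc.castSucc) (w (Fin.last n).castSucc) (w (Fin.last (n + 1)))) := by
  have c : ∀ a : Fin (n + 3), DefN S nums strs (n + 3) (fun _ v => v a) := fun a => .coord a
  have hm' := hm.rename fun a => a.castSucc.castSucc.castSucc
  have hG' := hG.rename fun a => a.castSucc.castSucc.castSucc
  have hN' := hN.rename fun a => a.castSucc.castSucc.castSucc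
  exact .exLt (hl.rename fun a => a.castSucc.castSucc)
    (.or (.and (.eq (c _) (.add (.add (c _) (c _)) (c _)))
      (.eq (c _) (.simGate₀ hm' hG' hN' (c _))))
    (.or (.and (.eq (c _) (.add (.add (.add (c _) (c _)) (c _)) .one))
      (.eq (c _) (.simGate₁ hG' hN' (c _))))
      (.and (.eq (c _) (.add (.add (.add (.add (c _) (c _)) (c _)) .one) .one))
      (.eq (c _) (.simGate₂ hm' hG' hN' (c _))))))

theorem DefS.simCircuit (hm : DefN S nums strs n m) (hl : DefN S nums strs n l)
    (hG : DefS S nums strs n G) (hN : DefS S nums strs n N) :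
    DefS S nums strs n (fun i v => simCircuit (S i) (m i v) (l i v) (G i v) (N i v)) :=
  .relStr (.add (.add hl hl) hl) (.pr (.add (.add hm hm) .one) (.add (.add hm hm) .one))
    (Def.simCircuit_aux hm hl hG hN)

theorem Def.simInput_aux (hm : DefN S nums strs n m) (hI : DefS S nums strs n I) :
    Def S nums strs (n + 1) (fun i w =>
      (fun i v z => ∃ j, j < m i v ∧ ((z = j + j ∧ j ∈ I i v) ∨ (z = j + j + 1 ∧ j ∉ I i v)))
        i (fun a => w a.castSucc) (w (Fin.last n))) := by
  have c : ∀ a : Fin (n + 2), DefN S nums strs (n + 2) (fun _ v => v a) := fun a => .coord a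
  have hI' := hI.rename fun a => a.castSucc.castSucc
  exact .exLt (hm.rename _) (.or (.and (.eq (c _) (.add (c _) (c _))) (.mem (c _) hI'))
    (.and (.eq (c _) (.add (.add (c _) (c _)) .one)) (.not (.mem (c _) hI'))))

theorem DefS.simInput (hm : DefN S nums strs n m) (hI : DefS S nums strs n I) :
    DefS S nums strs n (fun i v => simInput (S i) (m i v) (I i v)) :=
  .mkStr (.add (.add hm hm) .one) (Def.simInput_aux hm hI)

end

section
variable {M : Structure.{u}} [IsVZero M]

theorem triple_inj {i i' r r' : M.Num} (hr : r < 1 + 1 + 1) (hr' : r' < 1 + 1 + 1) :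
    i + i + i + r = i' + i' + i' + r' ↔ i = i' ∧ r = r' := by
  have e : ∀ i : M.Num, i + i + i = i * (1 + 1 + 1) := fun i => by ring
  rw [e i, e i', row_inj hr hr']

/-- Gate number `k < 3n` of the simulating circuit belongs to the simulation of one gate `i < n`. -/
theorem exists_triple {k n : M.Num} (h : k < n + n + n) : ∃ i < n, k = i + i + i ∨
    k = i + i + i + 1 ∨ k = i + i + i + 1 + 1 := by
  have key : ∃ i ≤ k, k = i + i + i ∨ k = i + i + i + 1 ∨ k = i + i + i + 1 + 1 := by
    refine num_induction (P := fun k => ∃ i ≤ k, k = i + i + i ∨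
      k = i + i + i + 1 ∨ k = i + i + i + 1 + 1) .auto ⟨0, le_rfl, by simp⟩ ?_ k
    rintro k ⟨i, hi, rfl | rfl | rfl⟩
    · exact ⟨i, hi.trans (num_lt_add_one_iff.2 le_rfl).le, by simp⟩
    · exact ⟨i, hi.trans (num_lt_add_one_iff.2 le_rfl).le, by simp⟩
    · exact ⟨i + 1, add_le_add hi le_rfl, Or.inl (by ring)⟩
  obtain ⟨i, -, hk⟩ := key
  refine ⟨i, ?_, hk⟩
  by_contra! hni
  have h0 : (0 : M.Num) < 1 := zero_lt_one
  rcases hk with rfl | rfl | rfl <;> grind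

theorem mem_simCircuit {m n : M.Num} {G N : M.Str} {k y : M.Num} :
    pr k y ∈ simCircuit M m n G N ↔ k < n + n + n ∧ y < pr (m + m + 1) (m + m + 1) ∧
      ∃ i, i < n ∧ ((k = i + i + i ∧ y = simGate₀ M m G N i) ∨
        (k = i + i + i + 1 ∧ y = simGate₁ M G N i) ∨
        (k = i + i + i + 1 + 1 ∧ y = simGate₂ M m G N i)) :=
  Def.mem_relStr (n := 0) (S := fun _ : Unit => M) (nums := Set.univ) (strs := Set.univ)
    (b := fun _ _ => n + n + n) (c := fun _ _ => pr (m + m + 1) (m + m + 1))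
    (R := fun _ _ k y => ∃ i, i < n ∧ ((k = i + i + i ∧ y = simGate₀ M m G N i) ∨
        (k = i + i + i + 1 ∧ y = simGate₁ M G N i) ∨
        (k = i + i + i + 1 + 1 ∧ y = simGate₂ M m G N i)))
    (.add (.add (.param n) (.param n)) (.param n))
    (.pr (.add (.add (.param m) (.param m)) .one) (.add (.add (.param m) (.param m)) .one))
    (Def.simCircuit_aux (m := fun _ _ => m) (l := fun _ _ => n) (G := fun _ _ => G)
      (N := fun _ _ => N) (.param m) (.param n) (.param G) (.param N)) () ![]

/-- Gates `3i`, `3i + 1` and `3i + 2` of the simulating circuit simulate gate `i`.  The bounds hold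
if gate `i` is valid. -/
theorem seq_simCircuit {m n : M.Num} {G N : M.Str} {i : M.Num} (hi : i < n)
    (h0 : simGate₀ M m G N i < pr (m + m + 1) (m + m + 1))
    (h1 : simGate₁ M G N i < pr (m + m + 1) (m + m + 1))
    (h2 : simGate₂ M m G N i < pr (m + m + 1) (m + m + 1)) :
    seq M (simCircuit M m n G N) (i + i + i) = simGate₀ M m G N i ∧
    seq M (simCircuit M m n G N) (i + i + i + 1) = simGate₁ M G N i ∧
    seq M (simCircuit M m n G N) (i + i + i + 1 + 1) = simGate₂ M m G N i := by
  have p1 : (0 : M.Num) < 1 := zero_lt_one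
  have t0 : (0 : M.Num) < 1 + 1 + 1 := by grind
  have t1 : (1 : M.Num) < 1 + 1 + 1 := by grind
  have t2 : (1 + 1 : M.Num) < 1 + 1 + 1 := by grind
  have n01 : (0 : M.Num) ≠ 1 := p1.ne
  have n02 : (0 : M.Num) ≠ 1 + 1 := by grind
  have n12 : (1 : M.Num) ≠ 1 + 1 := by grind
  have hi' := num_add_one_le_iff.2 hi
  have l2 : i + i + i + 1 + 1 < n + n + n := by grind
  have l1 : i + i + i + 1 < n + n + n := by grind
  have l0 : i + i + i < n + n + n := by grind
  have e00 : ∀ a b : M.Num, a + a + a = b + b + b ↔ a = b := fun a b => by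
    simpa using triple_inj (i := a) (i' := b) t0 t0
  have e01 : ∀ a b : M.Num, a + a + a ≠ b + b + b + 1 := fun a b h =>
    n01 ((triple_inj (i := a) (i' := b) t0 t1).1 (by simpa using h)).2
  have e02 : ∀ a b : M.Num, a + a + a ≠ b + b + b + 1 + 1 := fun a b h =>
    n02 ((triple_inj (i := a) (i' := b) t0 t2).1 (by rw [add_zero, h, add_assoc _ 1 1])).2
  refine ⟨seq_eq_of_unique fun z => ?_, seq_eq_of_unique fun z => ?_,
    seq_eq_of_unique fun z => ?_⟩
  · rw [mem_simCircuit]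
    constructor
    · rintro ⟨-, -, a, -, ⟨ha, rfl⟩ | ⟨ha, -⟩ | ⟨ha, -⟩⟩
      · rw [(e00 _ _).1 ha]
      · exact absurd ha (e01 _ _)
      · exact absurd ha (e02 _ _)
    · rintro rfl
      exact ⟨l0, h0, i, hi, Or.inl ⟨rfl, rfl⟩⟩
  · rw [mem_simCircuit]
    constructor
    · rintro ⟨-, -, a, -, ⟨ha, -⟩ | ⟨ha, rfl⟩ | ⟨ha, -⟩⟩
      · exact absurd ha.symm (e01 _ _)
      · rw [add_right_cancel_iff, e00] at ha; rw [ha]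
      · rw [add_right_cancel_iff] at ha; exact absurd ha (e01 _ _)
    · rintro rfl
      exact ⟨l1, h1, i, hi, Or.inr (Or.inl ⟨rfl, rfl⟩)⟩
  · rw [mem_simCircuit]
    constructor
    · rintro ⟨-, -, a, -, ⟨ha, -⟩ | ⟨ha, -⟩ | ⟨ha, rfl⟩⟩
      · exact absurd ha.symm (e02 _ _)
      · rw [add_right_cancel_iff] at ha; exact absurd ha.symm (e01 _ _)
      · rw [add_right_cancel_iff, add_right_cancel_iff, e00] at ha; rw [ha]
    · rintro rfl
      exact ⟨l2, h2, i, hi, Or.inr (Or.inr ⟨rfl, rfl⟩)⟩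

theorem simCircuit_negation {m n : M.Num} {G N : M.Str} {i x : M.Num} (hi : i < n)
    (hN : i ∈ N) (hx : x < m) (e : x = seq M G i) :
    seq M (simCircuit M m n G N) (i + i + i) = pr (x + x) (m + m) ∧
    seq M (simCircuit M m n G N) (i + i + i + 1) = pr (x + x + 1) (x + x) ∧
    seq M (simCircuit M m n G N) (i + i + i + 1 + 1) = pr (m + m) (x + x + 1) := by
  have e0 : simGate₀ M m G N i = pr (x + x) (m + m) := by simp [simGate₀, gateX, hN, e]
  have e1 : simGate₁ M G N i = pr (x + x + 1) (x + x) := by simp [simGate₁, gateX, hN, e]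
  have e2 : simGate₂ M m G N i = pr (m + m) (x + x + 1) := by simp [simGate₂, gateX, hN, e]
  have lt : m + m < m + m + 1 := num_lt_add_one_iff.2 le_rfl
  have ltx : x + x < m + m + 1 := (add_lt_add hx hx).trans lt
  have ltx1 : x + x + 1 < m + m + 1 := (add_self_add_one_lt hx).trans lt
  rw [← e0, ← e1, ← e2]
  refine seq_simCircuit hi ?_ ?_ ?_
  · rw [e0]; exact pr_lt_pr ltx lt.le
  · rw [e1]; exact pr_lt_pr ltx1 ltx.le
  · rw [e2]; exact pr_lt_pr lt ltx1.le

theorem simCircuit_comparator {m n : M.Num} {G N : M.Str} {i x y : M.Num} (hi : i < n)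
    (hN : i ∉ N) (hx : x < m) (hy : y < m) (e : pr x y = seq M G i) :
    seq M (simCircuit M m n G N) (i + i + i) = pr (x + x) (y + y) ∧
    seq M (simCircuit M m n G N) (i + i + i + 1) = pr (y + y + 1) (x + x + 1) ∧
    seq M (simCircuit M m n G N) (i + i + i + 1 + 1) = pr 0 0 := by
  have e0 : simGate₀ M m G N i = pr (x + x) (y + y) := by
    simp [simGate₀, gateX, hN, ← e, fstPr_pr, sndPr_pr]
  have e1 : simGate₁ M G N i = pr (y + y + 1) (x + x + 1) := by
    simp [simGate₁, gateX, hN, ← e, fstPr_pr, sndPr_pr]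
  have e2 : simGate₂ M m G N i = pr 0 0 := by simp [simGate₂, hN]
  have lt : m + m < m + m + 1 := num_lt_add_one_iff.2 le_rfl
  have ltx : x + x < m + m + 1 := (add_lt_add hx hx).trans lt
  have ltx1 : x + x + 1 < m + m + 1 := (add_self_add_one_lt hx).trans lt
  have lty : y + y < m + m + 1 := (add_lt_add hy hy).trans lt
  have lty1 : y + y + 1 < m + m + 1 := (add_self_add_one_lt hy).trans lt
  rw [← e0, ← e1, ← e2]
  refine seq_simCircuit hi ?_ ?_ ?_
  · rw [e0]; exact pr_lt_pr ltx lty.le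
  · rw [e1]; exact pr_lt_pr lty1 ltx1.le
  · rw [e2]; exact pr_lt_pr ((num_zero_le _).trans_lt ltx) (num_zero_le _)

theorem validCcv_simCircuit {m n : M.Num} {G N : M.Str} (hv : ValidCcvNeg M m n G N) :
    ValidCcv M (m + m + 1) (n + n + n) (simCircuit M m n G N) := by
  intro k hk
  obtain ⟨i, hi, hk⟩ := exists_triple hk
  have lt : m + m < m + m + 1 := num_lt_add_one_iff.2 le_rfl
  obtain ⟨x, hx, ⟨hN, e⟩ | ⟨hN, y, hy, e⟩⟩ := hv i hi
  · obtain ⟨e0, e1, e2⟩ := simCircuit_negation hi hN hx e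
    have ltx : x + x < m + m + 1 := (add_lt_add hx hx).trans lt
    have ltx1 : x + x + 1 < m + m + 1 := (add_self_add_one_lt hx).trans lt
    rcases hk with rfl | rfl | rfl
    · exact ⟨_, ltx, _, lt, e0.symm⟩
    · exact ⟨_, ltx1, _, ltx, e1.symm⟩
    · exact ⟨_, lt, _, ltx1, e2.symm⟩
  · obtain ⟨e0, e1, e2⟩ := simCircuit_comparator hi hN hx hy e
    have ltx : x + x < m + m + 1 := (add_lt_add hx hx).trans lt
    have ltx1 : x + x + 1 < m + m + 1 := (add_self_add_one_lt hx).trans lt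
    have lty : y + y < m + m + 1 := (add_lt_add hy hy).trans lt
    have lty1 : y + y + 1 < m + m + 1 := (add_self_add_one_lt hy).trans lt
    have lt0 : (0 : M.Num) < m + m + 1 := (num_zero_le _).trans_lt ltx
    rcases hk with rfl | rfl | rfl
    · exact ⟨_, ltx, _, lty, e0.symm⟩
    · exact ⟨_, lty1, _, ltx1, e1.symm⟩
    · exact ⟨_, lt0, _, lt0, e2.symm⟩

theorem mem_simInput {m : M.Num} {I : M.Str} {z : M.Num} : z ∈ simInput M m I ↔
    z < m + m + 1 ∧ ∃ j, j < m ∧ ((z = j + j ∧ j ∈ I) ∨ (z = j + j + 1 ∧ j ∉ I)) :=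
  Def.mem_mkStr (n := 0) (S := fun _ : Unit => M) (nums := Set.univ) (strs := Set.univ)
    (Q := fun _ _ z => ∃ j, j < m ∧ ((z = j + j ∧ j ∈ I) ∨ (z = j + j + 1 ∧ j ∉ I)))
    (Def.simInput_aux (m := fun _ _ => m) (I := fun _ _ => I) (.param m) (.param I)) () ![]

/-- From the layers of the simulating circuit one obtains the layers of the simulated one. -/
theorem exists_layers_of_simulation {m n : M.Num} {G I N Z : M.Str} (hv : ValidCcvNeg M m n G N)
    (hZ : DeltaCCV M (m + m + 1) (n + n + n) (simCircuit M m n G N) (simInput M m I) Z) :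
    ∃ Z', DeltaCcvNeg M m n G I N Z' ∧
      ∀ i ≤ n, ∀ j < m, (pr i j ∈ Z' ↔ pr (i + i + i) (j + j) ∈ Z) := by
  have lt : m + m < m + m + 1 := num_lt_add_one_iff.2 le_rfl
  have hev : ∀ j < m, (pr 0 (j + j) ∈ Z ↔ j ∈ I) := fun j hj => by
    have hl := (add_lt_add hj hj).trans lt
    rw [← hZ.1 _ hl, mem_simInput]
    constructor
    · rintro ⟨-, a, -, ⟨ha, h⟩ | ⟨ha, -⟩⟩
      · rwa [add_self_inj.1 ha]
      · exact absurd ha (add_self_ne_add_self_add_one _ _)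
    · exact fun h => ⟨hl, j, hj, Or.inl ⟨rfl, h⟩⟩
  have hod : ∀ j < m, (pr 0 (j + j + 1) ∈ Z ↔ j ∉ I) := fun j hj => by
    have hl := (add_self_add_one_lt hj).trans lt
    rw [← hZ.1 _ hl, mem_simInput]
    constructor
    · rintro ⟨-, a, -, ⟨ha, -⟩ | ⟨ha, h⟩⟩
      · exact absurd ha.symm (add_self_ne_add_self_add_one _ _)
      · rwa [add_self_inj.1 (add_right_cancel ha)]
    · exact fun h => ⟨hl, j, hj, Or.inr ⟨rfl, h⟩⟩
  have h0 : DualRail m (fun j => pr 0 j ∈ Z) := by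
    refine ⟨fun j hj => (hod j hj).trans (not_congr (hev j hj)).symm, ?_⟩
    refine (not_congr (hZ.1 _ lt)).1 ?_
    rw [mem_simInput]
    rintro ⟨-, a, ha, ⟨ha', -⟩ | ⟨ha', -⟩⟩
    · exact ha.ne' (add_self_inj.1 ha')
    · exact add_self_ne_add_self_add_one _ _ ha'
  have e3 : ∀ i : M.Num, (i + 1) + (i + 1) + (i + 1) = i + i + i + 1 + 1 + 1 := fun i => by ring
  have p1 : (0 : M.Num) < 1 := zero_lt_one
  have step : ∀ i < n, ∀ {a b c d e f : M.Num}, a < m + m + 1 → b < m + m + 1 → c < m + m + 1 →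
      d < m + m + 1 → e < m + m + 1 → f < m + m + 1 →
      seq M (simCircuit M m n G N) (i + i + i) = pr a b ∧
      seq M (simCircuit M m n G N) (i + i + i + 1) = pr c d ∧
      seq M (simCircuit M m n G N) (i + i + i + 1 + 1) = pr e f →
      ∃ s₁ s₂ : M.Num → Prop, CompStep (m + m + 1) a b (fun j => pr (i + i + i) j ∈ Z) s₁ ∧
        CompStep (m + m + 1) c d s₁ s₂ ∧
        CompStep (m + m + 1) e f s₂ (fun j => pr ((i + 1) + (i + 1) + (i + 1)) j ∈ Z) := by
    intro i hi a b c d e f ha hb hc hd he hf ⟨h1, h2, h3⟩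
    have hi' := num_add_one_le_iff.2 hi
    rw [e3]
    exact ⟨_, _, hZ.2 _ (by grind) _ ha _ hb h1.symm, hZ.2 _ (by grind) _ hc _ hd h2.symm,
      hZ.2 _ (by grind) _ he _ hf h3.symm⟩
  have neg : ∀ i < n, ∀ x < m, i ∈ N ∧ x = seq M G i → DualRail m (fun j => pr (i + i + i) j ∈ Z) →
      NegStep m x (fun j => pr (i + i + i) (j + j) ∈ Z)
        (fun j => pr ((i + 1) + (i + 1) + (i + 1)) (j + j) ∈ Z) ∧
      DualRail m (fun j => pr ((i + 1) + (i + 1) + (i + 1)) j ∈ Z) := by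
    intro i hi x hx ⟨hN, e⟩ hd
    have ltx := (add_lt_add hx hx).trans lt
    have ltx1 := (add_self_add_one_lt hx).trans lt
    obtain ⟨s₁, s₂, h1, h2, h3⟩ := step i hi ltx lt ltx1 ltx lt ltx1
      (simCircuit_negation hi hN hx e)
    exact negation_simulation hx hd h1 h2 h3
  have comp : ∀ i < n, ∀ x < m, ∀ y < m, i ∉ N ∧ pr x y = seq M G i →
      DualRail m (fun j => pr (i + i + i) j ∈ Z) →
      CompStep m x y (fun j => pr (i + i + i) (j + j) ∈ Z)
        (fun j => pr ((i + 1) + (i + 1) + (i + 1)) (j + j) ∈ Z) ∧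
      DualRail m (fun j => pr ((i + 1) + (i + 1) + (i + 1)) j ∈ Z) := by
    intro i hi x hx y hy ⟨hN, e⟩ hd
    have ltx := (add_lt_add hx hx).trans lt
    have ltx1 := (add_self_add_one_lt hx).trans lt
    have lty := (add_lt_add hy hy).trans lt
    have lty1 := (add_self_add_one_lt hy).trans lt
    have lt0 : (0 : M.Num) < m + m + 1 := (num_zero_le _).trans_lt ltx
    obtain ⟨s₁, s₂, h1, h2, h3⟩ := step i hi ltx lty lty1 ltx1 lt0 lt0
      (simCircuit_comparator hi hN hx hy e)
    exact comparator_simulation hx hy hd h1 h2 h3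
  have dual : ∀ i ≤ n, DualRail m (fun j => pr (i + i + i) j ∈ Z) := by
    intro i
    refine num_induction (P := fun i => i ≤ n → (∀ j < m, (pr (i + i + i) (j + j + 1) ∈ Z ↔
      ¬ pr (i + i + i) (j + j) ∈ Z)) ∧ ¬ pr (i + i + i) (m + m) ∈ Z) .auto ?_ ?_ i
    · intro _
      simpa [DualRail] using h0
    · intro i ih hi
      rw [num_add_one_le_iff] at hi
      obtain ⟨x, hx, h | ⟨hN, y, hy, e⟩⟩ := hv i hi
      · exact (neg i hi x hx h (ih hi.le)).2
      · exact (comp i hi x hx y hy ⟨hN, e⟩ (ih hi.le)).2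
  have hd : ParamDef M 2 (fun v => pr (v 0 + v 0 + v 0) (v 1 + v 1) ∈ Z) := .auto
  have hm : ∀ i ≤ n, ∀ j < m, (pr i j ∈ relStr M (n + 1) m
      (fun i j => pr (i + i + i) (j + j) ∈ Z) ↔ pr (i + i + i) (j + j) ∈ Z) := by
    intro i hi j hj
    refine (Def.mem_relStr (n := 0) (b := fun _ _ => n + 1) (c := fun _ _ => m)
      (R := fun _ _ i j => pr (i + i + i) (j + j) ∈ Z) (.add (.param n) .one) (.param m) hd ()
      ![]).trans ?_
    rw [num_lt_add_one_iff]
    exact ⟨fun h => h.2.2, fun h => ⟨hi, hj, h⟩⟩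
  refine ⟨_, ⟨fun j hj => ?_, fun i hi x hx y hy e => ?_, fun i hi x hx e => ?_⟩, hm⟩
  · rw [hm 0 (num_zero_le _) j hj, add_zero, add_zero, hev j hj]
  · exact (comp i hi x hx y hy e (dual i hi.le)).1.transfer hx hy (hm i hi.le)
      (hm _ (num_add_one_le_iff.2 hi))
  · exact (neg i hi x hx e (dual i hi.le)).1.transfer hx (hm i hi.le)
      (hm _ (num_add_one_le_iff.2 hi))

end

/-- Valid circuits with negation gates have layers, which are read off from those of the simulating
comparator circuit. -/
theorem IsVCC.exists_layers_neg {M : Structure.{u}} [IsVCC M] {m n : M.Num} {G N : M.Str}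
    (hv : ValidCcvNeg M m n G N) (I : M.Str) : ∃ Z, DeltaCcvNeg M m n G I N Z := by
  obtain ⟨Z, hZ⟩ := IsVCC.exists_layers (m + m + 1) (n + n + n) (simCircuit M m n G N)
    (simInput M m I)
  obtain ⟨Z', hZ', -⟩ := exists_layers_of_simulation hv hZ
  exact ⟨Z', hZ'⟩

/-! ### Computing lfm-matchings by circuits -/

/-- Gate number `k = a * n + b` of the circuit that computes the lfm-matching of `E`: the
comparator gate `⟨a, m + b⟩` if `(a, b)` is an edge, and an idle gate otherwise. -/
noncomputable def lfmGate (M : Structure.{u}) [IsVZero M] (m n : M.Num) (E : M.Str) (k : M.Num) :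
    M.Num :=
  least M (pr m (m + n)) (fun y =>
    (∃ a, a < m ∧ ∃ b, b < n ∧ (k = a * n + b ∧ pr a b ∈ E ∧ y = pr a (m + b))) ∨
    (¬ (∃ a, a < m ∧ ∃ b, b < n ∧ (k = a * n + b ∧ pr a b ∈ E)) ∧ y = 0))

section
variable {ι : Type w} {S : ι → Structure.{u}} [∀ i, IsVZero (S i)] {nums : Set (∀ i, (S i).Num)}
  {strs : Set (∀ i, (S i).Str)} {d : ℕ}

theorem DefN.lfmGate {m n f : ∀ i, (Fin d → (S i).Num) → (S i).Num}
    {E : ∀ i, (Fin d → (S i).Num) → (S i).Str} (hm : DefN S nums strs d m)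
    (hn : DefN S nums strs d n) (hE : DefS S nums strs d E) (hf : DefN S nums strs d f) :
    DefN S nums strs d (fun i v => lfmGate (S i) (m i v) (n i v) (E i v) (f i v)) := by
  have c : ∀ a : Fin (d + 3), DefN S nums strs (d + 3) (fun _ v => v a) := fun a => .coord a
  have hf' := hf.rename fun a => a.castSucc.castSucc.castSucc
  have hm' := hm.rename fun a => a.castSucc.castSucc.castSucc
  have hn' := hn.rename fun a => a.castSucc.castSucc.castSucc
  have hE' := hE.rename fun a => a.castSucc.castSucc.castSucc
  refine .least (.pr hm (.add hm hn)) (.or ?_ (.and (.not ?_) (.eq (.coord _) .zero)))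
  · exact .exLt (hm.rename _) (.exLt (hn.rename fun a => a.castSucc.castSucc)
      (.and (.eq hf' (.add (.mul (c _) hn') (c _))) (.and (.mem (.pr (c _) (c _)) hE')
        (.eq (c _) (.pr (c _) (.add hm' (c _)))))))
  · exact .exLt (hm.rename _) (.exLt (hn.rename fun a => a.castSucc.castSucc)
      (.and (.eq hf' (.add (.mul (c _) hn') (c _))) (.mem (.pr (c _) (c _)) hE')))

end

section
variable {M : Structure.{u}} [IsVZero M] {m n : M.Num} {E : M.Str}

theorem lfmGate_of_edge {a b : M.Num} (ha : a < m) (hb : b < n) (hE : pr a b ∈ E) :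
    lfmGate M m n E (a * n + b) = pr a (m + b) := by
  refine least_eq_of_unique (pr_lt_pr ha (add_le_add le_rfl hb.le)) fun z => ?_
  constructor
  · rintro (⟨a', ha', b', hb', e, -, rfl⟩ | ⟨h, -⟩)
    · obtain ⟨rfl, rfl⟩ := (row_inj hb hb').1 e
      rfl
    · exact absurd ⟨a, ha, b, hb, rfl, hE⟩ h
  · rintro rfl
    exact Or.inl ⟨a, ha, b, hb, rfl, hE, rfl⟩

theorem lfmGate_of_not_edge {k : M.Num}
    (h : ¬ ∃ a, a < m ∧ ∃ b, b < n ∧ (k = a * n + b ∧ pr a b ∈ E)) :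
    lfmGate M m n E k = pr 0 0 := by
  rw [pr_zero]
  refine least_eq_of_unique_le (num_zero_le _) fun z => ?_
  constructor
  · rintro (⟨a, ha, b, hb, e, hE, -⟩ | ⟨-, h⟩)
    · exact absurd ⟨a, ha, b, hb, e, hE⟩ h
    · exact h
  · exact fun hz => Or.inr ⟨h, hz⟩

theorem lfmGate_valid {k : M.Num} (hk : k < m * n) :
    ∃ x < m + n, ∃ y < m + n, lfmGate M m n E k = pr x y := by
  by_cases h : ∃ a, a < m ∧ ∃ b, b < n ∧ (k = a * n + b ∧ pr a b ∈ E)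
  · obtain ⟨a, ha, b, hb, rfl, hE⟩ := h
    exact ⟨a, ha.trans_le (le_add_of_nonneg_right (num_zero_le _)), m + b,
      add_lt_add_right hb _, lfmGate_of_edge ha hb hE⟩
  · have h0 : 0 < m + n := by
      rw [num_pos_iff]
      intro h0
      have hm : m = 0 := le_antisymm (h0 ▸ le_add_of_nonneg_right (num_zero_le _)) (num_zero_le _)
      rw [hm, zero_mul] at hk
      exact absurd hk (not_lt.2 (num_zero_le _))
    exact ⟨0, h0, 0, h0, lfmGate_of_not_edge h⟩

/-- `Z` contains the layers of the circuit that computes the lfm-matching of `E`: the wires `a < m`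
carry one as long as the bottom node `a` is not matched, the wires `m + b` carry one as soon as
the top node `b` is matched. -/
def LfmLayers (M : Structure.{u}) [IsVZero M] (m n : M.Num) (E Z : M.Str) : Prop :=
  (∀ j < m + n, pr 0 j ∈ Z ↔ j < m) ∧ ∀ k < m * n, ∀ x < m + n, ∀ y < m + n,
    lfmGate M m n E k = pr x y →
    CompStep (m + n) x y (fun j => pr k j ∈ Z) (fun j => pr (k + 1) j ∈ Z)

/-- The matching read off from the layers of the circuit. -/
def IsReadOff (M : Structure.{u}) [IsVZero M] (m n : M.Num) (E Z L : M.Str) : Prop :=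
  ∀ a < m, ∀ b < n, (pr a b ∈ L ↔
    pr a b ∈ E ∧ pr (a * n + b) a ∈ Z ∧ pr (a * n + b) (m + b) ∉ Z)

/-- After the first `k` pairs `(a, b)` have been treated in lexicographic order, the wires record
which nodes are matched by the pairs treated so far. -/
theorem LfmLayers.invariant {Z L : M.Str} (hZ : LfmLayers M m n E Z) (hL : IsReadOff M m n E Z L) :
    ∀ k ≤ m * n, (∀ b < n, pr k (m + b) ∈ Z ↔ ∃ a < m, a * n + b < k ∧ pr a b ∈ L) ∧
      (∀ a < m, pr k a ∈ Z ↔ ¬ ∃ b < n, a * n + b < k ∧ pr a b ∈ L) := by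
  have ltm : ∀ a < m, a < m + n := fun a ha =>
    ha.trans_le (le_add_of_nonneg_right (num_zero_le _))
  have ltn : ∀ b < n, m + b < m + n := fun b hb => add_lt_add_right hb _
  have nlt : ∀ k : M.Num, ¬ k < 0 := fun k => not_lt.2 (num_zero_le k)
  have ne : ∀ a < m, ∀ b : M.Num, a ≠ m + b := fun a ha b =>
    (ha.trans_le (le_add_of_nonneg_right (num_zero_le _))).ne
  have succ : ∀ c k : M.Num, c < k + 1 ↔ c < k ∨ c = k := fun c k => by
    rw [num_lt_add_one_iff, le_iff_lt_or_eq]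
  intro k
  refine num_induction (P := fun k => k ≤ m * n →
    (∀ b < n, (pr k (m + b) ∈ Z ↔ ∃ a < m, a * n + b < k ∧ pr a b ∈ L)) ∧
      (∀ a < m, (pr k a ∈ Z ↔ ¬ ∃ b < n, a * n + b < k ∧ pr a b ∈ L))) .auto ?_ ?_ k
  · intro _
    refine ⟨fun b hb => ?_, fun a ha => ?_⟩
    · rw [hZ.1 _ (ltn b hb)]
      simp only [nlt, false_and, and_false, exists_false, iff_false, not_lt]
      exact le_add_of_nonneg_right (num_zero_le _)
    · rw [hZ.1 _ (ltm a ha)]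
      simp [nlt, ha]
  · intro k ih hk
    rw [num_add_one_le_iff] at hk
    obtain ⟨ih1, ih2⟩ := ih hk.le
    by_cases h : ∃ a, a < m ∧ ∃ b, b < n ∧ (k = a * n + b ∧ pr a b ∈ E)
    · obtain ⟨a, ha, b, hb, rfl, hE⟩ := h
      obtain ⟨h1, h2, h3⟩ := hZ.2 _ hk a (ltm a ha) _ (ltn b hb) (lfmGate_of_edge ha hb hE)
      have hLab := hL a ha b hb
      refine ⟨fun b' hb' => ?_, fun a' ha' => ?_⟩
      · by_cases hbb : b' = b
        · subst hbb
          have e : (∃ a' < m, a' * n + b' < a * n + b' + 1 ∧ pr a' b' ∈ L) ↔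
              (∃ a' < m, a' * n + b' < a * n + b' ∧ pr a' b' ∈ L) ∨ pr a b' ∈ L := by
            constructor
            · rintro ⟨a', ha', h, hl⟩
              rcases (succ _ _).1 h with h | h
              · exact Or.inl ⟨a', ha', h, hl⟩
              · exact Or.inr (((row_inj hb hb).1 h).1 ▸ hl)
            · rintro (⟨a', ha', h, hl⟩ | hl)
              · exact ⟨a', ha', (succ _ _).2 (Or.inl h), hl⟩
              · exact ⟨a, ha, (succ _ _).2 (Or.inr rfl), hl⟩
          rw [e, ← ih1 b' hb', hLab]
          refine h2.trans ?_
          beta_reduce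
          generalize (pr (a * n + b') a ∈ Z) = p, (pr (a * n + b') (m + b') ∈ Z) = q
          by_cases hp : p <;> by_cases hq : q <;> simp [hp, hq, hE]
        · refine (h3 _ (ltn b' hb') ⟨(ne a ha b').symm, fun h => hbb (add_left_cancel h)⟩).trans ?_
          refine (ih1 b' hb').trans (exists_congr fun a' => and_congr_right fun _ =>
            and_congr_left fun _ => ?_)
          rw [succ, or_iff_left fun h => hbb ((row_inj hb' hb).1 h).2]
      · by_cases haa : a' = a
        · subst haa
          have e : (∃ b' < n, a' * n + b' < a' * n + b + 1 ∧ pr a' b' ∈ L) ↔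
              (∃ b' < n, a' * n + b' < a' * n + b ∧ pr a' b' ∈ L) ∨ pr a' b ∈ L := by
            constructor
            · rintro ⟨b', hb', h, hl⟩
              rcases (succ _ _).1 h with h | h
              · exact Or.inl ⟨b', hb', h, hl⟩
              · exact Or.inr (((row_inj hb' hb).1 h).2 ▸ hl)
            · rintro (⟨b', hb', h, hl⟩ | hl)
              · exact ⟨b', hb', (succ _ _).2 (Or.inl h), hl⟩
              · exact ⟨b, hb, (succ _ _).2 (Or.inr rfl), hl⟩
          rw [e, not_or, ← ih2 a' ha', hLab]
          refine h1.trans ?_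
          beta_reduce
          generalize (pr (a' * n + b) a' ∈ Z) = p, (pr (a' * n + b) (m + b) ∈ Z) = q
          by_cases hp : p <;> by_cases hq : q <;> simp [hp, hq, hE]
        · refine (h3 _ (ltm a' ha') ⟨haa, ne a' ha' b⟩).trans ?_
          refine (ih2 a' ha').trans (not_congr (exists_congr fun b' => and_congr_right fun hb' =>
            and_congr_left fun _ => ?_))
          rw [succ, or_iff_left fun h => haa ((row_inj hb' hb).1 h).1]
    · have h0 : 0 < m + n := by
        obtain ⟨x, hx, -⟩ := lfmGate_valid (E := E) hk
        exact (num_zero_le x).trans_lt hx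
      have hs := (hZ.2 k hk 0 h0 0 h0 (lfmGate_of_not_edge h)).self
      refine ⟨fun b hb => (hs _ (ltn b hb)).trans ((ih1 b hb).trans ?_),
        fun a ha => (hs _ (ltm a ha)).trans ((ih2 a ha).trans (not_congr ?_))⟩
      · refine exists_congr fun a => and_congr_right fun ha => and_congr_left fun hl => ?_
        rw [succ, or_iff_left fun e => h ⟨a, ha, b, hb, e.symm, ((hL a ha b hb).1 hl).1⟩]
      · refine exists_congr fun b => and_congr_right fun hb => and_congr_left fun hl => ?_
        rw [succ, or_iff_left fun e => h ⟨a, ha, b, hb, e.symm, ((hL a ha b hb).1 hl).1⟩]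

theorem LfmLayers.isLfm {Z L : M.Str} (hZ : LfmLayers M m n E Z) (hL : IsReadOff M m n E Z L) :
    IsLfm M m n E L := by
  intro i hi j hj
  obtain ⟨h1, h2⟩ := hZ.invariant hL (i * n + j) (row_lt_mul hj hi).le
  rw [hL i hi j hj, h1 j hj, h2 i hi]
  refine and_congr_right fun _ => and_congr ?_ ?_
  · constructor
    · exact fun h k hk hl => h ⟨k, hk.trans hj, add_lt_add_right hk _, hl⟩
    · rintro h ⟨k, hk, hlt, hl⟩
      exact h k (lt_of_add_lt_add_left hlt) hl
  · constructor
    · exact fun h k hk hl => h ⟨k, hk.trans hi, row_lt hj hk _, hl⟩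
    · rintro h ⟨k, hk, hlt, hl⟩
      rcases (row_lt_iff hj hj).1 hlt with h' | h'
      · exact h k h' hl
      · exact absurd h'.2 (lt_irrefl _)

end

/-- The theory `VCC*` proves that every bipartite graph has an lfm-matching. -/
theorem IsVCC.exists_lfm {M : Structure.{u}} [IsVCC M] (m n : M.Num) (E : M.Str) :
    ∃ Z L, LfmLayers M m n E Z ∧ IsReadOff M m n E Z L ∧ IsLfm M m n E L := by
  obtain ⟨Z, h0, hZ⟩ := IsVCC.exists_layers_of_def (m + n) (m * n) (g := lfmGate M m n E)
    (P := fun j => j < m) (.lfmGate (.param m) (.param n) (.param E) (.coord 0)) .auto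
  have hd : ParamDef M 2 (fun v => pr (v 0) (v 1) ∈ E ∧ pr (v 0 * n + v 1) (v 0) ∈ Z ∧
    ¬ pr (v 0 * n + v 1) (m + v 1) ∈ Z) := .auto
  have hL : IsReadOff M m n E Z (relStr M m n (fun a b => pr a b ∈ E ∧ pr (a * n + b) a ∈ Z ∧
      ¬ pr (a * n + b) (m + b) ∈ Z)) := by
    intro a ha b hb
    refine (Def.mem_relStr (n := 0) (b := fun _ _ => m) (c := fun _ _ => n)
      (R := fun _ _ a b => pr a b ∈ E ∧ pr (a * n + b) a ∈ Z ∧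
        ¬ pr (a * n + b) (m + b) ∈ Z) (.param m) (.param n) hd () ![]).trans ?_
    exact ⟨fun h => h.2.2, fun h => ⟨ha, hb, h⟩⟩
  have hl : LfmLayers M m n E Z := ⟨h0, hZ⟩
  exact ⟨Z, _, hl, hL, hl.isLfm hL⟩

/-! ### From matched edges to circuits with negation gates -/

open Classical in
/-- The circuit of the lfm-matching up to the treatment of the edge `(i, j)`, followed by a negation
gate on the wire of `j` and a comparator gate from the wire of `i` to that of `j`. -/
noncomputable def edgeGate (M : Structure.{u}) [IsVZero M] (m n i j : M.Num) (E : M.Str)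
    (k : M.Num) : M.Num :=
  if k = i * n + j then m + j else if k = i * n + j + 1 then pr i (m + j) else lfmGate M m n E k

/-- The gates `edgeGate` as a string. -/
noncomputable def edgeCircuit (M : Structure.{u}) [IsVZero M] (m n i j : M.Num) (E : M.Str) :
    M.Str :=
  relStr M (i * n + j + 1 + 1) (pr (m + n) (m + n)) (fun k y => y = edgeGate M m n i j E k)

/-- The string `{0, …, m - 1}`. -/
noncomputable def initialSegment (M : Structure.{u}) [IsVZero M] (m : M.Num) : M.Str :=
  mkStr M m (fun z => z = z)

/-- The string `{k}`. -/
noncomputable def singletonStr (M : Structure.{u}) [IsVZero M] (k : M.Num) : M.Str :=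
  mkStr M (k + 1) (fun z => z = k)

section
variable {ι : Type w} {S : ι → Structure.{u}} [∀ i, IsVZero (S i)] {nums : Set (∀ i, (S i).Num)}
  {strs : Set (∀ i, (S i).Str)} {d : ℕ} {m n a b f : ∀ i, (Fin d → (S i).Num) → (S i).Num}
  {E : ∀ i, (Fin d → (S i).Num) → (S i).Str}

theorem DefN.edgeGate (hm : DefN S nums strs d m)
    (hn : DefN S nums strs d n) (ha : DefN S nums strs d a) (hb : DefN S nums strs d b)
    (hE : DefS S nums strs d E) (hf : DefN S nums strs d f) :
    DefN S nums strs d (fun i v =>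
      edgeGate (S i) (m i v) (n i v) (a i v) (b i v) (E i v) (f i v)) :=
  .ite (.eq hf (.add (.mul ha hn) hb)) (.add hm hb)
    (.ite (.eq hf (.add (.add (.mul ha hn) hb) .one)) (.pr ha (.add hm hb))
      (.lfmGate hm hn hE hf))

theorem DefS.edgeCircuit (hm : DefN S nums strs d m)
    (hn : DefN S nums strs d n) (ha : DefN S nums strs d a) (hb : DefN S nums strs d b)
    (hE : DefS S nums strs d E) :
    DefS S nums strs d (fun i v =>
      edgeCircuit (S i) (m i v) (n i v) (a i v) (b i v) (E i v)) :=
  .relStr (.add (.add (.add (.mul ha hn) hb) .one) .one) (.pr (.add hm hn) (.add hm hn))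
    (.eq (.coord _) (.edgeGate (hm.rename fun a => a.castSucc.castSucc) (hn.rename _)
      (ha.rename _) (hb.rename _) (hE.rename _) (.coord _)))

theorem DefS.initialSegment (hm : DefN S nums strs d m) :
    DefS S nums strs d (fun i v => initialSegment (S i) (m i v)) :=
  .mkStr hm (.eq (.coord _) (.coord _))

theorem DefS.singletonStr (hf : DefN S nums strs d f) :
    DefS S nums strs d (fun i v => singletonStr (S i) (f i v)) :=
  .mkStr (.add hf .one) (.eq (.coord _) (hf.rename _))

end

section
variable {M : Structure.{u}} [IsVZero M] {m n i j : M.Num} {E : M.Str}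

theorem mem_initialSegment {z : M.Num} : z ∈ initialSegment M m ↔ z < m := by
  have hd : ParamDef M 1 (fun v => v 0 = v 0) := .auto
  refine (Def.mem_mkStr (Q := fun _ _ z => z = z) (n := 0) hd () ![]).trans ?_
  simp

theorem mem_singletonStr {k z : M.Num} : z ∈ singletonStr M k ↔ z = k := by
  have hd : ParamDef M 1 (fun v => v 0 = k) := .auto
  refine (Def.mem_mkStr (Q := fun _ _ z => z = k) (n := 0) hd () ![]).trans ?_
  rw [and_iff_right_iff_imp]
  rintro rfl
  exact num_lt_add_one_iff.2 le_rfl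

theorem seq_edgeCircuit {k : M.Num} (hk : k < i * n + j + 1 + 1)
    (h : edgeGate M m n i j E k < pr (m + n) (m + n)) :
    seq M (edgeCircuit M m n i j E) k = edgeGate M m n i j E k :=
  seq_relStr (.edgeGate (.param m) (.param n) (.param i) (.param j) (.param E) (.coord 0)) hk h

theorem seq_edgeCircuit_of_lt (hi : i < m) (hj : j < n) {k : M.Num} (hk : k < i * n + j) :
    seq M (edgeCircuit M m n i j E) k = lfmGate M m n E k := by
  have e : edgeGate M m n i j E k = lfmGate M m n E k := by
    rw [edgeGate, if_neg hk.ne, if_neg (hk.trans (num_lt_add_one_iff.2 le_rfl)).ne]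
  obtain ⟨x, hx, y, hy, e'⟩ := lfmGate_valid (E := E) (hk.trans (row_lt_mul hj hi))
  rw [seq_edgeCircuit, e]
  · exact num_lt_add_one_iff.2 (num_lt_add_one_iff.2 hk.le).le
  · rw [e, e']; exact pr_lt_pr hx hy.le

theorem seq_edgeCircuit_negation (hj : j < n) :
    seq M (edgeCircuit M m n i j E) (i * n + j) = m + j := by
  have e : edgeGate M m n i j E (i * n + j) = m + j := if_pos rfl
  rw [seq_edgeCircuit, e]
  · exact num_lt_add_one_iff.2 (num_lt_add_one_iff.2 le_rfl).le
  · rw [e]; exact (add_lt_add_right hj m).trans_le (le_pr_right _ _)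

theorem seq_edgeCircuit_comparator (hi : i < m) (hj : j < n) :
    seq M (edgeCircuit M m n i j E) (i * n + j + 1) = pr i (m + j) := by
  have e : edgeGate M m n i j E (i * n + j + 1) = pr i (m + j) := by
    rw [edgeGate, if_neg (num_lt_add_one_iff.2 le_rfl).ne', if_pos rfl]
  rw [seq_edgeCircuit, e]
  · exact num_lt_add_one_iff.2 le_rfl
  · rw [e]
    exact pr_lt_pr (hi.trans_le (le_add_of_nonneg_right (num_zero_le _)))
      (add_lt_add_right hj m).le

theorem validCcvNeg_edgeCircuit (hi : i < m) (hj : j < n) :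
    ValidCcvNeg M (m + n) (i * n + j + 1 + 1) (edgeCircuit M m n i j E)
      (singletonStr M (i * n + j)) := by
  intro k hk
  rw [num_lt_add_one_iff, le_iff_lt_or_eq, num_lt_add_one_iff, le_iff_lt_or_eq] at hk
  rcases hk with (hk | rfl) | rfl
  · obtain ⟨x, hx, y, hy, e⟩ := lfmGate_valid (E := E) (hk.trans (row_lt_mul hj hi))
    exact ⟨x, hx, Or.inr ⟨by rw [mem_singletonStr]; exact hk.ne, y, hy,
      by rw [seq_edgeCircuit_of_lt hi hj hk, e]⟩⟩
  · exact ⟨m + j, add_lt_add_right hj m, Or.inl ⟨mem_singletonStr.2 rfl,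
      (seq_edgeCircuit_negation hj).symm⟩⟩
  · exact ⟨i, hi.trans_le (le_add_of_nonneg_right (num_zero_le _)), Or.inr
      ⟨by rw [mem_singletonStr]; exact (num_lt_add_one_iff.2 le_rfl).ne', m + j,
        add_lt_add_right hj m, (seq_edgeCircuit_comparator hi hj).symm⟩⟩

/-- When the edge `(i, j)` is treated, it becomes matched if and only if wire `i` carries one and
wire `m + j` carries zero, which is what the last two gates of `edgeCircuit` test. -/
theorem edgeCircuit_output {Z L Z' : M.Str} (hi : i < m) (hj : j < n) (hE : pr i j ∈ E)
    (hZ : LfmLayers M m n E Z) (hL : IsReadOff M m n E Z L)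
    (hZ' : DeltaCcvNeg M (m + n) (i * n + j + 1 + 1) (edgeCircuit M m n i j E)
      (initialSegment M m) (singletonStr M (i * n + j)) Z') :
    pr (i * n + j + 1 + 1) i ∈ Z' ↔ pr i j ∈ L := by
  have hi' : i < m + n := hi.trans_le (le_add_of_nonneg_right (num_zero_le _))
  have hj' : m + j < m + n := add_lt_add_right hj m
  have hne : i ≠ m + j := (hi.trans_le (le_add_of_nonneg_right (num_zero_le _))).ne
  have lt1 : i * n + j < i * n + j + 1 := num_lt_add_one_iff.2 le_rfl
  have lt2 : i * n + j + 1 < i * n + j + 1 + 1 := num_lt_add_one_iff.2 le_rfl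
  -- up to the layer `i * n + j`, both circuits agree
  have hu : ∀ k ≤ i * n + j, ∀ x < m + n, (pr k x ∈ Z' ↔ pr k x ∈ Z) := by
    refine layers_unique (fun x hx => ?_) fun k hk ih => ?_
    · rw [← hZ'.1 x hx, mem_initialSegment, hZ.1 x hx]
    · have hk' := hk.trans (row_lt_mul hj hi)
      obtain ⟨x, hx, y, hy, e⟩ := lfmGate_valid (E := E) hk'
      refine (hZ'.2.1 k (hk.trans (lt1.trans lt2)) x hx y hy ⟨?_, ?_⟩).congr hx hy
        (hZ.2 k hk' x hx y hy e) ih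
      · rw [mem_singletonStr]; exact hk.ne
      · rw [seq_edgeCircuit_of_lt hi hj hk, e]
  have h1 := hZ'.2.2 (i * n + j) (lt1.trans lt2) _ hj'
    ⟨mem_singletonStr.2 rfl, (seq_edgeCircuit_negation hj).symm⟩
  have h2 := hZ'.2.1 (i * n + j + 1) lt2 i hi' _ hj'
    ⟨by rw [mem_singletonStr]; exact lt1.ne', (seq_edgeCircuit_comparator hi hj).symm⟩
  have a1 := h1.1
  have a2 := h1.2 i hi' hne
  have a3 := h2.1
  simp only at a1 a2 a3
  rw [a3, a2, a1, hu _ le_rfl i hi', hu _ le_rfl _ hj', hL i hi j hj]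
  simp only [hE, true_and]

end

/-! ### From matched vertices to matched edges -/

/-- The graph `E` with a further bottom node `m`, adjacent to the top node `j` and a further top
node `n`. -/
noncomputable def vertexGraph (M : Structure.{u}) [IsVZero M] (m n j : M.Num) (E : M.Str) :
    M.Str :=
  relStr M (m + 1) (n + 1) (fun a b => (a < m ∧ b < n ∧ pr a b ∈ E) ∨
    (a = m ∧ j < n ∧ (b = j ∨ b = n)))

theorem DefS.vertexGraph {ι : Type w} {S : ι → Structure.{u}} [∀ i, IsVZero (S i)]
    {nums : Set (∀ i, (S i).Num)} {strs : Set (∀ i, (S i).Str)} {d : ℕ}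
    {m n a : ∀ i, (Fin d → (S i).Num) → (S i).Num} {E : ∀ i, (Fin d → (S i).Num) → (S i).Str}
    (hm : DefN S nums strs d m) (hn : DefN S nums strs d n) (ha : DefN S nums strs d a)
    (hE : DefS S nums strs d E) :
    DefS S nums strs d (fun i v => vertexGraph (S i) (m i v) (n i v) (a i v) (E i v)) := by
  have c : ∀ a : Fin (d + 2), DefN S nums strs (d + 2) (fun _ v => v a) := fun a => .coord a
  have hm' := hm.rename fun a => a.castSucc.castSucc
  have hn' := hn.rename fun a => a.castSucc.castSucc
  have ha' := ha.rename fun a => a.castSucc.castSucc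
  have hE' := hE.rename fun a => a.castSucc.castSucc
  exact .relStr (.add hm .one) (.add hn .one)
    (.or (.and (.lt (c _) hm') (.and (.lt (c _) hn') (.mem (.pr (c _) (c _)) hE')))
      (.and (.eq (c _) hm') (.and (.lt ha' hn') (.or (.eq (c _) ha') (.eq (c _) hn')))))

section
variable {M : Structure.{u}} [IsVZero M] {m n j : M.Num} {E : M.Str}

theorem mem_vertexGraph {a b : M.Num} (ha : a ≤ m) (hb : b ≤ n) :
    pr a b ∈ vertexGraph M m n j E ↔ (a < m ∧ b < n ∧ pr a b ∈ E) ∨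
      (a = m ∧ j < n ∧ (b = j ∨ b = n)) := by
  have hd : ParamDef M 2 (fun v => (v 0 < m ∧ v 1 < n ∧ pr (v 0) (v 1) ∈ E) ∨
      (v 0 = m ∧ j < n ∧ (v 1 = j ∨ v 1 = n))) := .auto
  refine (Def.mem_relStr (n := 0) (b := fun _ _ => m + 1) (c := fun _ _ => n + 1)
    (R := fun _ _ a b => (a < m ∧ b < n ∧ pr a b ∈ E) ∨
      (a = m ∧ j < n ∧ (b = j ∨ b = n))) (.add (.param m) .one) (.add (.param n) .one) hd ()
      ![]).trans ?_
  rw [num_lt_add_one_iff, num_lt_add_one_iff]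
  exact ⟨fun h => h.2.2, fun h => ⟨ha, hb, h⟩⟩

/-- The further bottom node `m` comes last, so it leaves the matching of `E` unchanged; it takes the
top node `j` if that is still free, and the top node `n` otherwise. -/
theorem IsLfm.of_vertexGraph {L : M.Str} (h : IsLfm M (m + 1) (n + 1) (vertexGraph M m n j E) L) :
    IsLfm M m n E L ∧ (pr m n ∈ L ↔ j < n ∧ ∃ i < m, pr i j ∈ L) := by
  have ltm : m < m + 1 := num_lt_add_one_iff.2 le_rfl
  have ltn : n < n + 1 := num_lt_add_one_iff.2 le_rfl
  refine ⟨h.congr ltm.le ltn.le fun i hi k hk => ?_, ?_⟩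
  · rw [mem_vertexGraph hi.le hk.le]
    simp [hi, hk, hi.ne]
  · rw [h m ltm n ltn, mem_vertexGraph le_rfl le_rfl]
    by_cases hj : j < n
    · have hmk : ∀ k < n, (pr m k ∈ vertexGraph M m n j E ↔ k = j) := fun k hk => by
        rw [mem_vertexGraph le_rfl hk.le]; simp [hj, hk.ne]
      have hin : ∀ i < m, pr i n ∉ L := fun i hi hL => by
        have := ((h i (hi.trans ltm) n ltn).1 hL).1
        rw [mem_vertexGraph hi.le le_rfl] at this
        simp [hi.ne] at this
      have hmj : pr m j ∈ L ↔ ∀ i < m, pr i j ∉ L := by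
        rw [h m ltm j (hj.trans ltn), hmk j hj]
        refine ⟨fun h => h.2.2, fun h' => ⟨rfl, fun k hk hL => ?_, h'⟩⟩
        exact hk.ne ((hmk k (hk.trans hj)).1 ((h m ltm k ((hk.trans hj).trans ltn)).1 hL).1)
      constructor
      · rintro ⟨-, h1, -⟩
        refine ⟨hj, ?_⟩
        by_contra! hc
        exact h1 j hj (hmj.2 hc)
      · rintro ⟨-, i, hi, hL⟩
        refine ⟨Or.inr ⟨rfl, hj, Or.inr rfl⟩, fun k hk hk' => ?_, hin⟩
        have := (hmk k hk).1 ((h m ltm k (hk.trans ltn)).1 hk').1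
        rw [this] at hk'
        exact hmj.1 hk' i hi hL
    · simp [hj]

end

/-! ### From comparator circuits to lfm-matchings of graphs of degree three -/

/-- The first wire of gate `t` of the circuit `G` with `n` gates. The gates from number `n` on are
idle. -/
noncomputable def gateFst (M : Structure.{u}) [IsVZero M] (n : M.Num) (G : M.Str) (t : M.Num) :
    M.Num :=
  if t < n then fstPr M (seq M G t) else 0

/-- The second wire of gate `t` of the circuit `G` with `n` gates. -/
noncomputable def gateSnd (M : Structure.{u}) [IsVZero M] (n : M.Num) (G : M.Str) (t : M.Num) :
    M.Num :=
  if t < n then sndPr M (seq M G t) else 0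

/-- The wire that gate `t` compares with the wire `j`, or `j` if there is none. -/
noncomputable def partner (M : Structure.{u}) [IsVZero M] (n : M.Num) (G : M.Str) (t j : M.Num) :
    M.Num :=
  if j = gateFst M n G t then gateSnd M n G t
  else if j = gateSnd M n G t then gateFst M n G t else j

open Classical in
/-- The position, in row `t` of the top nodes, of the node for wire `j` after `t` gates: the
wire on which the last gate puts the conjunction is moved to the last position `m`, so that the node
for the disjunction precedes it. -/
noncomputable def topSlot (M : Structure.{u}) [IsVZero M] (m n : M.Num) (G : M.Str) (t j : M.Num) :
    M.Num :=
  if ∃ u, u < t ∧ (u + 1 = t ∧ j = gateFst M n G u ∧ gateFst M n G u ≠ gateSnd M n G u)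
  then m else j

/-- The top node for wire `j` after `t` gates. It is matched to one of the bottom nodes of the rows
up to `t` if and only if the wire carries one. -/
noncomputable def topNode (M : Structure.{u}) [IsVZero M] (m n : M.Num) (G : M.Str) (t j : M.Num) :
    M.Num :=
  t * (m + 1) + topSlot M m n G t j

/-- The edges of the graph for the circuit `G` with input `I`.  The bottom node `j` of row `0` takes
the top node for the input on wire `j` if that input is one.  The bottom node `j` of row `t + 1` is
adjacent to the top node for wire `j` after `t` gates, which it takes if that node is free.  Otherwise
it takes one of the top nodes for the outputs of gate `t` on wire `j`: the two bottom nodes of the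
wires of the gate first fill the node for the disjunction, then the node for the conjunction. -/
def GadgetEdge (M : Structure.{u}) [IsVZero M] (m n : M.Num) (G I : M.Str) (a b : M.Num) : Prop :=
  (∃ j, j < m ∧ (j ∈ I ∧ a = j ∧ b = j)) ∨
  ∃ t, t ≤ n ∧ ∃ j, j < m ∧ (a = (t + 1) * (m + 1) + j ∧ (b = topNode M m n G t j ∨
    b = topNode M m n G (t + 1) j ∨ b = topNode M m n G (t + 1) (partner M n G t j)))

/-- The edge matrix with entries `GadgetEdge`. -/
noncomputable def gadgetGraph (M : Structure.{u}) [IsVZero M] (m n : M.Num) (G I : M.Str) : M.Str :=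
  relStr M ((n + 1 + 1) * (m + 1)) ((n + 1 + 1) * (m + 1)) (GadgetEdge M m n G I)

section
variable {ι : Type w} {S : ι → Structure.{u}} [∀ i, IsVZero (S i)] {nums : Set (∀ i, (S i).Num)}
  {strs : Set (∀ i, (S i).Str)} {d : ℕ} {m n f g : ∀ i, (Fin d → (S i).Num) → (S i).Num}
  {G I : ∀ i, (Fin d → (S i).Num) → (S i).Str}

theorem DefN.gateFst (hn : DefN S nums strs d n) (hG : DefS S nums strs d G)
    (hf : DefN S nums strs d f) :
    DefN S nums strs d (fun i v => gateFst (S i) (n i v) (G i v) (f i v)) :=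
  .ite (.lt hf hn) (.fstPr (.seq hG hf)) .zero

theorem DefN.gateSnd (hn : DefN S nums strs d n) (hG : DefS S nums strs d G)
    (hf : DefN S nums strs d f) :
    DefN S nums strs d (fun i v => gateSnd (S i) (n i v) (G i v) (f i v)) :=
  .ite (.lt hf hn) (.sndPr (.seq hG hf)) .zero

theorem DefN.partner (hn : DefN S nums strs d n) (hG : DefS S nums strs d G)
    (hf : DefN S nums strs d f) (hg : DefN S nums strs d g) :
    DefN S nums strs d (fun i v => partner (S i) (n i v) (G i v) (f i v) (g i v)) :=
  .ite (.eq hg (.gateFst hn hG hf)) (.gateSnd hn hG hf)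
    (.ite (.eq hg (.gateSnd hn hG hf)) (.gateFst hn hG hf) hg)

theorem DefN.topSlot (hm : DefN S nums strs d m) (hn : DefN S nums strs d n)
    (hG : DefS S nums strs d G) (hf : DefN S nums strs d f) (hg : DefN S nums strs d g) :
    DefN S nums strs d (fun i v => topSlot (S i) (m i v) (n i v) (G i v) (f i v) (g i v)) :=
  .ite (.exLt hf (.and (.eq (.add (.coord _) .one) (hf.rename _))
    (.and (.eq (hg.rename _) (.gateFst (hn.rename _) (hG.rename _) (.coord _)))
      (.ne (.gateFst (hn.rename _) (hG.rename _) (.coord _))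
        (.gateSnd (hn.rename _) (hG.rename _) (.coord _)))))) hm hg

theorem DefN.topNode (hm : DefN S nums strs d m) (hn : DefN S nums strs d n)
    (hG : DefS S nums strs d G) (hf : DefN S nums strs d f) (hg : DefN S nums strs d g) :
    DefN S nums strs d (fun i v => topNode (S i) (m i v) (n i v) (G i v) (f i v) (g i v)) :=
  .add (.mul hf (.add hm .one)) (.topSlot hm hn hG hf hg)

theorem Def.gadgetEdge (hm : DefN S nums strs d m) (hn : DefN S nums strs d n)
    (hG : DefS S nums strs d G) (hI : DefS S nums strs d I) :
    Def S nums strs (d + 1 + 1) (fun i w => GadgetEdge (S i) (m i fun a => w a.castSucc.castSucc)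
      (n i fun a => w a.castSucc.castSucc) (G i fun a => w a.castSucc.castSucc)
      (I i fun a => w a.castSucc.castSucc) (w (Fin.last d).castSucc) (w (Fin.last (d + 1)))) := by
  have c : ∀ a : Fin (d + 4), DefN S nums strs (d + 4) (fun _ v => v a) := fun a => .coord a
  have hm' := hm.rename fun a => a.castSucc.castSucc.castSucc.castSucc
  have hn' := hn.rename fun a => a.castSucc.castSucc.castSucc.castSucc
  have hG' := hG.rename fun a => a.castSucc.castSucc.castSucc.castSucc
  refine .or (.exLt (hm.rename _) (.and (.mem (.coord _) (hI.rename _)) (.and (.eq (.coord _)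
    (.coord _)) (.eq (.coord _) (.coord _))))) (.exLe (hn.rename _) (.exLt
      (hm.rename fun a => a.castSucc.castSucc.castSucc) (.and (.eq (c _) (.add
        (.mul (.add (c _) .one) (.add hm' .one)) (c _))) (.or (.eq (c _) (.topNode hm' hn' hG' (c _) (c _)))
        (.or (.eq (c _) (.topNode hm' hn' hG' (.add (c _) .one) (c _)))
          (.eq (c _) (.topNode hm' hn' hG' (.add (c _) .one) (.partner hn' hG' (c _) (c _)))))))))

theorem DefS.gadgetGraph (hm : DefN S nums strs d m) (hn : DefN S nums strs d n)
    (hG : DefS S nums strs d G) (hI : DefS S nums strs d I) :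
    DefS S nums strs d (fun i v => gadgetGraph (S i) (m i v) (n i v) (G i v) (I i v)) :=
  .relStr (.mul (.add (.add hn .one) .one) (.add hm .one))
    (.mul (.add (.add hn .one) .one) (.add hm .one)) (.gadgetEdge hm hn hG hI)

end

section
variable {M : Structure.{u}} [IsVZero M] {m n t u j j' a b : M.Num} {G I : M.Str}

theorem mem_gadgetGraph (ha : a < (n + 1 + 1) * (m + 1)) (hb : b < (n + 1 + 1) * (m + 1)) :
    pr a b ∈ gadgetGraph M m n G I ↔ GadgetEdge M m n G I a b := by
  have hN : DefN (fun _ : Unit => M) Set.univ Set.univ 0 (fun _ _ => (n + 1 + 1) * (m + 1)) :=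
    .mul (.add (.add (.param n) .one) .one) (.add (.param m) .one)
  refine (Def.mem_relStr (R := fun _ _ a b => GadgetEdge M m n G I a b) hN hN
    (.gadgetEdge (.param m) (.param n) (.param G) (.param I)) () ![]).trans ?_
  exact ⟨fun h => h.2.2, fun h => ⟨ha, hb, h⟩⟩

theorem topSlot_zero : topSlot M m n G 0 j = j := by
  rw [topSlot, if_neg]
  rintro ⟨u, hu, -⟩
  exact absurd hu (not_lt.2 (num_zero_le u))

theorem topSlot_succ_of_ne (h : j = gateFst M n G t → gateFst M n G t = gateSnd M n G t) :
    topSlot M m n G (t + 1) j = j := by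
  rw [topSlot, if_neg]
  rintro ⟨u, -, e, h1, h2⟩
  obtain rfl := add_right_cancel e
  exact h2 (h h1)

theorem topSlot_succ_gateFst (h : gateFst M n G t ≠ gateSnd M n G t) :
    topSlot M m n G (t + 1) (gateFst M n G t) = m := by
  rw [topSlot, if_pos]
  exact ⟨t, num_lt_add_one_iff.2 le_rfl, rfl, rfl, h⟩

theorem topSlot_lt (hj : j < m) : topSlot M m n G t j < m + 1 := by
  rw [num_lt_add_one_iff, topSlot]
  split_ifs
  exacts [le_rfl, hj.le]

/-- At most one wire is moved to the position `m`, so different wires have different positions. -/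
theorem topSlot_inj (hj : j < m) (hj' : j' < m)
    (h : topSlot M m n G t j = topSlot M m n G t j') : j = j' := by
  rw [topSlot, topSlot] at h
  split_ifs at h with h1 h2 h2
  · obtain ⟨u, -, e, h1, -⟩ := h1
    obtain ⟨u', -, e', h2, -⟩ := h2
    obtain rfl := add_right_cancel (e.trans e'.symm)
    rw [h1, h2]
  · exact absurd h hj'.ne'
  · exact absurd h hj.ne
  · exact h

theorem topNode_inj (hj : j < m) (hj' : j' < m) :
    topNode M m n G t j = topNode M m n G u j' ↔ t = u ∧ j = j' := by
  rw [topNode, topNode, row_inj (topSlot_lt hj) (topSlot_lt hj')]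
  constructor
  · rintro ⟨rfl, h⟩
    exact ⟨rfl, topSlot_inj hj hj' h⟩
  · rintro ⟨rfl, rfl⟩
    exact ⟨rfl, rfl⟩

theorem topNode_lt_of_lt (hj : j < m) (h : t < u) : topNode M m n G t j < topNode M m n G u j' :=
  row_lt (topSlot_lt hj) h _

theorem topNode_lt (hj : j < m) (h : t ≤ n + 1) :
    topNode M m n G t j < (n + 1 + 1) * (m + 1) :=
  row_lt_mul (topSlot_lt hj) (num_lt_add_one_iff.2 h)

theorem partner_lt (hg : ∀ t, gateFst M n G t < m ∧ gateSnd M n G t < m) (hj : j < m) :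
    partner M n G t j < m := by
  rw [partner]
  split_ifs
  exacts [(hg t).2, (hg t).1, hj]

theorem partner_partner : partner M n G t (partner M n G t j) = j := by
  unfold partner
  grind

theorem gadgetEdge_row (ht : t ≤ n) (hj : j < m) :
    GadgetEdge M m n G I ((t + 1) * (m + 1) + j) b ↔ b = topNode M m n G t j ∨
      b = topNode M m n G (t + 1) j ∨ b = topNode M m n G (t + 1) (partner M n G t j) := by
  have hm : ∀ {x : M.Num}, x < m → x < m + 1 := fun h => num_lt_add_one_iff.2 h.le
  constructor
  · rintro (⟨j', hj', -, e, -⟩ | ⟨t', -, j', hj', e, h⟩)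
    · refine absurd e.symm (LT.lt.ne ?_)
      simpa using row_lt (t := 0) (hm hj') (num_lt_add_one_iff.2 (num_zero_le t)) j
    · obtain ⟨e', rfl⟩ := (row_inj (hm hj) (hm hj')).1 e
      obtain rfl := add_right_cancel e'
      exact h
  · exact fun h => Or.inr ⟨t, ht, j, hj, rfl, h⟩

theorem gadgetEdge_input (ha : a < m + 1) :
    GadgetEdge M m n G I a b ↔ a < m ∧ a ∈ I ∧ b = a := by
  constructor
  · rintro (⟨j, hj, hI, rfl, rfl⟩ | ⟨t, -, j, -, rfl, -⟩)
    · exact ⟨hj, hI, rfl⟩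
    · refine absurd ha (not_lt.2 ?_)
      have := row_lt (t := 0) ha (num_lt_add_one_iff.2 (num_zero_le t)) j
      rw [zero_mul, zero_add] at this
      exact absurd this (lt_irrefl _)
  · rintro ⟨h, hI, rfl⟩
    exact Or.inl ⟨b, h, hI, rfl, rfl⟩

/-- The neighbours of a top node: a node of the first row (if `t = 0`) or the two nodes for the
wires of gate `t - 1`, and the node of row `t + 1` that it feeds. -/
theorem GadgetEdge.eq_of_topNode (hg : ∀ t, gateFst M n G t < m ∧ gateSnd M n G t < m) (hj : j < m)
    (h : GadgetEdge M m n G I a (topNode M m n G t j)) :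
    (t = 0 ∧ a = j ∧ j ∈ I) ∨ a = (t + 1) * (m + 1) + j ∨
      ∃ u ≤ n, t = u + 1 ∧ (a = (u + 1) * (m + 1) + j ∨
        a = (u + 1) * (m + 1) + partner M n G u j) := by
  obtain ⟨i, hi, hI, rfl, e⟩ | ⟨u, hu, i, hi, rfl, e | e | e⟩ := h
  · have e' : topNode M m n G t j = topNode M m n G 0 a := by
      rw [e, topNode, topSlot_zero, zero_mul, zero_add]
    obtain ⟨rfl, rfl⟩ := (topNode_inj hj hi).1 e'
    exact Or.inl ⟨rfl, rfl, hI⟩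
  · obtain ⟨rfl, rfl⟩ := (topNode_inj hj hi).1 e
    exact Or.inr (Or.inl rfl)
  · obtain ⟨rfl, rfl⟩ := (topNode_inj hj hi).1 e
    exact Or.inr (Or.inr ⟨u, hu, rfl, Or.inl rfl⟩)
  · obtain ⟨rfl, rfl⟩ := (topNode_inj hj (partner_lt hg hi)).1 e
    exact Or.inr (Or.inr ⟨u, hu, rfl, Or.inr (by rw [partner_partner])⟩)

theorem not_four_of_three {p q r : M.Num} {P : M.Num → Prop}
    (h : ∀ x, P x → x = p ∨ x = q ∨ x = r) {x y z v : M.Num} (hy : y < x) (hz : z < y) (hv : v < z)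
    (h1 : P x) (h2 : P y) (h3 : P z) (h4 : P v) : False := by
  replace h1 := h _ h1
  replace h2 := h _ h2
  replace h3 := h _ h3
  replace h4 := h _ h4
  clear h
  grind

/-- Bottom nodes have three neighbours by definition, top nodes by `GadgetEdge.eq_of_topNode`. -/
theorem degreeThree_gadgetGraph (hg : ∀ t, gateFst M n G t < m ∧ gateSnd M n G t < m) :
    DegreeThree M ((n + 1 + 1) * (m + 1)) ((n + 1 + 1) * (m + 1)) (gadgetGraph M m n G I) := by
  constructor
  · rintro i hi ⟨a, ha, b, hb, c, hc, d, hd, h1, h2, h3, h4⟩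
    have hb' := hb.trans ha
    have hc' := hc.trans hb'
    rw [mem_gadgetGraph hi ha] at h1
    rw [mem_gadgetGraph hi hb'] at h2
    rw [mem_gadgetGraph hi hc'] at h3
    rw [mem_gadgetGraph hi (hd.trans hc')] at h4
    obtain ⟨p, q, r, h⟩ : ∃ p q r, ∀ x, GadgetEdge M m n G I i x → x = p ∨ x = q ∨ x = r := by
      obtain ⟨j, hj, -, rfl, -⟩ | ⟨t, ht, j, hj, rfl, -⟩ := id h1
      · refine ⟨i, i, i, fun x hx => Or.inl ?_⟩
        exact ((gadgetEdge_input (num_lt_add_one_iff.2 hj.le)).1 hx).2.2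
      · exact ⟨_, _, _, fun x hx => (gadgetEdge_row ht hj).1 hx⟩
    exact not_four_of_three h hb hc hd h1 h2 h3 h4
  · rintro i hi ⟨a, ha, b, hb, c, hc, d, hd, h1, h2, h3, h4⟩
    have hb' := hb.trans ha
    have hc' := hc.trans hb'
    rw [mem_gadgetGraph ha hi] at h1
    rw [mem_gadgetGraph hb' hi] at h2
    rw [mem_gadgetGraph hc' hi] at h3
    rw [mem_gadgetGraph (hd.trans hc') hi] at h4
    obtain ⟨t, j, hj, rfl⟩ : ∃ t j, j < m ∧ i = topNode M m n G t j := by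
      obtain ⟨j, hj, -, -, rfl⟩ | ⟨t, -, j, hj, -, e | e | e⟩ := id h1
      · exact ⟨0, i, hj, by rw [topNode, topSlot_zero, zero_mul, zero_add]⟩
      · exact ⟨_, _, hj, e⟩
      · exact ⟨_, _, hj, e⟩
      · exact ⟨_, _, partner_lt hg hj, e⟩
    obtain ⟨p, q, r, h⟩ : ∃ p q r, ∀ x, GadgetEdge M m n G I x (topNode M m n G t j) →
        x = p ∨ x = q ∨ x = r := by
      rcases eq_or_ne t 0 with rfl | ht
      · refine ⟨j, (0 + 1) * (m + 1) + j, j, fun x hx => ?_⟩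
        obtain ⟨-, h, -⟩ | h | ⟨u, -, h, -⟩ := hx.eq_of_topNode hg hj
        · exact Or.inl h
        · exact Or.inr (Or.inl h)
        · exact absurd h.symm (num_pos_iff.1 ((num_zero_le u).trans_lt
            (num_lt_add_one_iff.2 le_rfl)))
      · obtain ⟨u, rfl⟩ := num_exists_pred (num_pos_iff.2 ht)
        refine ⟨(u + 1 + 1) * (m + 1) + j, (u + 1) * (m + 1) + j,
          (u + 1) * (m + 1) + partner M n G u j, fun x hx => ?_⟩
        obtain ⟨h, -, -⟩ | h | ⟨u', -, e, h⟩ := hx.eq_of_topNode hg hj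
        · exact absurd h ht
        · exact Or.inl h
        · obtain rfl := add_right_cancel e
          exact Or.inr h
    exact not_four_of_three h hb hc hd h1 h2 h3 h4

end

/-! ### The lfm-matching of the graph of a comparator circuit -/

/-- The top node for wire `j` after `t` gates is matched to a bottom node of the rows up to `t`. -/
def Occupied (M : Structure.{u}) [IsVZero M] (m n : M.Num) (G L : M.Str) (t j : M.Num) : Prop :=
  ∃ a, a < (t + 1) * (m + 1) ∧ pr a (topNode M m n G t j) ∈ L

section
variable {M : Structure.{u}} [IsVZero M] {m n t j j' : M.Num} {G I L : M.Str}

theorem bottomNode_lt (ht : t ≤ n) (hj : j < m) :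
    (t + 1) * (m + 1) + j < (n + 1 + 1) * (m + 1) :=
  row_lt_mul (num_lt_add_one_iff.2 hj.le) (num_lt_add_one_iff.2 (add_le_add ht le_rfl))

theorem row_le_row {a b W : M.Num} (h : a ≤ b) : a * W ≤ b * W :=
  mul_le_mul h le_rfl (num_zero_le _) (num_zero_le _)

section
variable (hg : ∀ t, gateFst M n G t < m ∧ gateSnd M n G t < m)
  (hL : IsLfm M ((n + 1 + 1) * (m + 1)) ((n + 1 + 1) * (m + 1)) (gadgetGraph M m n G I) L)
include hg hL

theorem IsLfm.gadgetEdge {a b : M.Num} (ha : a < (n + 1 + 1) * (m + 1))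
    (hb : b < (n + 1 + 1) * (m + 1)) (h : pr a b ∈ L) : GadgetEdge M m n G I a b :=
  (mem_gadgetGraph ha hb).1 ((hL a ha b hb).1 h).1

/-- The nodes of the first rows represent the input. -/
theorem occupied_zero (hj : j < m) : Occupied M m n G L 0 j ↔ j ∈ I := by
  have hm1 : m + 1 ≤ (n + 1 + 1) * (m + 1) := by
    have := row_le_row (W := m + 1) (add_le_add (num_zero_le (n + 1)) (le_refl 1))
    rwa [zero_add, one_mul] at this
  have e : topNode M m n G 0 j = j := by rw [topNode, topSlot_zero, zero_mul, zero_add]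
  have hj' : j < m + 1 := num_lt_add_one_iff.2 hj.le
  simp only [Occupied, e, zero_add, one_mul]
  constructor
  · rintro ⟨a, ha, h⟩
    have h' := IsLfm.gadgetEdge hg hL (ha.trans_le hm1) (hj'.trans_le hm1) h
    obtain ⟨-, h1, rfl⟩ := (gadgetEdge_input ha).1 h'
    exact h1
  · intro h
    have lt := hj'.trans_le hm1
    refine ⟨j, hj', (hL j lt j lt).2 ⟨(mem_gadgetGraph lt lt).2
      ((gadgetEdge_input hj').2 ⟨hj, h, rfl⟩), fun k hk hk' => ?_, fun k hk hk' => ?_⟩⟩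
    · have h' := IsLfm.gadgetEdge hg hL lt (hk.trans lt) hk'
      exact hk.ne ((gadgetEdge_input hj').1 h').2.2
    · have h' := IsLfm.gadgetEdge hg hL (hk.trans lt) lt hk'
      exact hk.ne' ((gadgetEdge_input (hk.trans hj')).1 h').2.2

/-- A bottom node is matched to the top node that feeds it if and only if that node is free. -/
theorem mem_lfm_own (ht : t ≤ n) (hj : j < m) :
    pr ((t + 1) * (m + 1) + j) (topNode M m n G t j) ∈ L ↔ ¬ Occupied M m n G L t j := by
  have hb := bottomNode_lt ht hj
  have hp : topNode M m n G t j < (n + 1 + 1) * (m + 1) :=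
    topNode_lt hj (ht.trans (num_lt_add_one_iff.2 le_rfl).le)
  have lt1 : topNode M m n G t j < topNode M m n G (t + 1) j :=
    topNode_lt_of_lt hj (num_lt_add_one_iff.2 le_rfl)
  have lt2 : topNode M m n G t j < topNode M m n G (t + 1) (partner M n G t j) :=
    topNode_lt_of_lt hj (num_lt_add_one_iff.2 le_rfl)
  rw [hL _ hb _ hp, mem_gadgetGraph hb hp, gadgetEdge_row ht hj]
  constructor
  · rintro ⟨-, -, h⟩ ⟨a, ha, h'⟩
    exact h a (ha.trans_le (le_add_of_nonneg_right (num_zero_le _))) h'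
  · refine fun h => ⟨Or.inl rfl, fun k hk hk' => ?_, fun a ha h' => ?_⟩
    · rcases (gadgetEdge_row ht hj).1 (IsLfm.gadgetEdge hg hL hb (hk.trans hp) hk') with e | e | e
      · exact hk.ne e
      · exact (hk.trans lt1).ne e
      · exact (hk.trans lt2).ne e
    · rcases lt_or_ge a ((t + 1) * (m + 1)) with h1 | h1
      · exact h ⟨a, h1, h'⟩
      · obtain ⟨rfl, rfl, -⟩ | rfl | ⟨u, hu, rfl, e⟩ :=
          (IsLfm.gadgetEdge hg hL (ha.trans hb) hp h').eq_of_topNode hg hj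
        · rw [zero_add, one_mul] at h1
          exact absurd hj (not_lt.2 ((num_lt_add_one_iff.2 le_rfl).le.trans h1))
        · exact lt_irrefl _ ha
        · refine absurd h1 (not_le.2 ?_)
          rcases e with rfl | rfl
          · exact row_lt_mul (num_lt_add_one_iff.2 hj.le) (num_lt_add_one_iff.2 le_rfl)
          · exact row_lt_mul (num_lt_add_one_iff.2 (partner_lt hg hj).le)
              (num_lt_add_one_iff.2 le_rfl)

/-- A bottom node whose feeding top node is occupied takes the first free top node for the outputs of
its gate.  The condition involves only the bottom and top nodes of the two wires of the gate. -/
theorem mem_lfm_next (ht : t ≤ n) (hj : j < m) (hj' : j' = j ∨ j' = partner M n G t j) :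
    pr ((t + 1) * (m + 1) + j) (topNode M m n G (t + 1) j') ∈ L ↔ Occupied M m n G L t j ∧
      (∀ k, k = j ∨ k = partner M n G t j →
        topNode M m n G (t + 1) k < topNode M m n G (t + 1) j' →
        pr ((t + 1) * (m + 1) + j) (topNode M m n G (t + 1) k) ∉ L) ∧
      (∀ i, i = j' ∨ i = partner M n G t j' → i < j →
        pr ((t + 1) * (m + 1) + i) (topNode M m n G (t + 1) j') ∉ L) := by
  have hb := bottomNode_lt ht hj
  have hj'm : j' < m := by
    rcases hj' with rfl | rfl
    exacts [hj, partner_lt hg hj]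
  have ltt : t < t + 1 := num_lt_add_one_iff.2 le_rfl
  have hp : topNode M m n G (t + 1) j' < (n + 1 + 1) * (m + 1) :=
    topNode_lt hj'm (add_le_add ht le_rfl)
  have hedge : GadgetEdge M m n G I ((t + 1) * (m + 1) + j) (topNode M m n G (t + 1) j') := by
    rw [gadgetEdge_row ht hj]
    rcases hj' with rfl | rfl
    exacts [Or.inr (Or.inl rfl), Or.inr (Or.inr rfl)]
  have hown : Occupied M m n G L t j ↔ pr ((t + 1) * (m + 1) + j) (topNode M m n G t j) ∉ L := by
    rw [mem_lfm_own hg hL ht hj, not_not]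
  rw [hL _ hb _ hp, mem_gadgetGraph hb hp, and_iff_right hedge, hown]
  constructor
  · rintro ⟨h1, h2⟩
    exact ⟨h1 _ (topNode_lt_of_lt hj ltt), fun k _ hk => h1 _ hk,
      fun i _ hi => h2 _ (add_lt_add_right hi _)⟩
  · rintro ⟨h0, h1, h2⟩
    refine ⟨fun k hk hk' => ?_, fun a ha h' => ?_⟩
    · rcases (gadgetEdge_row ht hj).1 (IsLfm.gadgetEdge hg hL hb (hk.trans hp) hk') with
        rfl | rfl | rfl
      · exact h0 hk'
      · exact h1 j (Or.inl rfl) hk hk'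
      · exact h1 _ (Or.inr rfl) hk hk'
    · obtain ⟨e, -⟩ | rfl | ⟨u, hu, e, h⟩ :=
          (IsLfm.gadgetEdge hg hL (ha.trans hb) hp h').eq_of_topNode hg hj'm
      · exact absurd e.symm ((num_zero_le t).trans_lt ltt).ne
      · exact absurd ha
          (row_lt (num_lt_add_one_iff.2 hj.le) (num_lt_add_one_iff.2 le_rfl) _).not_gt
      · obtain rfl := add_right_cancel e
        rcases h with rfl | rfl
        · exact h2 _ (Or.inl rfl) (lt_of_add_lt_add_left ha) h'
        · exact h2 _ (Or.inr rfl) (lt_of_add_lt_add_left ha) h'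

/-- A top node after gate `t` can only be matched by the bottom nodes of the two wires of the gate. -/
theorem occupied_succ (ht : t ≤ n) (hj : j < m) : Occupied M m n G L (t + 1) j ↔
    pr ((t + 1) * (m + 1) + j) (topNode M m n G (t + 1) j) ∈ L ∨
    pr ((t + 1) * (m + 1) + partner M n G t j) (topNode M m n G (t + 1) j) ∈ L := by
  have lt : ∀ {i : M.Num}, i < m → (t + 1) * (m + 1) + i < (t + 1 + 1) * (m + 1) := fun hi =>
    row_lt_mul (num_lt_add_one_iff.2 hi.le) (num_lt_add_one_iff.2 le_rfl)
  have ltt : t < t + 1 := num_lt_add_one_iff.2 le_rfl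
  constructor
  · rintro ⟨a, ha, h⟩
    obtain ⟨e, -⟩ | rfl | ⟨u, hu, e, e' | e'⟩ :=
      (IsLfm.gadgetEdge hg hL (ha.trans_le (row_le_row (add_le_add (add_le_add ht le_rfl) le_rfl)))
        (topNode_lt hj (add_le_add ht le_rfl)) h).eq_of_topNode hg hj
    · exact absurd e.symm ((num_zero_le t).trans_lt ltt).ne
    · exact absurd ha (not_lt.2 (le_add_of_nonneg_right (num_zero_le _)))
    · obtain rfl := add_right_cancel e
      exact Or.inl (e' ▸ h)
    · obtain rfl := add_right_cancel e
      exact Or.inr (e' ▸ h)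
  · rintro (h | h)
    exacts [⟨_, lt hj, h⟩, ⟨_, lt (partner_lt hg hj), h⟩]

theorem mem_lfm_next_of_partner_eq (ht : t ≤ n) (hj : j < m) (hpj : partner M n G t j = j) :
    pr ((t + 1) * (m + 1) + j) (topNode M m n G (t + 1) j) ∈ L ↔ Occupied M m n G L t j := by
  rw [mem_lfm_next hg hL ht hj (Or.inl rfl), and_iff_left_iff_imp, hpj]
  refine fun _ => ⟨fun k hk hlt => ?_, fun i hi hlt => ?_⟩
  · rw [or_self] at hk
    exact absurd (hk ▸ hlt) (lt_irrefl _)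
  · rw [or_self] at hi
    exact absurd (hi ▸ hlt) (lt_irrefl _)

/-- One row of bottom nodes acts on the top nodes as the corresponding gate acts on the wires. -/
theorem compStep_occupied (ht : t ≤ n) : CompStep m (gateFst M n G t) (gateSnd M n G t)
    (Occupied M m n G L t) (Occupied M m n G L (t + 1)) := by
  have idle : ∀ j < m, partner M n G t j = j →
      (Occupied M m n G L (t + 1) j ↔ Occupied M m n G L t j) := fun j hj hpj => by
    rw [occupied_succ hg hL ht hj, hpj, or_self, mem_lfm_next_of_partner_eq hg hL ht hj hpj]
  obtain ⟨hx, hy⟩ := hg t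
  have hrest : ∀ j < m, j ≠ gateFst M n G t ∧ j ≠ gateSnd M n G t →
      (Occupied M m n G L (t + 1) j ↔ Occupied M m n G L t j) := fun j hj h =>
    idle j hj (by rw [partner, if_neg h.1, if_neg h.2])
  refine ⟨?_, ?_, hrest⟩ <;> clear hrest
  all_goals
    generalize hxd : gateFst M n G t = x at hx ⊢
    generalize hyd : gateSnd M n G t = y at hy ⊢
    have px : partner M n G t x = y := by rw [partner, hxd, if_pos rfl, hyd]
    have py : partner M n G t y = x := by
      rw [← px, partner_partner]
    rcases eq_or_ne x y with rfl | hne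
    · simp [idle x hx px]
  all_goals
    -- the node for the disjunction precedes the node for the conjunction
    have hlt : topNode M m n G (t + 1) y < topNode M m n G (t + 1) x := by
      rw [topNode, topNode, ← hxd, topSlot_succ_gateFst (by rwa [hxd, hyd]),
        topSlot_succ_of_ne fun h => absurd (h.trans hxd).symm hne]
      exact add_lt_add_right hy _
    have hxy := mem_lfm_next hg hL ht hx (j' := y) (Or.inr px.symm)
    have hyy := mem_lfm_next hg hL ht hy (j' := y) (Or.inl rfl)
    have hxx := mem_lfm_next hg hL ht hx (j' := x) (Or.inl rfl)
    have hyx := mem_lfm_next hg hL ht hy (j' := x) (Or.inr py.symm)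
    simp only [px, py, forall_eq_or_imp, forall_eq, lt_irrefl, hlt, hlt.not_gt, false_implies,
      true_implies, true_and, and_true] at hxy hyy hxx hyx
    rw [occupied_succ hg hL ht (by assumption)]
    first | rw [px] | rw [py]
    -- the result does not depend on which of the two bottom nodes comes first
    rcases lt_or_gt_of_ne hne with h | h <;> simp only [h, h.not_gt, false_implies, true_implies,
      and_true] at hxy hyy hxx hyx
    all_goals
      generalize (pr ((t + 1) * (m + 1) + x) (topNode M m n G (t + 1) y) ∈ L) = a at *
      generalize (pr ((t + 1) * (m + 1) + y) (topNode M m n G (t + 1) y) ∈ L) = b at *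
      generalize (pr ((t + 1) * (m + 1) + x) (topNode M m n G (t + 1) x) ∈ L) = c at *
      generalize (pr ((t + 1) * (m + 1) + y) (topNode M m n G (t + 1) x) ∈ L) = d at *
      generalize Occupied M m n G L t x = p at *
      generalize Occupied M m n G L t y = q at *
      clear idle
      by_cases p <;> by_cases q <;> simp_all

end
end

section
variable {M : Structure.{u}} [IsVZero M] {m n w : M.Num} {G I L Z : M.Str}

theorem gate_eq {t x y : M.Num} (ht : t < n) (h : pr x y = seq M G t) :
    gateFst M n G t = x ∧ gateSnd M n G t = y := by
  rw [gateFst, gateSnd, if_pos ht, if_pos ht, ← h, fstPr_pr, sndPr_pr]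
  exact ⟨rfl, rfl⟩

theorem ValidCcv.gate_lt (hv : ValidCcv M m n G) (hm : 0 < m) (t : M.Num) :
    gateFst M n G t < m ∧ gateSnd M n G t < m := by
  by_cases ht : t < n
  · obtain ⟨x, hx, y, hy, e⟩ := hv t ht
    rw [(gate_eq ht e).1, (gate_eq ht e).2]
    exact ⟨hx, hy⟩
  · rw [gateFst, gateSnd, if_neg ht, if_neg ht]
    exact ⟨hm, hm⟩

/-- The lfm-matching of `gadgetGraph` computes the layers of the circuit. -/
theorem occupied_iff_layers (hv : ValidCcv M m n G) (hm : 0 < m) (hZ : DeltaCCV M m n G I Z)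
    (hL : IsLfm M ((n + 1 + 1) * (m + 1)) ((n + 1 + 1) * (m + 1)) (gadgetGraph M m n G I) L) :
    ∀ t ≤ n, ∀ j < m, Occupied M m n G L t j ↔ pr t j ∈ Z := by
  have hg := hv.gate_lt hm
  have hd : ParamDef M 1 (fun v => v 0 ≤ n → ∀ j, j < m →
      ((∃ a, a < (v 0 + 1) * (m + 1) ∧ pr a (topNode M m n G (v 0) j) ∈ L) ↔ pr (v 0) j ∈ Z)) :=
    .imp (.le (.coord _) (.param n)) (.allLt (.param m) (.iff
      (.exLt (.mul (.add (.coord _) .one) (.add (.param m) .one)) (.mem (.pr (.coord _)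
        (.topNode (.param m) (.param n) (.param G) (.coord _) (.coord _))) (.param L)))
      (.mem (.pr (.coord _) (.coord _)) (.param Z))))
  intro t
  refine num_induction (P := fun t => t ≤ n → ∀ j < m, (Occupied M m n G L t j ↔ pr t j ∈ Z))
    hd ?_ ?_ t
  · exact fun _ j hj => (occupied_zero hg hL hj).trans (hZ.1 j hj)
  · intro t ih ht
    rw [num_add_one_le_iff] at ht
    obtain ⟨x, hx, y, hy, e⟩ := hv t ht
    have h := compStep_occupied hg hL ht.le
    rw [(gate_eq ht e).1, (gate_eq ht e).2] at h
    exact h.congr hx hy (hZ.2 t ht x hx y hy e) (ih ht.le)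

theorem topNode_last (h : gateFst M n G n = gateSnd M n G n) :
    topNode M m n G (n + 1) w = (n + 1) * (m + 1) + w := by
  rw [topNode, topSlot_succ_of_ne fun _ => h]

/-- Gate `n` is the idle gate `⟨0, 0⟩`: it adds a last row of bottom nodes, each of which copies the
value of its wire to a top node at a known position. -/
theorem gate_idle : gateFst M n G n = 0 ∧ gateSnd M n G n = 0 := by
  rw [gateFst, gateSnd, if_neg (lt_irrefl n), if_neg (lt_irrefl n)]
  exact ⟨rfl, rfl⟩

/-- The output of the circuit on wire `w` as a matched top node. -/
theorem gadgetGraph_vertex (hv : ValidCcv M m n G) (hw : w < m) (hZ : DeltaCCV M m n G I Z)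
    (hL : IsLfm M ((n + 1 + 1) * (m + 1)) ((n + 1 + 1) * (m + 1)) (gadgetGraph M m n G I) L) :
    (∃ a < (n + 1 + 1) * (m + 1), pr a ((n + 1) * (m + 1) + w) ∈ L) ↔ pr n w ∈ Z := by
  have hm := (num_zero_le w).trans_lt hw
  have hi := gate_idle (M := M) (n := n) (G := G)
  have h := compStep_occupied (hv.gate_lt hm) hL le_rfl
  rw [hi.1, hi.2] at h
  rw [← occupied_iff_layers hv hm hZ hL n le_rfl w hw, ← h.self w hw, Occupied,
    topNode_last (hi.1.trans hi.2.symm)]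

/-- The output of the circuit on wire `w` as a matched edge. -/
theorem gadgetGraph_edge (hv : ValidCcv M m n G) (hw : w < m) (hZ : DeltaCCV M m n G I Z)
    (hL : IsLfm M ((n + 1 + 1) * (m + 1)) ((n + 1 + 1) * (m + 1)) (gadgetGraph M m n G I) L) :
    pr ((n + 1) * (m + 1) + w) ((n + 1) * (m + 1) + w) ∈ L ↔ pr n w ∈ Z := by
  have hm := (num_zero_le w).trans_lt hw
  have hi := gate_idle (M := M) (n := n) (G := G)
  have hp : partner M n G n w = w := by
    rw [partner, hi.1, hi.2]
    split_ifs with h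
    exacts [h.symm, rfl]
  rw [← occupied_iff_layers hv hm hZ hL n le_rfl w hw,
    ← mem_lfm_next_of_partner_eq (hv.gate_lt hm) hL le_rfl hw hp,
    topNode_last (hi.1.trans hi.2.symm)]

end

/-! ### Reductions between problems, uniformly in a family of structures -/

/-- An instance of a problem in one of the structures `T c`. -/
abbrev Instances {κ : Type w} (T : κ → Structure.{u}) (k l : ℕ) :=
  Σ c, (Fin k → (T c).Num) × (Fin l → (T c).Str)

section
variable {κ : Type w} (T : κ → Structure.{u}) (k l : ℕ)

/-- The number arguments of an instance. -/
abbrev numArgs : Set (∀ i : Instances T k l, (T i.1).Num) := Set.range fun a i => i.2.1 a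

/-- The string arguments of an instance. -/
abbrev strArgs : Set (∀ i : Instances T k l, (T i.1).Str) := Set.range fun b i => i.2.2 b

variable [∀ c, IsVZero (T c)]

/-- Number functions on the structures `T c` that are bounded by one number term and whose graph
is defined by one `Σ₀ᴮ`-formula. -/
def NumFun (f : ∀ c, (Fin k → (T c).Num) → (Fin l → (T c).Str) → (T c).Num) : Prop :=
  DefN (fun i : Instances T k l => T i.1) (numArgs T k l) (strArgs T k l) 0
    (fun i _ => f i.1 i.2.1 i.2.2)

/-- String functions on the structures `T c` whose length is bounded by one number term and whose
bit graph is defined by one `Σ₀ᴮ`-formula. -/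
def StrFun (F : ∀ c, (Fin k → (T c).Num) → (Fin l → (T c).Str) → (T c).Str) : Prop :=
  DefS (fun i : Instances T k l => T i.1) (numArgs T k l) (strArgs T k l) 0
    (fun i _ => F i.1 i.2.1 i.2.2)

end

section
variable {κ : Type w} {T : κ → Structure.{u}} [∀ c, IsVZero (T c)] {k l : ℕ}

theorem DefN.numArg {n : ℕ} (a : Fin k) : DefN (fun i : Instances T k l => T i.1)
    (numArgs T k l) (strArgs T k l) n (fun i _ => i.2.1 a) :=
  .num (f := fun i : Instances T k l => i.2.1 a) (Set.mem_range_self a)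

theorem DefS.strArg {n : ℕ} (b : Fin l) : DefS (fun i : Instances T k l => T i.1)
    (numArgs T k l) (strArgs T k l) n (fun i _ => i.2.2 b) :=
  .str (F := fun i : Instances T k l => i.2.2 b) (Set.mem_range_self b)

theorem termFun (t : NTerm k l) : NumFun T k l (fun c v V => t.eval (T c) v V) :=
  DefN.eval (S := fun i : Instances T k l => T i.1) (f := fun a i _ => i.2.1 a)
    (F := fun b i _ => i.2.2 b) DefN.numArg DefS.strArg t

theorem numFun_iff {f : ∀ c, (Fin k → (T c).Num) → (Fin l → (T c).Str) → (T c).Num} :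
    NumFun T k l f ↔ (∃ t : NTerm k l, ∀ c v V, f c v V ≤ t.eval (T c) v V) ∧
      ∃ φ : Formula (k + 1) l, φ.IsSigmaZeroB ∧ ∀ c v V y,
        φ.Realize (T c) (Fin.snoc (α := fun _ => (T c).Num) v y) V ↔ y = f c v V := by
  have app : ∀ {α : Type u} (v : Fin k → α), Fin.append v (![] : Fin 0 → α) = v := fun v => by
    funext a; exact Fin.append_left v ![] a
  constructor
  · rintro ⟨⟨t, ht, hle⟩, hd⟩
    obtain ⟨s, hs⟩ := ht.exists_nterm
    obtain ⟨φ, hφ, h⟩ := hd.exists_formula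
    refine ⟨⟨s, fun c v V => ?_⟩, φ, hφ, fun c v V y => ?_⟩
    · have := hs ⟨c, v, V⟩ ![]
      rw [app] at this
      rw [this]
      exact hle ⟨c, v, V⟩ ![]
    · have := h ⟨c, v, V⟩ (Fin.snoc (α := fun _ => (T c).Num) ![] y)
      rw [append_snoc_eq, app] at this
      refine this.trans ?_
      rw [Fin.snoc_last]
  · rintro ⟨⟨t, ht⟩, φ, hφ, h⟩
    have ht' := termFun (T := T) t
    refine ht'.of_le (fun i v => ht _ _ _) ?_
    refine (Def.realize hφ (n := 1) (f := fun a i v => Fin.snoc (α := fun _ => (T i.1).Num) i.2.1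
      (v 0) a) (F := fun b i _ => i.2.2 b) (fun a => ?_) DefS.strArg).congr
      fun i v => h _ _ _ _
    refine Fin.lastCases ?_ (fun a => ?_) a
    · simpa using DefN.coord _
    · simpa using DefN.numArg a

theorem strFun_iff {F : ∀ c, (Fin k → (T c).Num) → (Fin l → (T c).Str) → (T c).Str} :
    StrFun T k l F ↔ (∃ t : NTerm k l, ∀ c v V, (T c).len (F c v V) ≤ t.eval (T c) v V) ∧
      ∃ φ : Formula (k + 1) l, φ.IsSigmaZeroB ∧ ∀ c v V z,
        φ.Realize (T c) (Fin.snoc (α := fun _ => (T c).Num) v z) V ↔ z ∈ F c v V := by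
  have app : ∀ {α : Type u} (v : Fin k → α), Fin.append v (![] : Fin 0 → α) = v := fun v => by
    funext a; exact Fin.append_left v ![] a
  constructor
  · rintro ⟨⟨t, ht, hle⟩, hd⟩
    obtain ⟨s, hs⟩ := ht.exists_nterm
    obtain ⟨φ, hφ, h⟩ := hd.exists_formula
    refine ⟨⟨s, fun c v V => ?_⟩, φ, hφ, fun c v V y => ?_⟩
    · have := hs ⟨c, v, V⟩ ![]
      rw [app] at this
      rw [this]
      exact hle ⟨c, v, V⟩ ![]
    · have := h ⟨c, v, V⟩ (Fin.snoc (α := fun _ => (T c).Num) ![] y)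
      rw [append_snoc_eq, app] at this
      refine this.trans ?_
      rw [Fin.snoc_last]
  · rintro ⟨⟨t, ht⟩, φ, hφ, h⟩
    have ht' := termFun (T := T) t
    obtain ⟨⟨s, hs, hle⟩, -⟩ := ht'
    refine ⟨⟨s, hs, fun i v => (ht _ _ _).trans (hle i v)⟩, ?_⟩
    refine (Def.realize hφ (n := 1) (f := fun a i v => Fin.snoc (α := fun _ => (T i.1).Num) i.2.1
      (v 0) a) (F := fun b i _ => i.2.2 b) (fun a => ?_) DefS.strArg).congr
      fun i v => h _ _ _ _
    refine Fin.lastCases ?_ (fun a => ?_) a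
    · simpa using DefN.coord _
    · simpa using DefN.numArg a

variable {k' l' : ℕ} {f : ∀ c, (Fin k → (T c).Num) → (Fin l → (T c).Str) → Fin k' → (T c).Num}
  {F : ∀ c, (Fin k → (T c).Num) → (Fin l → (T c).Str) → Fin l' → (T c).Str}

theorem snoc_defN (hf : ∀ a, NumFun T k l (fun c v V => f c v V a)) (a : Fin (k' + 1)) :
    DefN (fun i : Instances T k l => T i.1) (numArgs T k l) (strArgs T k l) 1
      (fun i v => Fin.snoc (α := fun _ => (T i.1).Num) (f i.1 i.2.1 i.2.2) (v 0) a) := by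
  refine Fin.lastCases ?_ (fun a => ?_) a
  · simpa using DefN.coord _
  · simpa using DefN.rename (hf a) Fin.castSucc

/-- `AC⁰` functions are closed under composition. -/
theorem NumFun.comp {g : ∀ c, (Fin k' → (T c).Num) → (Fin l' → (T c).Str) → (T c).Num}
    (hg : NumFun T k' l' g) (hf : ∀ a, NumFun T k l (fun c v V => f c v V a))
    (hF : ∀ b, StrFun T k l (fun c v V => F c v V b)) :
    NumFun T k l (fun c v V => g c (f c v V) (F c v V)) := by
  obtain ⟨⟨t, ht⟩, φ, hφ, h⟩ := numFun_iff.1 hg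
  refine DefN.of_le (DefN.eval hf hF t) (fun i _ => ht _ _ _) ?_
  exact (Def.realize hφ (snoc_defN hf) fun b => DefS.rename (hF b) Fin.castSucc).congr
    fun i v => h _ _ _ _

theorem StrFun.comp {g : ∀ c, (Fin k' → (T c).Num) → (Fin l' → (T c).Str) → (T c).Str}
    (hg : StrFun T k' l' g) (hf : ∀ a, NumFun T k l (fun c v V => f c v V a))
    (hF : ∀ b, StrFun T k l (fun c v V => F c v V b)) :
    StrFun T k l (fun c v V => g c (f c v V) (F c v V)) := by
  obtain ⟨⟨t, ht⟩, φ, hφ, h⟩ := strFun_iff.1 hg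
  obtain ⟨⟨s, hs, hle⟩, -⟩ := DefN.eval hf hF t
  refine ⟨⟨s, hs, fun i v => (ht _ _ _).trans (hle i v)⟩, ?_⟩
  exact (Def.realize hφ (snoc_defN hf) fun b => DefS.rename (hF b) Fin.castSucc).congr
    fun i v => h _ _ _ _

end

/-- The problem `P` is reducible to the problem `Q` by functions that are uniformly
`Σ₀ᴮ`-definable in the structures `T c`, where the reduction has to be correct in the models of
`VCC*` only. -/
def UniformlyReduces {κ : Type w} (T : κ → Structure.{u}) [∀ c, IsVZero (T c)] {k l k' l' : ℕ}
    (P : ∀ c, (Fin k → (T c).Num) → (Fin l → (T c).Str) → Prop)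
    (Q : ∀ c, (Fin k' → (T c).Num) → (Fin l' → (T c).Str) → Prop) : Prop :=
  ∃ (f : ∀ c, (Fin k → (T c).Num) → (Fin l → (T c).Str) → Fin k' → (T c).Num)
    (F : ∀ c, (Fin k → (T c).Num) → (Fin l → (T c).Str) → Fin l' → (T c).Str),
    (∀ a, NumFun T k l (fun c v V => f c v V a)) ∧ (∀ b, StrFun T k l (fun c v V => F c v V b)) ∧
    ∀ c, IsVCC (T c) → ∀ v V, P c v V ↔ Q c (f c v V) (F c v V)

section
variable {κ : Type w} {T : κ → Structure.{u}} [∀ c, IsVZero (T c)] {k l k' l' k'' l'' : ℕ}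
  {P : ∀ c, (Fin k → (T c).Num) → (Fin l → (T c).Str) → Prop}
  {Q : ∀ c, (Fin k' → (T c).Num) → (Fin l' → (T c).Str) → Prop}
  {R : ∀ c, (Fin k'' → (T c).Num) → (Fin l'' → (T c).Str) → Prop}

theorem UniformlyReduces.trans (h : UniformlyReduces T P Q) (h' : UniformlyReduces T Q R) :
    UniformlyReduces T P R := by
  obtain ⟨f, F, hf, hF, h⟩ := h
  obtain ⟨g, H, hg, hH, h'⟩ := h'
  exact ⟨fun c v V => g c (f c v V) (F c v V), fun c v V => H c (f c v V) (F c v V),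
    fun a => (hg a).comp hf hF, fun b => (hH b).comp hf hF,
    fun c hc v V => (h c hc v V).trans (h' c hc _ _)⟩

end

/-! ### Provable reductions -/

theorem Formula.realize_exUniqueN {M : Structure.{u}} {k l : ℕ} {φ : Formula (k + 1) l}
    {v : Fin k → M.Num} {V : Fin l → M.Str} : φ.exUniqueN.Realize M v V ↔
      ∃! y, φ.Realize M (Fin.snoc (α := fun _ => M.Num) v y) V := by
  simp only [Formula.exUniqueN, Formula.Realize, Formula.realize_imp, Formula.realize_rename,
    snoc_comp_extendRen, NTerm.eval, Fin.snoc_last, Fin.snoc_castSucc]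
  rfl

theorem Formula.realize_exUniqueS {M : Structure.{u}} {k l : ℕ} {φ : Formula k (l + 1)}
    {v : Fin k → M.Num} {V : Fin l → M.Str} : φ.exUniqueS.Realize M v V ↔
      ∃! Y, φ.Realize M v (Fin.snoc (α := fun _ => M.Str) V Y) := by
  simp only [Formula.exUniqueS, Formula.Realize, Formula.realize_imp, Formula.realize_rename,
    snoc_comp_extendRen, Fin.snoc_last, Fin.snoc_castSucc]
  rfl

theorem realize_numGraph {M : Structure.{u}} [IsVZero M] {k l : ℕ} {t : NTerm k l}
    {φ : Formula (k + 1) l} {v : Fin k → M.Num} {V : Fin l → M.Str} {x y : M.Num}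
    (hx : x ≤ t.eval M v V)
    (h : ∀ y, φ.Realize M (Fin.snoc (α := fun _ => M.Num) v y) V ↔ y = x) :
    (numGraph t φ).Realize M (Fin.snoc (α := fun _ => M.Num) v y) V ↔ y = x := by
  rw [numGraph, Formula.realize_and, h, Formula.realize_le, NTerm.eval_liftN, NTerm.eval,
    Fin.snoc_last, and_iff_right_iff_imp]
  rintro rfl
  exact hx

theorem realize_strGraph {M : Structure.{u}} [IsVZero M] {k l : ℕ} {t : NTerm k l}
    {ψ : Formula (k + 1) l} {v : Fin k → M.Num} {V : Fin l → M.Str} {X Y : M.Str}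
    (hX : M.len X ≤ t.eval M v V)
    (h : ∀ z, ψ.Realize M (Fin.snoc (α := fun _ => M.Num) v z) V ↔ z ∈ X) :
    (strGraph t ψ).Realize M v (Fin.snoc (α := fun _ => M.Str) V Y) ↔ Y = X := by
  simp only [strGraph, Formula.realize_and, Formula.realize_le, Formula.realize_allLt,
    Formula.realize_iff, Formula.realize_liftS, h, Formula.realize_mem, NTerm.eval_liftS,
    NTerm.eval, Fin.snoc_last]
  constructor
  · rintro ⟨h1, h2⟩
    refine str_ext fun z => ⟨fun hz => ?_, fun hz => ?_⟩
    · exact (h2 z ((lt_len_of_mem hz).trans_le h1)).1 hz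
    · exact (h2 z ((lt_len_of_mem hz).trans_le hX)).2 hz
  · rintro rfl
    exact ⟨hX, fun z _ => Iff.rfl⟩

/-- The family of all models of `V⁰`. -/
abbrev vZeroModels : {M : Structure.{u} // IsVZero M} → Structure.{u} := Subtype.val

instance (c : {M : Structure.{u} // IsVZero M}) : IsVZero (vZeroModels c) := c.2

/-- A reduction that is uniform in all models of `V⁰` and correct in all models of `VCC*` is
provable, because provability is truth in all models. -/
theorem UniformlyReduces.provablyReduces {k l k' l' : ℕ} {P : Formula k l} {Q : Formula k' l'}
    (h : UniformlyReduces vZeroModels.{u} (fun c v V => P.Realize c.1 v V)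
      (fun c v V => Q.Realize c.1 v V)) : ProvablyReduces.{u} VCCStar P Q := by
  obtain ⟨f, F, hf, hF, h⟩ := h
  choose hf' φ hφ hfφ using fun a => numFun_iff.1 (hf a)
  choose s hs using hf'
  choose hF' ψ hψ hFψ using fun b => strFun_iff.1 (hF b)
  choose t ht using hF'
  refine ⟨s, φ, t, ψ, fun a => ⟨hφ a, fun M hM v V => ?_⟩, fun b => ⟨hψ b, fun M hM v V => ?_⟩,
    fun M hM v V => ?_⟩
  · let c : {M : Structure.{u} // IsVZero M} := ⟨M, ⟨hM⟩⟩
    have : IsVZero M := c.2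
    rw [Formula.realize_exUniqueN]
    have e := fun y => realize_numGraph (y := y) (hs a c v V) (hfφ a c v V)
    exact ⟨_, (e _).2 rfl, fun y hy => (e y).1 hy⟩
  · let c : {M : Structure.{u} // IsVZero M} := ⟨M, ⟨hM⟩⟩
    have : IsVZero M := c.2
    rw [Formula.realize_exUniqueS]
    have e := fun Y => realize_strGraph (Y := Y) (ht b c v V) (hFψ b c v V)
    exact ⟨_, (e _).2 rfl, fun Y hY => (e Y).1 hY⟩
  · have hc : IsVCC M := isVCC_iff.2 hM
    let c : {M : Structure.{u} // IsVZero M} := ⟨M, inferInstance⟩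
    have cN : ∀ x : Fin k' , (fun i => v (Fin.snoc (α := fun _ => Fin (k + k')) (Fin.castAdd k')
        (Fin.natAdd k x) i)) = Fin.snoc (α := fun _ => M.Num) (fun i => v (Fin.castAdd k' i))
          (v (Fin.natAdd k x)) := fun x => by
      funext i; refine Fin.lastCases ?_ (fun i => ?_) i <;> simp
    have cS : ∀ x : Fin l' , (fun i => V (Fin.snoc (α := fun _ => Fin (l + l')) (Fin.castAdd l')
        (Fin.natAdd l x) i)) = Fin.snoc (α := fun _ => M.Str) (fun i => V (Fin.castAdd l' i))
          (V (Fin.natAdd l x)) := fun x => by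
      funext i; refine Fin.lastCases ?_ (fun i => ?_) i <;> simp
    rw [reductionFormula, Formula.realize_imp, Formula.realize_and, Formula.realize_iff,
      Formula.realize_conj, Formula.realize_conj]
    simp only [Formula.realize_rename, cN, cS]
    rintro ⟨h1, h2⟩
    have e1 := funext fun a => (realize_numGraph (hs a c _ _) (hfφ a c _ _)).1 (h1 a)
    have e2 := funext fun b => (realize_strGraph (ht b c _ _) (hFψ b c _ _)).1 (h2 b)
    rw [e1, e2]
    exact h c hc _ _

/-! ### The reductions between the six problems -/

section
variable {ι : Type w} {S : ι → Structure.{u}} [∀ i, IsVZero (S i)] {nums : Set (∀ i, (S i).Num)}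
  {strs : Set (∀ i, (S i).Str)} {d : ℕ} {m n : ∀ i, (Fin d → (S i).Num) → (S i).Num}
  {G N E : ∀ i, (Fin d → (S i).Num) → (S i).Str}

theorem Def.validCcv (hm : DefN S nums strs d m) (hn : DefN S nums strs d n)
    (hG : DefS S nums strs d G) :
    Def S nums strs d (fun i v => ValidCcv (S i) (m i v) (n i v) (G i v)) :=
  .allLt hn (.exLt (hm.rename _) (.exLt (hm.rename fun a => a.castSucc.castSucc)
    (.eq (.pr (.coord _) (.coord _))
      (.seq (hG.rename fun a => a.castSucc.castSucc.castSucc) (.coord _)))))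

theorem Def.validCcvNeg (hm : DefN S nums strs d m) (hn : DefN S nums strs d n)
    (hG : DefS S nums strs d G) (hN : DefS S nums strs d N) :
    Def S nums strs d (fun i v => ValidCcvNeg (S i) (m i v) (n i v) (G i v) (N i v)) :=
  .allLt hn (.exLt (hm.rename _) (.or
    (.and (.mem (.coord _) (hN.rename fun a => a.castSucc.castSucc))
      (.eq (.coord _) (.seq (hG.rename fun a => a.castSucc.castSucc) (.coord _))))
    (.and (.not (.mem (.coord _) (hN.rename fun a => a.castSucc.castSucc)))
      (.exLt (hm.rename fun a => a.castSucc.castSucc) (.eq (.pr (.coord _) (.coord _))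
        (.seq (hG.rename fun a => a.castSucc.castSucc.castSucc) (.coord _)))))))

theorem Def.degreeThree (hm : DefN S nums strs d m) (hn : DefN S nums strs d n)
    (hE : DefS S nums strs d E) :
    Def S nums strs d (fun i v => DegreeThree (S i) (m i v) (n i v) (E i v)) := by
  have hE' := hE.rename fun a => a.castSucc.castSucc.castSucc.castSucc.castSucc
  have c : ∀ a : Fin (d + 5), DefN S nums strs (d + 5) (fun _ v => v a) := fun a => .coord a
  have hp : ∀ a b : Fin (d + 5), Def S nums strs (d + 5) (fun i v => pr (v a) (v b) ∈
      E i (fun a => v a.castSucc.castSucc.castSucc.castSucc.castSucc)) := fun a b =>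
    .mem (.pr (c a) (c b)) hE'
  exact .and
    (.allLt hm (.not (.exLt (hn.rename _) (.exLt (.coord _) (.exLt (.coord _) (.exLt (.coord _)
      (.and (hp _ _) (.and (hp _ _) (.and (hp _ _) (hp _ _))))))))))
    (.allLt hn (.not (.exLt (hm.rename _) (.exLt (.coord _) (.exLt (.coord _) (.exLt (.coord _)
      (.and (hp _ _) (.and (hp _ _) (.and (hp _ _) (hp _ _))))))))))

end

/-- The problem expressed by a formula, in the structures `T c`. -/
abbrev problemIn {κ : Type w} (T : κ → Structure.{u}) {k l : ℕ} (φ : Formula k l) (c : κ)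
    (v : Fin k → (T c).Num) (V : Fin l → (T c).Str) : Prop := φ.Realize (T c) v V

section
variable {κ : Type w} (T : κ → Structure.{u}) [∀ c, IsVZero (T c)]

open Classical in
/-- The graph is `gadgetGraph`, and the top node asked for is that of the output wire in the last
row.  An invalid circuit is mapped to a node outside the graph, which makes a negative instance. -/
theorem ccv_reduces_threeVLfmm :
    UniformlyReduces T (problemIn T formulaCcv) (problemIn T formulaThreeVLfmm) := by
  refine ⟨fun c v V => ![(v 1 + 1 + 1) * (v 0 + 1), (v 1 + 1 + 1) * (v 0 + 1),
      if v 2 < v 0 ∧ ValidCcv (T c) (v 0) (v 1) (V 0) then (v 1 + 1) * (v 0 + 1) + v 2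
      else (v 1 + 1 + 1) * (v 0 + 1)],
    fun c v V => ![gadgetGraph (T c) (v 0) (v 1) (V 0) (V 1)], ?_, ?_, fun c hc v V => ?_⟩
  · have h : NumFun T 3 2 (fun _ v _ => (v 1 + 1 + 1) * (v 0 + 1)) :=
      DefN.mul (.add (.add (.numArg 1) .one) .one) (.add (.numArg 0) .one)
    rw [Fin.forall_fin_succ, Fin.forall_fin_succ, Fin.forall_fin_one]
    exact ⟨h, h, DefN.ite (.and (.lt (.numArg 2) (.numArg 0))
      (.validCcv (.numArg 0) (.numArg 1) (.strArg 0)))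
      (.add (.mul (.add (.numArg 1) .one) (.add (.numArg 0) .one)) (.numArg 2)) h⟩
  · rw [Fin.forall_fin_one]
    exact DefS.gadgetGraph (.numArg 0) (.numArg 1) (.strArg 0) (.strArg 1)
  · obtain ⟨Z, hZ⟩ := IsVCC.exists_layers (v 0) (v 1) (V 0) (V 1)
    obtain ⟨-, L, -, -, hL⟩ := IsVCC.exists_lfm ((v 1 + 1 + 1) * (v 0 + 1))
      ((v 1 + 1 + 1) * (v 0 + 1)) (gadgetGraph (T c) (v 0) (v 1) (V 0) (V 1))
    rw [problemIn, problemIn, realize_formulaCcv_iff hZ, realize_formulaThreeVLfmm,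
      realize_formulaVLfmm_iff (L := L) (by exact hL)]
    by_cases h : v 2 < v 0 ∧ ValidCcv (T c) (v 0) (v 1) (V 0)
    · obtain ⟨hw, hv⟩ := h
      have hd := degreeThree_gadgetGraph (I := V 1) (hv.gate_lt ((num_zero_le _).trans_lt hw))
      have hlt := bottomNode_lt (le_refl (v 1)) hw
      simpa [hw, hv, hd, hlt] using (gadgetGraph_vertex hv hw hZ hL).symm
    · rw [← and_assoc]
      simp [h]

open Classical in
/-- The graph is `gadgetGraph`, and the edge asked for is that of the output wire in the last row. -/
theorem ccv_reduces_threeLfmm :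
    UniformlyReduces T (problemIn T formulaCcv) (problemIn T formulaThreeLfmm) := by
  refine ⟨fun c v V => ![(v 1 + 1 + 1) * (v 0 + 1), (v 1 + 1 + 1) * (v 0 + 1),
      (v 1 + 1) * (v 0 + 1) + v 2,
      if v 2 < v 0 ∧ ValidCcv (T c) (v 0) (v 1) (V 0) then (v 1 + 1) * (v 0 + 1) + v 2
      else (v 1 + 1 + 1) * (v 0 + 1)],
    fun c v V => ![gadgetGraph (T c) (v 0) (v 1) (V 0) (V 1)], ?_, ?_, fun c hc v V => ?_⟩
  · have h : NumFun T 3 2 (fun _ v _ => (v 1 + 1 + 1) * (v 0 + 1)) :=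
      DefN.mul (.add (.add (.numArg 1) .one) .one) (.add (.numArg 0) .one)
    have h' : NumFun T 3 2 (fun _ v _ => (v 1 + 1) * (v 0 + 1) + v 2) :=
      DefN.add (.mul (.add (.numArg 1) .one) (.add (.numArg 0) .one)) (.numArg 2)
    rw [Fin.forall_fin_succ, Fin.forall_fin_succ, Fin.forall_fin_succ, Fin.forall_fin_one]
    exact ⟨h, h, h', DefN.ite (.and (.lt (.numArg 2) (.numArg 0))
      (.validCcv (.numArg 0) (.numArg 1) (.strArg 0))) h' h⟩
  · rw [Fin.forall_fin_one]
    exact DefS.gadgetGraph (.numArg 0) (.numArg 1) (.strArg 0) (.strArg 1)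
  · obtain ⟨Z, hZ⟩ := IsVCC.exists_layers (v 0) (v 1) (V 0) (V 1)
    obtain ⟨-, L, -, -, hL⟩ := IsVCC.exists_lfm ((v 1 + 1 + 1) * (v 0 + 1))
      ((v 1 + 1 + 1) * (v 0 + 1)) (gadgetGraph (T c) (v 0) (v 1) (V 0) (V 1))
    rw [problemIn, problemIn, realize_formulaCcv_iff hZ, realize_formulaThreeLfmm,
      realize_formulaLfmm_iff (L := L) (by exact hL)]
    by_cases h : v 2 < v 0 ∧ ValidCcv (T c) (v 0) (v 1) (V 0)
    · obtain ⟨hw, hv⟩ := h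
      have hd := degreeThree_gadgetGraph (I := V 1) (hv.gate_lt ((num_zero_le _).trans_lt hw))
      have hlt := bottomNode_lt (le_refl (v 1)) hw
      simpa [hw, hv, hd, hlt] using (gadgetGraph_edge hv hw hZ hL).symm
    · rw [← and_assoc]
      simp [h]

open Classical in
/-- The identity, except that graphs of higher degree are mapped to negative instances. -/
theorem threeVLfmm_reduces_vLfmm :
    UniformlyReduces T (problemIn T formulaThreeVLfmm) (problemIn T formulaVLfmm) := by
  refine ⟨fun c v V => ![v 0, v 1, if DegreeThree (T c) (v 0) (v 1) (V 0) then v 2 else v 1],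
    fun c v V => ![V 0], ?_, ?_, fun c hc v V => ?_⟩
  · rw [Fin.forall_fin_succ, Fin.forall_fin_succ, Fin.forall_fin_one]
    exact ⟨DefN.numArg 0, DefN.numArg 1, DefN.ite (.degreeThree (.numArg 0) (.numArg 1)
      (.strArg 0)) (.numArg 2) (.numArg 1)⟩
  · rw [Fin.forall_fin_one]
    exact DefS.strArg 0
  · obtain ⟨-, L, -, -, hL⟩ := IsVCC.exists_lfm (v 0) (v 1) (V 0)
    rw [problemIn, problemIn, realize_formulaThreeVLfmm, realize_formulaVLfmm_iff hL,
      realize_formulaVLfmm_iff (L := L) (by exact hL)]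
    by_cases h : DegreeThree (T c) (v 0) (v 1) (V 0) <;> simp [h]

open Classical in
/-- The identity, except that graphs of higher degree are mapped to negative instances. -/
theorem threeLfmm_reduces_lfmm :
    UniformlyReduces T (problemIn T formulaThreeLfmm) (problemIn T formulaLfmm) := by
  refine ⟨fun c v V => ![v 0, v 1, v 2,
      if DegreeThree (T c) (v 0) (v 1) (V 0) then v 3 else v 1],
    fun c v V => ![V 0], ?_, ?_, fun c hc v V => ?_⟩
  · rw [Fin.forall_fin_succ, Fin.forall_fin_succ, Fin.forall_fin_succ, Fin.forall_fin_one]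
    exact ⟨DefN.numArg 0, DefN.numArg 1, DefN.numArg 2, DefN.ite (.degreeThree (.numArg 0)
      (.numArg 1) (.strArg 0)) (.numArg 3) (.numArg 1)⟩
  · rw [Fin.forall_fin_one]
    exact DefS.strArg 0
  · obtain ⟨-, L, -, -, hL⟩ := IsVCC.exists_lfm (v 0) (v 1) (V 0)
    rw [problemIn, problemIn, realize_formulaThreeLfmm, realize_formulaLfmm_iff hL,
      realize_formulaLfmm_iff (L := L) (by exact hL)]
    by_cases h : DegreeThree (T c) (v 0) (v 1) (V 0) <;> simp [h]

theorem vLfmm_reduces_lfmm :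
    UniformlyReduces T (problemIn T formulaVLfmm) (problemIn T formulaLfmm) := by
  refine ⟨fun c v V => ![v 0 + 1, v 1 + 1, v 0, v 1],
    fun c v V => ![vertexGraph (T c) (v 0) (v 1) (v 2) (V 0)], ?_, ?_, fun c hc v V => ?_⟩
  · rw [Fin.forall_fin_succ, Fin.forall_fin_succ, Fin.forall_fin_succ, Fin.forall_fin_one]
    exact ⟨DefN.add (.numArg 0) .one, DefN.add (.numArg 1) .one, DefN.numArg 0, DefN.numArg 1⟩
  · rw [Fin.forall_fin_one]
    exact DefS.vertexGraph (.numArg 0) (.numArg 1) (.numArg 2) (.strArg 0)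
  · obtain ⟨-, L, -, -, hL⟩ := IsVCC.exists_lfm (v 0 + 1) (v 1 + 1)
      (vertexGraph (T c) (v 0) (v 1) (v 2) (V 0))
    obtain ⟨hL', h⟩ := hL.of_vertexGraph
    have lt : ∀ x : (T c).Num, x < x + 1 := fun x => num_lt_add_one_iff.2 le_rfl
    rw [problemIn, problemIn, realize_formulaVLfmm_iff hL',
      realize_formulaLfmm_iff (L := L) (by exact hL)]
    simpa [lt] using h.symm

open Classical in
/-- If `(i, j)` is not an edge, then the output wire is chosen outside the circuit. -/
theorem lfmm_reduces_ccvNeg :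
    UniformlyReduces T (problemIn T formulaLfmm) (problemIn T formulaCcvNeg) := by
  refine ⟨fun c v V => ![v 0 + v 1, v 2 * v 1 + v 3 + 1 + 1,
      if v 2 < v 0 ∧ v 3 < v 1 ∧ pr (v 2) (v 3) ∈ V 0 then v 2 else v 0 + v 1],
    fun c v V => ![edgeCircuit (T c) (v 0) (v 1) (v 2) (v 3) (V 0), initialSegment (T c) (v 0),
      singletonStr (T c) (v 2 * v 1 + v 3)], ?_, ?_, fun c hc v V => ?_⟩
  · rw [Fin.forall_fin_succ, Fin.forall_fin_succ, Fin.forall_fin_one]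
    exact ⟨DefN.add (.numArg 0) (.numArg 1), DefN.add (.add (.add (.mul (.numArg 2) (.numArg 1))
      (.numArg 3)) .one) .one, DefN.ite (.and (.lt (.numArg 2) (.numArg 0)) (.and
      (.lt (.numArg 3) (.numArg 1)) (.mem (.pr (.numArg 2) (.numArg 3)) (.strArg 0))))
      (.numArg 2) (.add (.numArg 0) (.numArg 1))⟩
  · rw [Fin.forall_fin_succ, Fin.forall_fin_succ, Fin.forall_fin_one]
    exact ⟨DefS.edgeCircuit (.numArg 0) (.numArg 1) (.numArg 2) (.numArg 3) (.strArg 0),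
      DefS.initialSegment (.numArg 0),
      DefS.singletonStr (.add (.mul (.numArg 2) (.numArg 1)) (.numArg 3))⟩
  · obtain ⟨Z, L, hZ, hR, hL⟩ := IsVCC.exists_lfm (v 0) (v 1) (V 0)
    rw [problemIn, problemIn, realize_formulaLfmm_iff hL]
    by_cases h : v 2 < v 0 ∧ v 3 < v 1 ∧ pr (v 2) (v 3) ∈ V 0
    · obtain ⟨hi, hj, hE⟩ := h
      have hv := validCcvNeg_edgeCircuit (E := V 0) hi hj
      obtain ⟨Z', hZ'⟩ := IsVCC.exists_layers_neg hv (initialSegment (T c) (v 0))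
      rw [realize_formulaCcvNeg_iff (Z := Z') (by exact hZ')]
      have hlt : v 2 < v 0 + v 1 := hi.trans_le (le_add_of_nonneg_right (num_zero_le _))
      simpa [hi, hj, hE, hlt, hv] using (edgeCircuit_output hi hj hE hZ hR hZ').symm
    · rw [realize_formulaCcvNeg]
      have h' : ¬ (v 2 < v 0 ∧ v 3 < v 1 ∧ pr (v 2) (v 3) ∈ L) := fun ⟨hi, hj, hl⟩ =>
        h ⟨hi, hj, ((hL _ hi _ hj).1 hl).1⟩
      simp [h, h']

open Classical in
theorem ccvNeg_reduces_ccv :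
    UniformlyReduces T (problemIn T formulaCcvNeg) (problemIn T formulaCcv) := by
  refine ⟨fun c v V => ![v 0 + v 0 + 1, v 1 + v 1 + v 1,
      if v 2 < v 0 ∧ ValidCcvNeg (T c) (v 0) (v 1) (V 0) (V 2) then v 2 + v 2
      else v 0 + v 0 + 1],
    fun c v V => ![simCircuit (T c) (v 0) (v 1) (V 0) (V 2), simInput (T c) (v 0) (V 1)],
    ?_, ?_, fun c hc v V => ?_⟩
  · rw [Fin.forall_fin_succ, Fin.forall_fin_succ, Fin.forall_fin_one]
    have h : NumFun T 3 3 (fun _ v _ => v 0 + v 0 + 1) :=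
      DefN.add (.add (.numArg 0) (.numArg 0)) .one
    exact ⟨h, DefN.add (.add (.numArg 1) (.numArg 1)) (.numArg 1), DefN.ite (.and
      (.lt (.numArg 2) (.numArg 0)) (.validCcvNeg (.numArg 0) (.numArg 1) (.strArg 0) (.strArg 2)))
      (.add (.numArg 2) (.numArg 2)) h⟩
  · rw [Fin.forall_fin_succ, Fin.forall_fin_one]
    exact ⟨DefS.simCircuit (.numArg 0) (.numArg 1) (.strArg 0) (.strArg 2),
      DefS.simInput (.numArg 0) (.strArg 1)⟩
  · by_cases h : v 2 < v 0 ∧ ValidCcvNeg (T c) (v 0) (v 1) (V 0) (V 2)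
    · obtain ⟨hw, hv⟩ := h
      obtain ⟨Z, hZ⟩ := IsVCC.exists_layers (v 0 + v 0 + 1) (v 1 + v 1 + v 1)
        (simCircuit (T c) (v 0) (v 1) (V 0) (V 2)) (simInput (T c) (v 0) (V 1))
      obtain ⟨Z', hZ', e⟩ := exists_layers_of_simulation hv hZ
      rw [problemIn, problemIn, realize_formulaCcvNeg_iff hZ',
        realize_formulaCcv_iff (Z := Z) (by exact hZ)]
      have hlt : v 2 + v 2 < v 0 + v 0 + 1 :=
        (add_lt_add hw hw).trans (num_lt_add_one_iff.2 le_rfl)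
      simpa [hw, hv, hlt, validCcv_simCircuit hv] using e _ le_rfl _ hw
    · rw [problemIn, problemIn, realize_formulaCcvNeg, realize_formulaCcv, ← and_assoc]
      simp [h]

/-- Each of the six problems is reducible to each other one.  The reductions form a cycle through
`ccv`, `threeVLfmm`, `vLfmm`, `lfmm` and `ccvNeg`, and `threeLfmm` lies between `ccv` and `lfmm`. -/
theorem problems_equivalent (p q : Problem) :
    UniformlyReduces T (problemIn T p.formula) (problemIn T q.formula) := by
  have h3v : UniformlyReduces T (problemIn T formulaThreeVLfmm) (problemIn T formulaCcv) :=
    (threeVLfmm_reduces_vLfmm T).trans ((vLfmm_reduces_lfmm T).trans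
      ((lfmm_reduces_ccvNeg T).trans (ccvNeg_reduces_ccv T)))
  have h1 : UniformlyReduces T (problemIn T p.formula) (problemIn T formulaCcv) := by
    cases p
    · exact (ccv_reduces_threeVLfmm T).trans h3v
    · exact h3v
    · exact (vLfmm_reduces_lfmm T).trans ((lfmm_reduces_ccvNeg T).trans (ccvNeg_reduces_ccv T))
    · exact ccvNeg_reduces_ccv T
    · exact (threeLfmm_reduces_lfmm T).trans
        ((lfmm_reduces_ccvNeg T).trans (ccvNeg_reduces_ccv T))
    · exact (lfmm_reduces_ccvNeg T).trans (ccvNeg_reduces_ccv T)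
  have h2 : UniformlyReduces T (problemIn T formulaCcv) (problemIn T q.formula) := by
    have hl := (ccv_reduces_threeLfmm T).trans (threeLfmm_reduces_lfmm T)
    cases q
    · exact (ccv_reduces_threeVLfmm T).trans h3v
    · exact ccv_reduces_threeVLfmm T
    · exact (ccv_reduces_threeVLfmm T).trans (threeVLfmm_reduces_vLfmm T)
    · exact hl.trans (lfmm_reduces_ccvNeg T)
    · exact ccv_reduces_threeLfmm T
    · exact hl
  exact h1.trans h2

end

/-! ### The standard structure -/

theorem lt_strLen {X : Finset ℕ} {a : ℕ} (h : a ∈ X) : a < strLen X :=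
  Nat.lt_of_succ_le (Finset.le_sup (f := fun i => i + 1) h)

theorem mem_of_succ_eq_strLen {X : Finset ℕ} {a : ℕ} (h : a + 1 = strLen X) : a ∈ X := by
  have hX : X.Nonempty := by
    rw [Finset.nonempty_iff_ne_empty]
    rintro rfl
    simp [strLen] at h
  obtain ⟨b, hb, e⟩ := Finset.exists_mem_eq_sup X hX (fun i => i + 1)
  have : a + 1 = b + 1 := h.trans e
  obtain rfl : a = b := by omega
  exact hb

theorem strLen_le {X : Finset ℕ} {b : ℕ} (h : ∀ x ∈ X, x < b) : strLen X ≤ b :=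
  Finset.sup_le fun x hx => h x hx

instance isVZero_standard : IsVZero standard := by
  classical
  refine ⟨?_⟩
  rintro p (hp | ⟨k, l, y, φ, -, rfl⟩)
  · simp only [twoBasic, Set.mem_insert_iff, Set.mem_singleton_iff] at hp
    rcases hp with rfl | rfl | rfl | rfl | rfl | rfl | rfl | rfl | rfl | rfl | rfl | rfl | rfl |
      rfl | rfl <;> intro v V
    · exact Nat.succ_ne_zero _
    · rw [Formula.realize_imp]; exact Nat.succ.inj
    · rfl
    · rfl
    · rfl
    · rfl
    · rw [Formula.realize_imp]; exact fun h => Nat.le_antisymm h.1 h.2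
    · exact Nat.le_add_right _ _
    · exact Nat.zero_le _
    · exact Nat.le_total _ _
    · rw [Formula.realize_iff]
      have : ∀ a b : ℕ, a ≤ b ↔ a ≤ b + 1 ∧ ¬ a = b + 1 := by omega
      exact this (v 0) (v 1)
    · rw [Formula.realize_imp, Formula.realize_exLe]
      intro h
      obtain ⟨a, ha⟩ := Nat.exists_eq_succ_of_ne_zero h
      exact ⟨a, Nat.le_of_lt (Nat.lt_of_succ_le (Nat.le_of_eq ha.symm)), ha.symm⟩
    · rw [Formula.realize_imp]
      exact fun h => ⟨(lt_strLen h).le, (lt_strLen h).ne⟩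
    · rw [Formula.realize_imp]
      exact fun h => mem_of_succ_eq_strLen h
    · rw [Formula.realize_imp]
      rintro ⟨h1, h2⟩
      rw [Formula.allLt, Formula.realize_allLe] at h2
      simp only [Formula.realize_imp, Formula.realize_iff] at h2
      have h1 : strLen (V 0) = strLen (V 1) := h1
      refine Finset.ext fun x => ⟨fun hx => ?_, fun hx => ?_⟩
      · exact (h2 x (lt_strLen hx).le (lt_strLen hx).ne).1 hx
      · exact (h2 x ((lt_strLen hx).trans_eq h1.symm).le ((lt_strLen hx).trans_eq h1.symm).ne).2 hx
  · intro v V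
    obtain ⟨X, hX, h⟩ : ∃ X : standard.Str, standard.le (standard.len X) (v y) ∧
        ∀ z : standard.Num, standard.mem z X ↔ Nat.lt z (v y) ∧
          φ.Realize standard (Fin.snoc (α := fun _ => standard.Num) v z) V := by
      refine ⟨(Finset.range (v y)).filter (fun z : ℕ =>
        φ.Realize standard (Fin.snoc (α := fun _ => standard.Num) v z) V), ?_, fun z => ?_⟩
      · exact strLen_le fun x hx => Finset.mem_range.1 (Finset.mem_filter.1 hx).1
      · exact Finset.mem_filter.trans (and_congr_left' Finset.mem_range)
    refine (Formula.realize_exSLe ..).2 ⟨X, hX, ?_⟩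
    rw [Formula.allLt, Formula.realize_allLe]
    simp only [Formula.realize_imp, Formula.realize_iff, Formula.realize_liftS, Formula.Realize,
      NTerm.eval_liftN, NTerm.eval, Fin.snoc_last]
    exact fun x hx hne => (h x).trans (and_iff_right (Nat.lt_of_le_of_ne hx hne))

theorem standard_lt : @LT.lt standard.Num _ = @LT.lt ℕ _ := by
  funext a b
  have h : @LT.lt standard.Num _ a b ↔ standard.le a b ∧ ¬ standard.le b a := lt_iff_le_not_ge
  exact propext (h.trans Nat.lt_iff_le_and_not_ge.symm)

theorem standard_seq : seq standard = seqVal := by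
  funext (X : Finset ℕ) (i : ℕ)
  refine (eq_seq_iff.2 ?_).symm
  simp only [standard_lt]
  show (seqVal X i < strLen X ∧ pairCode i (seqVal X i) ∈ X ∧ ∀ z : ℕ, z < seqVal X i →
    pairCode i z ∉ X) ∨ (∀ z : ℕ, z < strLen X → pairCode i z ∉ X) ∧ seqVal X i = strLen X
  rw [seqVal]
  split_ifs with h
  · have := Finset.min'_mem _ h
    rw [Finset.mem_filter, Finset.mem_range] at this
    refine Or.inl ⟨this.1, this.2, fun z hz hz' => ?_⟩
    refine absurd hz (not_lt.2 (Finset.min'_le _ _ ?_))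
    exact Finset.mem_filter.2 ⟨Finset.mem_range.2 (hz.trans this.1), hz'⟩
  · refine Or.inr ⟨fun z hz hz' => h ⟨z, ?_⟩, rfl⟩
    exact Finset.mem_filter.2 ⟨Finset.mem_range.2 hz, hz'⟩

theorem deltaCcvNeg_standard {m n : ℕ} {G I N Z : Finset ℕ} : DeltaCcvNeg standard m n G I N Z ↔
    (∀ j < m, j ∈ I ↔ pairCode 0 j ∈ Z) ∧
    (∀ i < n, ∀ x < m, ∀ y < m, i ∉ N ∧ pairCode x y = seqVal G i →
      CompStep m x y (fun j => pairCode i j ∈ Z) (fun j => pairCode (i + 1) j ∈ Z)) ∧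
    (∀ i < n, ∀ x < m, i ∈ N ∧ x = seqVal G i →
      NegStep m x (fun j => pairCode i j ∈ Z) (fun j => pairCode (i + 1) j ∈ Z)) := by
  simp only [DeltaCcvNeg, CompStep, NegStep, standard_lt, standard_seq]
  rfl

theorem validCcvNeg_standard {m n : ℕ} {G N : Finset ℕ} : ValidCcvNeg standard m n G N ↔
    ∀ i < n, ∃ x < m, (i ∈ N ∧ x = seqVal G i) ∨ (i ∉ N ∧ ∃ y < m, pairCode x y = seqVal G i) := by
  simp only [ValidCcvNeg, standard_lt, standard_seq]
  rfl

theorem deltaLFMM_standard {m n : ℕ} {E L : Finset ℕ} : DeltaLFMM standard m n E L ↔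
    ∀ i < m, ∀ j < n, (pairCode i j ∈ L ↔ pairCode i j ∈ E ∧ (∀ k < j, pairCode i k ∉ L) ∧
      (∀ l < i, pairCode l j ∉ L) ∧ ∀ k < j, pairCode i k ∉ E ∨ ∃ i' < i, pairCode i' k ∈ L) := by
  simp only [DeltaLFMM, standard_lt]
  rfl

theorem degreeThree_standard {m n : ℕ} {E : Finset ℕ} : DegreeThree standard m n E ↔
    (∀ i < m, ¬ ∃ a < n, ∃ b < a, ∃ c < b, ∃ d < c,
      pairCode i a ∈ E ∧ pairCode i b ∈ E ∧ pairCode i c ∈ E ∧ pairCode i d ∈ E) ∧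
    (∀ j < n, ¬ ∃ a < m, ∃ b < a, ∃ c < b, ∃ d < c,
      pairCode a j ∈ E ∧ pairCode b j ∈ E ∧ pairCode c j ∈ E ∧ pairCode d j ∈ E) := by
  simp only [DegreeThree, standard_lt]
  rfl

/-! ### The standard structure is a model of `VCC*` -/

theorem pairCode_inj {x y x' y' : ℕ} : pairCode x y = pairCode x' y' ↔ x = x' ∧ y = y' :=
  pr_inj (M := standard)

open Classical in
/-- The values of the wires after `i` gates of a comparator circuit.  A number that codes no gate is
read as some gate, which does no harm because `δ_CCV` says nothing about it. -/
noncomputable def standardLayer (X Y : Finset ℕ) : ℕ → ℕ → Prop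
  | 0, j => j ∈ Y
  | i + 1, j =>
    if j = fstPr standard (seqVal X i) then
      standardLayer X Y i j ∧ standardLayer X Y i (sndPr standard (seqVal X i))
    else if j = sndPr standard (seqVal X i) then
      standardLayer X Y i (fstPr standard (seqVal X i)) ∨ standardLayer X Y i j
    else standardLayer X Y i j

theorem deltaCCV_standard {m n : ℕ} {X Y Z : Finset ℕ} : DeltaCCV standard m n X Y Z ↔
    (∀ j < m, j ∈ Y ↔ pairCode 0 j ∈ Z) ∧ ∀ i < n, ∀ x < m, ∀ y < m, pairCode x y = seqVal X i →
      CompStep m x y (fun j => pairCode i j ∈ Z) (fun j => pairCode (i + 1) j ∈ Z) := by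
  simp only [DeltaCCV, CompStep, standard_lt, standard_seq]
  rfl

instance isVCC_standard : IsVCC standard := by
  classical
  refine ⟨fun (m n : ℕ) (X Y : Finset ℕ) => ?_⟩
  obtain ⟨Z, hZ⟩ : ∃ Z : Finset ℕ, ∀ i ≤ n, ∀ j < m,
      (pairCode i j ∈ Z ↔ standardLayer X Y i j) := by
    refine ⟨((Finset.range (n + 1) ×ˢ Finset.range m).filter fun p =>
      standardLayer X Y p.1 p.2).image fun p => pairCode p.1 p.2, fun i hi j hj => ?_⟩
    simp only [Finset.mem_image, Finset.mem_filter, Finset.mem_product, Finset.mem_range,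
      Prod.exists]
    constructor
    · rintro ⟨a, b, ⟨-, h⟩, e⟩
      obtain ⟨rfl, rfl⟩ := pairCode_inj.1 e
      exact h
    · exact fun h => ⟨i, j, ⟨⟨Nat.lt_succ_of_le hi, hj⟩, h⟩, rfl⟩
  refine ⟨Z, deltaCCV_standard.2 ⟨fun j hj => (hZ 0 (Nat.zero_le _) j hj).symm, ?_⟩⟩
  intro i hi x hx y hy e
  have e1 : fstPr standard (seqVal X i) = x := by rw [← e]; exact fstPr_pr (M := standard) x y
  have e2 : sndPr standard (seqVal X i) = y := by rw [← e]; exact sndPr_pr (M := standard) x y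
  have hs : ∀ j, standardLayer X Y (i + 1) j ↔ if j = x then
      standardLayer X Y i j ∧ standardLayer X Y i y else if j = y then
      standardLayer X Y i x ∨ standardLayer X Y i j else standardLayer X Y i j := fun j => by
    rw [standardLayer, e1, e2]
    split_ifs <;> rfl
  have hi' : i + 1 ≤ n := hi
  refine ⟨?_, ?_, fun j hj hne => ?_⟩ <;> beta_reduce
  · rw [hZ _ hi' x hx, hZ _ hi.le x hx, hZ _ hi.le y hy, hs, if_pos rfl]
  · rw [hZ _ hi' y hy, hZ _ hi.le x hx, hZ _ hi.le y hy, hs]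
    split_ifs with h
    · rw [h, and_self, or_self]
    · rfl
    · exact absurd rfl ‹¬ y = y›
  · rw [hZ _ hi' j hj, hZ _ hi.le j hj, hs, if_neg hne.1, if_neg hne.2]

/-! ### The formulas represent the problems -/

section
variable {m n w : ℕ} {G I N Z E L : Finset ℕ}

theorem validCcvNeg_iff_exists_gate : ValidCcvNeg standard m n G N ↔
    ∀ i < n, ∃ g : Gate m, EncodesGate G N i g := by
  rw [validCcvNeg_standard]
  refine forall₂_congr fun i _ => ⟨?_, ?_⟩
  · rintro ⟨x, hx, ⟨hN, e⟩ | ⟨hN, y, hy, e⟩⟩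
    · exact ⟨.negation ⟨x, hx⟩, hN, e.symm⟩
    · exact ⟨.comparator ⟨x, hx⟩ ⟨y, hy⟩, hN, e.symm⟩
  · rintro ⟨⟨x, y⟩ | x, hN, e⟩
    · exact ⟨x, x.2, Or.inr ⟨hN, y, y.2, e.symm⟩⟩
    · exact ⟨x, x.2, Or.inl ⟨hN, e.symm⟩⟩

/-- Layer `k` contains the values of the wires after the first `k` gates. -/
theorem runCircuit_take {C : List (Gate m)} (hC : C.length = n)
    (henc : ∀ (i : ℕ) (hi : i < C.length), EncodesGate G N i C[i])
    (hZ : DeltaCcvNeg standard m n G I N Z) : ∀ k ≤ n, ∀ j : Fin m,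
      runCircuit (C.take k) (fun j => decide ((j : ℕ) ∈ I)) j = true ↔ pairCode k j ∈ Z := by
  rw [deltaCcvNeg_standard] at hZ
  obtain ⟨h0, h1, h2⟩ := hZ
  intro k
  induction k with
  | zero => intro _ j; simp [runCircuit, h0 j j.2]
  | succ k ih =>
    intro hk j
    have hk' : k < C.length := by omega
    have ih := ih (by omega)
    have he := henc k hk'
    have hrun : runCircuit (C.take (k + 1)) (fun j => decide ((j : ℕ) ∈ I)) =
        Gate.step (runCircuit (C.take k) (fun j => decide ((j : ℕ) ∈ I))) C[k] := by
      rw [runCircuit, runCircuit, List.take_add_one, List.getElem?_eq_getElem hk',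
        List.foldl_append]
      rfl
    rw [hrun]
    generalize runCircuit (C.take k) (fun j => decide ((j : ℕ) ∈ I)) = s at ih
    cases hg : C[k] with
    | comparator x y =>
      rw [hg] at he
      obtain ⟨a1, a2, a3⟩ := h1 k hk x x.2 y y.2 ⟨he.1, he.2.symm⟩
      beta_reduce at *
      simp only [Gate.step]
      split_ifs with hx hy
      · rw [hx, a1, ← ih, ← ih, Bool.and_eq_true]
      · rw [hy, a2, ← ih, ← ih, Bool.or_eq_true]
      · rw [a3 j j.2 ⟨fun e => hx (Fin.ext e), fun e => hy (Fin.ext e)⟩, ← ih]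
    | negation x =>
      rw [hg] at he
      obtain ⟨a1, a2⟩ := h2 k hk x x.2 ⟨he.1, he.2.symm⟩
      beta_reduce at *
      simp only [Gate.step]
      split_ifs with hx
      · rw [hx, a1, ← ih]
        simp
      · rw [a2 j j.2 fun e => hx (Fin.ext e), ← ih]

theorem circuitAccepts_iff (hZ : DeltaCcvNeg standard m n G I N Z) :
    CircuitAccepts m n w G I N ↔ w < m ∧ ValidCcvNeg standard m n G N ∧ pairCode n w ∈ Z := by
  rw [validCcvNeg_iff_exists_gate]
  constructor
  · rintro ⟨hw, C, hC, henc, hrun⟩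
    refine ⟨hw, fun i hi => ⟨C[i], henc i (hC ▸ hi)⟩, ?_⟩
    have := runCircuit_take hC henc hZ n le_rfl ⟨w, hw⟩
    rw [← hC, List.take_length] at this
    exact hC ▸ this.1 hrun
  · rintro ⟨hw, hg, hwZ⟩
    choose g hg using hg
    have hC : (List.ofFn fun i : Fin n => g i i.2).length = n := List.length_ofFn
    have henc : ∀ (i : ℕ) (hi : i < (List.ofFn fun i : Fin n => g i i.2).length),
        EncodesGate G N i (List.ofFn fun i : Fin n => g i i.2)[i] := fun i hi => by
      rw [List.getElem_ofFn]
      exact hg i _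
    refine ⟨hw, _, hC, henc, ?_⟩
    have := runCircuit_take hC henc hZ n le_rfl ⟨w, hw⟩
    rw [List.take_of_length_le hC.le] at this
    exact this.2 hwZ

/-- Bottom node `i` is matched to `b` if `b` is available and no `k < b` is. -/
theorem mem_lfmMatching_succ {i a b : ℕ} : (a, b) ∈ lfmMatching n E (i + 1) ↔
    (a, b) ∈ lfmMatching n E i ∨ a = i ∧ (b < n ∧ pairCode i b ∈ E ∧
      ∀ l, (l, b) ∉ lfmMatching n E i) ∧ ∀ k < b, pairCode i k ∈ E →
        ∃ l, (l, k) ∈ lfmMatching n E i := by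
  set A := (Finset.range n).filter
    (fun j => pairCode i j ∈ E ∧ j ∉ (lfmMatching n E i).image Prod.snd) with hA
  have hmem : ∀ k, k ∈ A ↔ k < n ∧ pairCode i k ∈ E ∧ ∀ l, (l, k) ∉ lfmMatching n E i := by
    intro k; simp [hA]
  rw [← hmem]
  have hstep : lfmMatching n E (i + 1) =
      if h : A.Nonempty then insert (i, A.min' h) (lfmMatching n E i) else lfmMatching n E i := rfl
  rw [hstep]
  split_ifs with h
  · rw [Finset.mem_insert, or_comm]
    refine or_congr_right ?_
    rw [Prod.mk.injEq]
    refine and_congr_right fun _ => ?_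
    constructor
    · rintro rfl
      have hm := A.min'_mem h
      refine ⟨hm, fun k hk hE => ?_⟩
      by_contra! hc
      exact absurd (A.min'_le k ((hmem k).2 ⟨hk.trans ((hmem _).1 hm).1, hE, hc⟩)) (not_le.2 hk)
    · rintro ⟨hb, hmin⟩
      refine le_antisymm ?_ (A.min'_le b hb)
      by_contra! hlt
      obtain ⟨-, hE, hc⟩ := (hmem _).1 (A.min'_mem h)
      obtain ⟨l, hl⟩ := hmin _ hlt hE
      exact hc l hl
  · rw [or_iff_left]
    rintro ⟨-, hb, -⟩
    exact h ⟨b, hb⟩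

/-- The partner of bottom node `a` is settled in step `a`. -/
theorem mem_lfmMatching {i a b : ℕ} : (a, b) ∈ lfmMatching n E i ↔
    a < i ∧ (a, b) ∈ lfmMatching n E (a + 1) := by
  have hlt : ∀ i a b, (a, b) ∈ lfmMatching n E i → a < i := by
    intro i
    induction i with
    | zero => intro a b h; simp [lfmMatching] at h
    | succ i ih =>
      intro a b h
      rcases mem_lfmMatching_succ.1 h with h | ⟨rfl, -⟩
      · exact (ih a b h).trans (Nat.lt_succ_self i)
      · exact Nat.lt_succ_self a
  induction i with
  | zero => exact ⟨fun h => absurd (hlt _ _ _ h) (Nat.not_lt_zero _),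
      fun h => absurd h.1 (Nat.not_lt_zero _)⟩
  | succ i ih =>
    rcases eq_or_ne a i with rfl | hne
    · exact (and_iff_right (Nat.lt_succ_self a)).symm
    · refine mem_lfmMatching_succ.trans ((or_iff_left fun h => hne h.1).trans (ih.trans ?_))
      refine and_congr_left fun _ => ?_
      omega

/-- The lfm-matching of the first `m` bottom nodes as a string. -/
def lfmString (m n : ℕ) (E : Finset ℕ) : Finset ℕ :=
  (lfmMatching n E m).image fun p => pairCode p.1 p.2

theorem mem_lfmString {a b : ℕ} :
    pairCode a b ∈ lfmString m n E ↔ (a, b) ∈ lfmMatching n E m := by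
  rw [lfmString, Finset.mem_image]
  constructor
  · rintro ⟨⟨a', b'⟩, h, e⟩
    obtain ⟨rfl, rfl⟩ := pairCode_inj.1 e
    exact h
  · exact fun h => ⟨(a, b), h, rfl⟩

/-- The formula `δ_LFMM` describes the matching that the greedy procedure yields. -/
theorem deltaLFMM_lfmString : DeltaLFMM standard m n E (lfmString m n E) := by
  rw [deltaLFMM_standard]
  intro i hi j hj
  have h : ∀ a < m, ∀ b, pairCode a b ∈ lfmString m n E ↔ (a, b) ∈ lfmMatching n E (a + 1) :=
    fun a ha b => by rw [mem_lfmString, mem_lfmMatching, and_iff_right ha]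
  have h' : ∀ b, (∃ l, (l, b) ∈ lfmMatching n E i) ↔ ∃ l < i, pairCode l b ∈ lfmString m n E := by
    refine fun b => exists_congr fun l => ?_
    rw [mem_lfmMatching]
    exact and_congr_right fun hl => (h l (hl.trans hi) b).symm
  have key : ∀ b, pairCode i b ∈ lfmString m n E ↔ (b < n ∧ pairCode i b ∈ E ∧
      ∀ l < i, pairCode l b ∉ lfmString m n E) ∧ ∀ k < b, pairCode i k ∈ E →
        ∃ l < i, pairCode l k ∈ lfmString m n E := by
    intro b
    have h1 : (i, b) ∉ lfmMatching n E i := fun h => absurd (mem_lfmMatching.1 h).1 (lt_irrefl i)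
    have h2 : (∀ l, (l, b) ∉ lfmMatching n E i) ↔ ∀ l < i, pairCode l b ∉ lfmString m n E := by
      have := not_congr (h' b)
      push Not at this
      exact this
    rw [h i hi, mem_lfmMatching_succ, or_iff_right h1, and_iff_right rfl, h2]
    simp only [h']
  rw [key]
  constructor
  · rintro ⟨⟨-, hE, h1⟩, h2⟩
    refine ⟨hE, fun k hk hL => ?_, h1, fun k hk => ?_⟩
    · obtain ⟨⟨-, hE', h3⟩, -⟩ := (key k).1 hL
      obtain ⟨l, hl, hl'⟩ := h2 k hk hE'
      exact h3 l hl hl'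
    · rw [← imp_iff_not_or]
      exact h2 k hk
  · rintro ⟨hE, -, h1, h2⟩
    exact ⟨⟨hj, hE, h1⟩, fun k hk hE' => (h2 k hk).resolve_left (not_not.2 hE')⟩

theorem card_filter_le_three {P : ℕ → Prop} [DecidablePred P] :
    ((Finset.range n).filter P).card ≤ 3 ↔
      ¬ ∃ a < n, ∃ b < a, ∃ c < b, ∃ d < c, P a ∧ P b ∧ P c ∧ P d := by
  rw [← not_lt, not_iff_not]
  constructor
  · intro h
    have hm := fun i => Finset.orderEmbOfCardLe_mem ((Finset.range n).filter P) h i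
    simp only [Finset.mem_filter, Finset.mem_range] at hm
    have hlt : ∀ i j : Fin 4, i < j → Finset.orderEmbOfCardLe ((Finset.range n).filter P) h i <
        Finset.orderEmbOfCardLe ((Finset.range n).filter P) h j := fun i j hij =>
      (OrderEmbedding.lt_iff_lt _).2 hij
    exact ⟨_, (hm 3).1, _, hlt 2 3 (by decide), _, hlt 1 2 (by decide), _, hlt 0 1 (by decide),
      (hm 3).2, (hm 2).2, (hm 1).2, (hm 0).2⟩
  · rintro ⟨a, ha, b, hb, c, hc, d, hd, h1, h2, h3, h4⟩
    have hsub : ({a, b, c, d} : Finset ℕ) ⊆ (Finset.range n).filter P := by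
      intro x hx
      simp only [Finset.mem_insert, Finset.mem_singleton] at hx
      rw [Finset.mem_filter, Finset.mem_range]
      rcases hx with rfl | rfl | rfl | rfl
      exacts [⟨ha, h1⟩, ⟨by omega, h2⟩, ⟨by omega, h3⟩, ⟨by omega, h4⟩]
    have hcard : ({a, b, c, d} : Finset ℕ).card = 4 := by
      have h1 : a ≠ b ∧ a ≠ c ∧ a ≠ d ∧ b ≠ c ∧ b ≠ d ∧ c ≠ d := by omega
      simp [h1]
    exact hcard.symm.le.trans (Finset.card_le_card hsub)

theorem degreeThree_iff_degreeLeThree : DegreeThree standard m n E ↔ DegreeLeThree m n E := by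
  rw [degreeThree_standard, DegreeLeThree]
  simp only [card_filter_le_three]

end

theorem represents_ccvNeg : Represents formulaCcvNeg relCcvNeg := by
  intro x X
  by_cases hv : ValidCcvNeg standard (x 0) (x 1) (X 0) (X 2)
  · obtain ⟨Z, hZ⟩ := IsVCC.exists_layers_neg (M := standard) hv (X 1)
    refine (realize_formulaCcvNeg_iff (M := standard) (V := X) hZ).trans ?_
    rw [standard_lt]
    exact (circuitAccepts_iff hZ).symm
  · refine iff_of_false (fun h => hv ((realize_formulaCcvNeg (M := standard) x X).1 h).2.1) ?_
    rintro ⟨-, C, hC, henc, -⟩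
    exact hv (validCcvNeg_iff_exists_gate.2 fun i hi => ⟨_, henc i (hC.symm ▸ hi)⟩)

/-- Comparator circuits are the circuits with no negation gates. -/
theorem represents_ccv : Represents formulaCcv relCcv := by
  intro x X
  obtain ⟨Z, hZ⟩ := IsVCC.exists_layers (M := standard) (x 0) (x 1) (X 0) (X 1)
  have hZ' : DeltaCcvNeg standard (x 0) (x 1) (X 0) (X 1) (∅ : Finset ℕ) Z := by
    refine ⟨hZ.1, fun i hi x hx y hy h => hZ.2 i hi x hx y hy h.2, fun i _ x _ h => ?_⟩
    exact absurd h.1 (Finset.notMem_empty (α := ℕ) i)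
  have hv : ValidCcvNeg standard (x 0) (x 1) (X 0) (∅ : Finset ℕ) ↔
      ValidCcv standard (x 0) (x 1) (X 0) := by
    refine forall₂_congr fun i _ => exists_congr fun x => and_congr_right fun _ => ?_
    have hi : ¬ Membership.mem (∅ : Finset ℕ) i := Finset.notMem_empty (α := ℕ) i
    exact ⟨fun h => (h.resolve_left fun h => hi h.1).2, fun h => Or.inr ⟨hi, h⟩⟩
  refine (realize_formulaCcv_iff (M := standard) (V := X) hZ).trans ?_
  rw [standard_lt, ← hv]
  exact (circuitAccepts_iff hZ').symm

theorem isLfm_lfmString (m n : ℕ) (E : Finset ℕ) : IsLfm standard m n E (lfmString m n E) :=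
  deltaLFMM_iff_isLfm.1 deltaLFMM_lfmString

theorem represents_vLfmm : Represents formulaVLfmm relVLfmm := by
  intro x X
  refine (realize_formulaVLfmm_iff (M := standard) (V := X)
    (isLfm_lfmString (x 0) (x 1) (X 0))).trans ?_
  rw [standard_lt]
  refine and_congr_right fun _ => exists_congr fun i => ?_
  refine (and_congr_right fun _ => mem_lfmString).trans ?_
  exact and_iff_right_of_imp fun h => (mem_lfmMatching.1 h).1

theorem represents_lfmm : Represents formulaLfmm relLfmm := by
  intro x X
  refine (realize_formulaLfmm_iff (M := standard) (V := X)
    (isLfm_lfmString (x 0) (x 1) (X 0))).trans ?_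
  rw [standard_lt]
  exact and_congr_right fun _ => and_congr_right fun _ => mem_lfmString

theorem represents_formula (p : Problem) : Represents p.formula p.rel := by
  cases p
  · exact represents_ccv
  · exact fun x X => (realize_formulaThreeVLfmm (M := standard) x X).trans
      (and_congr degreeThree_iff_degreeLeThree (represents_vLfmm x X))
  · exact represents_vLfmm
  · exact represents_ccvNeg
  · exact fun x X => (realize_formulaThreeLfmm (M := standard) x X).trans
      (and_congr degreeThree_iff_degreeLeThree (represents_lfmm x X))
  · exact represents_lfmm

/-! ### Reductions in the standard structure -/

/-- The family consisting of the standard structure. -/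
abbrev standardFamily : Unit → Structure.{0} := fun _ => standard

section
variable {k l k' l' : ℕ}

theorem numFun_standard_iff {f : (Fin k → ℕ) → (Fin l → Finset ℕ) → ℕ} :
    NumFun standardFamily k l (fun _ v V => f v V) ↔ InFACZeroNum f := by
  refine numFun_iff.trans (and_congr ?_ ?_)
  · exact exists_congr fun t => ⟨fun h => h (), fun h _ => h⟩
  · refine exists_congr fun φ => and_congr_right fun _ => ⟨fun h x X => ?_, fun h _ => ?_⟩
    · have := h () (fun i => x i.castSucc) X (x (Fin.last k))
      rwa [show (Fin.snoc (α := fun _ => standard.Num) (fun i : Fin k => x i.castSucc)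
        (x (Fin.last k)) : Fin (k + 1) → ℕ) = x from Fin.snoc_init_self x] at this
    · intro (v : Fin k → ℕ) (V : Fin l → Finset ℕ) (y : ℕ)
      have e : (fun i : Fin k => Fin.snoc (α := fun _ => ℕ) v y i.castSucc) = v :=
        funext fun i => Fin.snoc_castSucc ..
      have := h (Fin.snoc (α := fun _ => ℕ) v y) V
      beta_reduce at this
      rwa [e, Fin.snoc_last] at this

theorem strFun_standard_iff {F : (Fin k → ℕ) → (Fin l → Finset ℕ) → Finset ℕ} :
    StrFun standardFamily k l (fun _ v V => F v V) ↔ InFACZeroStr F := by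
  refine strFun_iff.trans (and_congr ?_ ?_)
  · exact exists_congr fun t => ⟨fun h => h (), fun h _ => h⟩
  · refine exists_congr fun φ => and_congr_right fun _ => ⟨fun h x X => ?_, fun h _ => ?_⟩
    · have := h () (fun i => x i.castSucc) X (x (Fin.last k))
      rwa [show (Fin.snoc (α := fun _ => standard.Num) (fun i : Fin k => x i.castSucc)
        (x (Fin.last k)) : Fin (k + 1) → ℕ) = x from Fin.snoc_init_self x] at this
    · intro (v : Fin k → ℕ) (V : Fin l → Finset ℕ) (y : ℕ)
      have e : (fun i : Fin k => Fin.snoc (α := fun _ => ℕ) v y i.castSucc) = v :=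
        funext fun i => Fin.snoc_castSucc ..
      have := h (Fin.snoc (α := fun _ => ℕ) v y) V
      beta_reduce at this
      rwa [e, Fin.snoc_last] at this

/-- For the standard structure, which is a model of `VCC*`, uniform reducibility is many-one `AC⁰`
reducibility. -/
theorem manyOneReduces_iff {R : Relation k l} {S : Relation k' l'} : ManyOneReduces R S ↔
    UniformlyReduces standardFamily (fun _ v V => R v V) (fun _ v V => S v V) := by
  constructor
  · rintro ⟨f, F, hf, hF, h⟩
    exact ⟨fun _ v V a => f a v V, fun _ v V b => F b v V,
      fun a => numFun_standard_iff.2 (hf a), fun b => strFun_standard_iff.2 (hF b),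
      fun _ _ v V => h v V⟩
  · rintro ⟨f, F, hf, hF, h⟩
    exact ⟨fun a v V => f () v V a, fun b v V => F () v V b,
      fun a => numFun_standard_iff.1 (hf a), fun b => strFun_standard_iff.1 (hF b),
      fun v V => h () isVCC_standard v V⟩

theorem ManyOneReduces.trans {k'' l'' : ℕ} {R : Relation k l} {S : Relation k' l'}
    {Q : Relation k'' l''} (h : ManyOneReduces R S) (h' : ManyOneReduces S Q) :
    ManyOneReduces R Q :=
  manyOneReduces_iff.2 ((manyOneReduces_iff.1 h).trans (manyOneReduces_iff.1 h'))

end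

theorem problem_manyOneReduces (p q : Problem) : ManyOneReduces p.rel q.rel := by
  obtain ⟨f, F, hf, hF, h⟩ := problems_equivalent standardFamily p q
  refine manyOneReduces_iff.2 ⟨f, F, hf, hF, fun c hc v V => ?_⟩
  exact (represents_formula p v V).symm.trans
    ((h c hc v V).trans (represents_formula q (f c v V) (F c v V)))

end TwoSorted

theorem corollary5 :
    (∀ p : TwoSorted.Problem, TwoSorted.Represents p.formula p.rel) ∧
    (∀ p q : TwoSorted.Problem,
      TwoSorted.ProvablyReduces.{u} TwoSorted.VCCStar p.formula q.formula) ∧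
    (∀ p : TwoSorted.Problem, TwoSorted.IsCCComplete p.rel) :=
  ⟨TwoSorted.represents_formula,
    fun p q => (TwoSorted.problems_equivalent _ p q).provablyReduces,
    fun p _ _ _ => ⟨fun h => h.trans (TwoSorted.problem_manyOneReduces .ccv p),
      fun h => h.trans (TwoSorted.problem_manyOneReduces p .ccv)⟩⟩
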